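/- **Setting.** A *meet-tree* is a lower semilattice $(T,\le,\wedge)$ in which every set $T_{<a}$ is linearly ordered; a *branch* is a maximal chain $\Gamma\subseteq T$, and $\pi_\Gamma(a)=\max\{b\in\Gamma : b\le a\}$. A *strong Fraïssé class* is a Fraïssé class with strong amalgamation and strong joint embedding (the images of the two given structures intersect exactly in the image of the common substructure, respectively in the substructure generated by $\emptyset$). Let $\mathcal L_{\mathrm R}$ be a finite relational language and $M$ a countably infinite $\mathcal L_{\mathrm R}$-structure that is the Fraïssé limit of a strong Fraïssé class. Let $\mathfrak T^M$ be its generic meet-tree expansion: an expansion of $M$ by a meet-tree order and its meet that is the Fraïssé limit of the class of all finite structures that are meet-trees and whose $\mathcal L_{\mathrm R}$-reduct is in the age of $M$. For a point $\gamma$ (a branch $\Gamma$), let $\mathfrak T^M_\gamma$ (respectively $\mathfrak T^M_\Gamma$) be the expansion of $\mathfrak T^M$ by a constant for $\gamma$ (respectively by a predicate for $\Gamma$ and a function symbol for $\pi_\Gamma$), and let $\langle X\rangle_\gamma$ (respectively $\langle X\rangle_\Gamma$) be the substructure generated by $X$. Assume that $M$ has a *free weak independence relation* $\perp^{\mathrm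 R}$: a ternary relation $A\perp_C B$ between finite subsets satisfying invariance, monotonicity, normality ($A\perp_CB\Rightarrow AC\perp_CBC$), left and right existence ($A\perp_AB$ and $A\perp_BB$), left and right base monotonicity (if $A\perp_CB$ and $C\subseteq D\subseteq A$ or $C\subseteq D\subseteq B$, then $A\perp_DB$), left and right transitivity (if $C\subseteq D\subseteq A$, $A\perp_DB$ and $D\perp_CB$, then $A\perp_CB$; if $C\subseteq D\subseteq B$, $A\perp_DB$ and $A\perp_CD$, then $A\perp_CB$), stationarity (if $a\perp_Cb$, $a'\perp_Cb'$, $a\equiv_Ca'$ and $b\equiv_Cb'$, then $ab\equiv_Ca'b'$), left and right extension (if $a\perp_Cb$ and $a\subseteq a'$, there is $a''\equiv_Ca'$ with $a''\perp_Cb$; if $a\perp_Cb$ and $b\subseteq b'$, there is $b''\equiv_Cb'$ with $a\perp_Cb''$), independent generation ($A\perp_CB\Rightarrow\langle ABC\rangle=\langle AC\rangle\cup\langle BC\rangle$), reflexivity ($a\perp_Ca\Rightarrow a\in\langle C\rangle$) and freeness (if $A\perp_CB$, $D\subseteq C$ and $\langle C\rangle\cap\langle AB\rangle\subseteq\langle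 D\rangle$, then $A\perp_DB$). Write $A\perp^{\gamma}_CB$ if (i) for all $a\in\langle AC\rangle_\gamma$, $b\in\langle BC\rangle_\gamma$ with $b\le a$ there is $c\in\langle C\rangle_\gamma$ with $b\le c\le a$, and (ii) for all $a\in\langle AC\rangle_\gamma$, $b\in\langle BC\rangle_\gamma$ with $a\wedge b\notin\langle C\rangle_\gamma$ there is $c\in\langle C\rangle_\gamma$ with $a\wedge c\ne b\wedge c$. Write $A\perp^{\Gamma}_CB$ for the same with $\langle\cdot\rangle_\Gamma$ in place of $\langle\cdot\rangle_\gamma$, where (ii) is required only if $\pi_\Gamma(a)=\pi_\Gamma(b)$. Let $A\perp^{\mathrm R\gamma}_CB$ mean that both $\langle AC\rangle_\gamma\perp^\gamma_{\langle C\rangle_\gamma}\langle BC\rangle_\gamma$ and $\langle AC\rangle_\gamma\perp^{\mathrm R}_{\langle C\rangle_\gamma}\langle BC\rangle_\gamma$, and define $\perp^{\mathrm R\Gamma}$ likewise from $\perp^\Gamma$, $\perp^{\mathrm R}$ and $\langle\cdot\rangle_\Gamma$. Independence of tuples is that of their ranges. For $\perp$ one of these two relations, an automorphism $f$ *moves $\perp$-right-maximally*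 (*$\perp$-left-maximally*) if every complete type $p$, in finitely many variables over a finite set $C$, in the language of the corresponding expansion ($\mathfrak T^M_\gamma$ or $\mathfrak T^M_\Gamma$) has a realisation $a$ in $\mathfrak T^M$ with $a\perp_Cf(a)$ (respectively $f(a)\perp_Ca$). An automorphism $\alpha$ of $\mathfrak T^M$ is an *infinite fan above $\gamma$* if $a\wedge\alpha^n(a)=\gamma$ for all $n\ge1$ and all $a\ge\gamma$; it is *strictly increasing* at $x$ if $\alpha(x)>x$. Automorphisms act on the left and $[\alpha,\beta]=\alpha^{-1}\beta^{-1}\alpha\beta$. **Lemma.** Let $\Gamma$ be a branch and $\gamma$ a point of $\mathfrak T^M$. 1. Let $\alpha$ be an automorphism of $\mathfrak T^M$ that is an infinite fan above $\gamma$ and strictly increasing at every $x<\gamma$. Then there is an automorphism $\beta$ of $\mathfrak T^M$ fixing $\gamma$ such that $[\beta,\alpha]$ moves $\perp^{\mathrm R\gamma}$-right-maximally and $[\alpha,\beta]$ moves $\perp^{\mathrm R\gamma}$-left-maximally. 2. Let $\alpha$ be an automorphism of $\mathfrak T^M$ that setwise fixes $\Gamma$ and is strictly increasing at every $x\in\Gamma$.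 Then there is an automorphism $\beta$ of $\mathfrak T^M$ setwise fixing $\Gamma$ such that $[\beta,\alpha]$ moves $\perp^{\mathrm R\Gamma}$-right-maximally and $[\alpha,\beta]$ moves $\perp^{\mathrm R\Gamma}$-left-maximally. -/

import Mathlib

open FirstOrder CategoryTheory

universe u v u' v' w

namespace MeetTree

/-! ### Meet-trees, branches, and special automorphisms -/

/-- A meet-tree is a lower semilattice in which, for every point `a`, the set of points strictly
below `a` is linearly ordered. -/
class IsMeetTree (T : Type w) [SemilatticeInf T] : Prop where
  isChain_Iio : ∀ a : T, IsChain (· ≤ ·) (Set.Iio a)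

/-- A branch of `T` is a maximal chain. -/
def IsBranch {T : Type w} [SemilatticeInf T] (Γ : Set T) : Prop :=
  IsMaxChain (· ≤ ·) Γ

/-- In a meet-tree, for every branch `Γ` and every point `a`, there is a largest element of `Γ`
below `a`. -/
theorem IsBranch.exists_isGreatest {T : Type w} [SemilatticeInf T] [IsMeetTree T] {Γ : Set T}
    (hΓ : IsBranch Γ) (a : T) : ∃ b, IsGreatest {b | b ∈ Γ ∧ b ≤ a} b := by
  have tree : ∀ x y z : T, x ≤ z → y ≤ z → x ≤ y ∨ y ≤ x := by
    intro x y z hx hy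
    rcases hx.eq_or_lt with rfl | hx
    · exact Or.inr hy
    rcases hy.eq_or_lt with rfl | hy
    · exact Or.inl hx.le
    exact (IsMeetTree.isChain_Iio z).total hx hy
  have key : ∀ x : T, (∀ g ∈ Γ, x ≤ g ∨ g ≤ x) → x ∈ Γ := by
    intro x hx
    have hc : IsChain (· ≤ ·) (insert x Γ) := hΓ.1.insert fun g hg _ => hx g hg
    exact (hΓ.2 hc (Set.subset_insert x Γ)).symm ▸ Set.mem_insert x Γ
  by_cases ha : a ∈ Γ
  · exact ⟨a, ⟨ha, le_rfl⟩, fun b hb => hb.2⟩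
  · obtain ⟨g, hg, hga⟩ : ∃ g ∈ Γ, ¬ (a ≤ g ∨ g ≤ a) := by
      by_contra! h
      exact ha (key a fun g hg => by
        by_contra! h'
        exact absurd (h g hg) (by tauto))
    refine ⟨a ⊓ g, ⟨key _ fun x hx => ?_, inf_le_left⟩, fun b hb => le_inf hb.2 ?_⟩
    · rcases hΓ.1.total hx hg with h | h
      · exact tree _ _ g inf_le_right h
      · exact Or.inl (inf_le_right.trans h)
    · rcases hΓ.1.total hb.1 hg with h | h
      · exact h
      · exact absurd (Or.inr (h.trans hb.2)) hga

open Classical in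
/-- The branch-projection `π_Γ(a) = max {b ∈ Γ | b ≤ a}` (which exists when `Γ` is a branch of a
meet-tree; otherwise a junk value is taken if there is no maximum). -/
noncomputable def branchProj {T : Type w} [SemilatticeInf T] (Γ : Set T) (a : T) : T :=
  if h : ∃ b, IsGreatest {b | b ∈ Γ ∧ b ≤ a} b then h.choose else a

theorem IsBranch.branchProj_isGreatest {T : Type w} [SemilatticeInf T] [IsMeetTree T] {Γ : Set T}
    (hΓ : IsBranch Γ) (a : T) : IsGreatest {b | b ∈ Γ ∧ b ≤ a} (branchProj Γ a) := by
  have h := hΓ.exists_isGreatest a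
  rw [branchProj, dif_pos h]
  exact h.choose_spec

/-- `f` is a fan above `γ`: `a ⊓ f a = γ` for every `a ≥ γ`. -/
def IsFanAbove {T : Type w} [SemilatticeInf T] (f : T → T) (γ : T) : Prop :=
  ∀ a, γ ≤ a → a ⊓ f a = γ

/-- `f` is an infinite fan above `γ`: every positive power of `f` is a fan above `γ`. -/
def IsInfiniteFanAbove {T : Type w} [SemilatticeInf T] (f : T → T) (γ : T) : Prop :=
  ∀ n : ℕ, 0 < n → IsFanAbove (f^[n]) γ

/-- `f` is strictly increasing at every point of `S`. -/
def StrictlyIncreasingOn {T : Type w} [SemilatticeInf T] (f : T → T) (S : Set T) : Prop :=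
  ∀ x ∈ S, x < f x

/-! ### The languages of meet-trees, pointed meet-trees and branched meet-trees -/

/-- Function symbols for meet-trees: the meet. -/
inductive TreeFunctions : ℕ → Type
  | meet : TreeFunctions 2

/-- Relation symbols for meet-trees: the order. -/
inductive TreeRelations : ℕ → Type
  | le : TreeRelations 2

/-- Function symbols for pointed meet-trees: the meet and a constant. -/
inductive PointedFunctions : ℕ → Type
  | meet : PointedFunctions 2
  | point : PointedFunctions 0

/-- Function symbols for branched meet-trees: the meet and the branch-projection. -/
inductive BranchedFunctions : ℕ → Type
  | meet : BranchedFunctions 2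
  | proj : BranchedFunctions 1

/-- Relation symbols for branched meet-trees: the order and the branch. -/
inductive BranchedRelations : ℕ → Type
  | le : BranchedRelations 2
  | branch : BranchedRelations 1

/-- The language of meet-trees. -/
def treeLang : FirstOrder.Language.{0, 0} := ⟨TreeFunctions, TreeRelations⟩

/-- The language of pointed meet-trees. -/
def pointedLang : FirstOrder.Language.{0, 0} := ⟨PointedFunctions, TreeRelations⟩

/-- The language of branched meet-trees. -/
def branchedLang : FirstOrder.Language.{0, 0} := ⟨BranchedFunctions, BranchedRelations⟩

/-- A lower semilattice as a structure in the language of meet-trees. -/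
instance treeStructure (T : Type w) [SemilatticeInf T] : treeLang.Structure T where
  funMap := fun {_} f => match f with
    | TreeFunctions.meet => fun x => x 0 ⊓ x 1
  RelMap := fun {_} r => match r with
    | TreeRelations.le => fun x => x 0 ≤ x 1

/-- A lower semilattice with a distinguished point as a structure. -/
abbrev pointedStructure {T : Type w} [SemilatticeInf T] (γ : T) : pointedLang.Structure T where
  funMap := fun {_} f => match f with
    | PointedFunctions.meet => fun x => x 0 ⊓ x 1
    | PointedFunctions.point => fun _ => γ
  RelMap := fun {_} r => match r with
    | TreeRelations.le => fun x => x 0 ≤ x 1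

/-- A lower semilattice with a distinguished branch and its projection as a structure. -/
noncomputable abbrev branchedStructure {T : Type w} [SemilatticeInf T] (Γ : Set T) :
    branchedLang.Structure T where
  funMap := fun {_} f => match f with
    | BranchedFunctions.meet => fun x => x 0 ⊓ x 1
    | BranchedFunctions.proj => fun x => branchProj Γ (x 0)
  RelMap := fun {_} r => match r with
    | BranchedRelations.le => fun x => x 0 ≤ x 1
    | BranchedRelations.branch => fun x => x 0 ∈ Γ

/-- The structure on `T` in the union of `LR` and the language of pointed meet-trees. -/
abbrev expPointedStructure (LR : FirstOrder.Language.{u, v}) {T : Type w} [LR.Structure T] [SemilatticeInf T]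
    (γ : T) : (LR.sum pointedLang).Structure T :=
  letI := pointedStructure γ
  FirstOrder.Language.sumStructure LR pointedLang T

/-- The structure on `T` in the union of `LR` and the language of branched meet-trees. -/
noncomputable abbrev expBranchedStructure (LR : FirstOrder.Language.{u, v}) {T : Type w} [LR.Structure T]
    [SemilatticeInf T] (Γ : Set T) : (LR.sum branchedLang).Structure T :=
  letI := branchedStructure Γ
  FirstOrder.Language.sumStructure LR branchedLang T

instance countable_tree_functions (LR : FirstOrder.Language.{u, v}) [LR.IsRelational] :
    Countable (Σ l, (LR.sum treeLang).Functions l) := by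
  have : ∀ l, Countable ((LR.sum treeLang).Functions l) := fun l => by
    have h : Countable (TreeFunctions l) :=
      ⟨fun _ => 0, fun a b _ => by cases a; cases b; rfl⟩
    exact @instCountableSum _ _ _ h
  infer_instance

/-! ### Strong Fraïssé classes and generic meet-tree expansions -/

/-- Strong amalgamation: amalgamation in which the images of the two structures intersect exactly
in the image of the common substructure. -/
def StrongAmalgamation {L : FirstOrder.Language.{u, v}} (K : Set (Bundled.{w} L.Structure)) : Prop :=
  ∀ (A B C : Bundled.{w} L.Structure) (f : A ↪[L] B) (g : A ↪[L] C),
    A ∈ K → B ∈ K → C ∈ K →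
      ∃ (D : Bundled.{w} L.Structure) (f' : B ↪[L] D) (g' : C ↪[L] D), D ∈ K ∧
        f'.comp f = g'.comp g ∧ Set.range f' ∩ Set.range g' = Set.range (f'.comp f)

/-- Strong joint embedding: joint embedding in which the images of the two structures intersect
exactly in the substructure generated by the empty set. -/
def StrongJointEmbedding {L : FirstOrder.Language.{u, v}} (K : Set (Bundled.{w} L.Structure)) : Prop :=
  ∀ A B : Bundled.{w} L.Structure, A ∈ K → B ∈ K →
    ∃ (D : Bundled.{w} L.Structure) (f : A ↪[L] D) (g : B ↪[L] D), D ∈ K ∧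
      Set.range f ∩ Set.range g = (FirstOrder.Language.Substructure.closure L (∅ : Set D) : Set D)

/-- Strong Fraïssé classes. -/
structure IsStrongFraisse {L : FirstOrder.Language.{u, v}} (K : Set (Bundled.{w} L.Structure)) : Prop where
  isFraisse : FirstOrder.Language.IsFraisse K
  strongJointEmbedding : StrongJointEmbedding K
  strongAmalgamation : StrongAmalgamation K

/-- `M` is the Fraïssé limit of a strong Fraïssé class. -/
def IsStrongFraisseLimit (L : FirstOrder.Language.{u, v}) [Countable (Σ l, L.Functions l)] (M : Type w)
    [L.Structure M] [Countable M] : Prop :=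
  ∃ K : Set (Bundled.{w} L.Structure), IsStrongFraisse K ∧ FirstOrder.Language.IsFraisseLimit K M

/-- The mix of two classes of structures in disjoint languages: the structures in the union of the
languages whose reducts lie in the respective classes. -/
def mix {L₁ : FirstOrder.Language.{u, v}} {L₂ : FirstOrder.Language.{u', v'}} (K₁ : Set (Bundled.{w} L₁.Structure))
    (K₂ : Set (Bundled.{w} L₂.Structure)) : Set (Bundled.{w} (L₁.sum L₂).Structure) :=
  {N | (⟨N, (FirstOrder.Language.LHom.sumInl : L₁ →ᴸ L₁.sum L₂).reduct N⟩ : Bundled.{w} L₁.Structure) ∈ K₁ ∧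
    (⟨N, (FirstOrder.Language.LHom.sumInr : L₂ →ᴸ L₁.sum L₂).reduct N⟩ : Bundled.{w} L₂.Structure) ∈ K₂}

/-- The class of finite meet-trees, as structures in the language of meet-trees. -/
def finiteMeetTrees : Set (Bundled.{w} treeLang.Structure) :=
  {N | Finite N ∧ ∃ _ : SemilatticeInf N, IsMeetTree N ∧ N.str = treeStructure N}

/-- The meet-tree `T` with its `LR`-structure is the generic meet-tree expansion of the
`LR`-structure `T`: it is the Fraïssé limit of the mix of the age of the `LR`-structure `T` with
the class of finite meet-trees. -/
def IsGenericMeetTreeExpansion (LR : FirstOrder.Language.{u, v}) [LR.IsRelational] (T : Type w)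
    [LR.Structure T] [SemilatticeInf T] [Countable T] : Prop :=
  FirstOrder.Language.IsFraisseLimit (mix (LR.age T) finiteMeetTrees) T

/-! ### Types, generated substructures and independence relations

A ternary relation between finite subsets of `M` is given by `Ind : Set M → Set M → Set M → Prop`,
of which only the values on finite sets are ever considered. The statement `Ind A C B` reads
"`A` is independent of `B` over `C`". It is applied to tuples through their ranges. -/

/-- The underlying set of the substructure generated by `X`. -/
def gen {L : FirstOrder.Language.{u, v}} {M : Type w} (S : L.Structure M) (X : Set M) : Set M :=
  FirstOrder.Language.Substructure.closure L X

/-- The tuples `a` and `b` have the same type over `C`. -/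
def EqType {L : FirstOrder.Language.{u, v}} {M : Type w} (S : L.Structure M) (C : Set M) {ι : Type}
    (a b : ι → M) : Prop :=
  ∀ φ : L[[C]].Formula ι, φ.Realize a ↔ φ.Realize b

/-- Stationary weak independence relations. -/
structure IsStationaryWeakIndependence {L : FirstOrder.Language.{u, v}} {M : Type w} (S : L.Structure M)
    (Ind : Set M → Set M → Set M → Prop) : Prop where
  invariance : ∀ {k l m : ℕ} (a a' : Fin k → M) (c c' : Fin l → M) (b b' : Fin m → M),
    EqType S ∅ (Sum.elim a (Sum.elim c b)) (Sum.elim a' (Sum.elim c' b')) →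
      Ind (Set.range a) (Set.range c) (Set.range b) →
        Ind (Set.range a') (Set.range c') (Set.range b')
  monotonicity : ∀ {A B C A₀ B₀ : Set M}, A.Finite → B.Finite → C.Finite → A₀ ⊆ A → B₀ ⊆ B →
    Ind A C B → Ind A₀ C B₀
  normality : ∀ {A B C : Set M}, A.Finite → B.Finite → C.Finite →
    Ind A C B → Ind (A ∪ C) C (B ∪ C)
  left_existence : ∀ {A B : Set M}, A.Finite → B.Finite → Ind A A B
  right_existence : ∀ {A B : Set M}, A.Finite → B.Finite → Ind A B B
  left_base_monotonicity : ∀ {A B C D : Set M}, A.Finite → B.Finite → C ⊆ D → D ⊆ A →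
    Ind A C B → Ind A D B
  right_base_monotonicity : ∀ {A B C D : Set M}, A.Finite → B.Finite → C ⊆ D → D ⊆ B →
    Ind A C B → Ind A D B
  left_transitivity : ∀ {A B C D : Set M}, A.Finite → B.Finite → C ⊆ D → D ⊆ A →
    Ind A D B → Ind D C B → Ind A C B
  right_transitivity : ∀ {A B C D : Set M}, A.Finite → B.Finite → C ⊆ D → D ⊆ B →
    Ind A D B → Ind A C D → Ind A C B
  stationarity : ∀ {k m : ℕ} {C : Set M} (a a' : Fin k → M) (b b' : Fin m → M), C.Finite →
    Ind (Set.range a) C (Set.range b) → Ind (Set.range a') C (Set.range b') →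
      EqType S C a' a → EqType S C b' b → EqType S C (Sum.elim a' b') (Sum.elim a b)
  left_extension : ∀ {k l m : ℕ} {C : Set M} (a : Fin k → M) (a' : Fin l → M) (b : Fin m → M),
    C.Finite → Set.range a ⊆ Set.range a' → Ind (Set.range a) C (Set.range b) →
      ∃ a'' : Fin l → M, EqType S C a'' a' ∧ Ind (Set.range a'') C (Set.range b)
  right_extension : ∀ {k l m : ℕ} {C : Set M} (a : Fin k → M) (b : Fin m → M) (b' : Fin l → M),
    C.Finite → Set.range b ⊆ Set.range b' → Ind (Set.range a) C (Set.range b) →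
      ∃ b'' : Fin l → M, EqType S C b'' b' ∧ Ind (Set.range a) C (Set.range b'')

/-- Free weak independence relations. -/
structure IsFreeWeakIndependence {L : FirstOrder.Language.{u, v}} {M : Type w} (S : L.Structure M)
    (Ind : Set M → Set M → Set M → Prop) : Prop extends IsStationaryWeakIndependence S Ind where
  independent_generation : ∀ {A B C : Set M}, A.Finite → B.Finite → C.Finite → Ind A C B →
    gen S (A ∪ B ∪ C) = gen S (A ∪ C) ∪ gen S (B ∪ C)
  reflexivity : ∀ {a : M} {C : Set M}, C.Finite → Ind {a} C {a} → a ∈ gen S C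
  freeness : ∀ {A B C D : Set M}, A.Finite → B.Finite → C.Finite → D ⊆ C → Ind A C B →
    gen S C ∩ gen S (A ∪ B) ⊆ gen S D → Ind A D B

/-- Cone-independence above the point `γ`. -/
def ConeIndep {T : Type w} [SemilatticeInf T] (γ : T) (A C B : Set T) : Prop :=
  (∀ a ∈ gen (pointedStructure γ) (A ∪ C), ∀ b ∈ gen (pointedStructure γ) (B ∪ C), b ≤ a →
    ∃ c ∈ gen (pointedStructure γ) C, b ≤ c ∧ c ≤ a) ∧
  (∀ a ∈ gen (pointedStructure γ) (A ∪ C), ∀ b ∈ gen (pointedStructure γ) (B ∪ C),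
    a ⊓ b ∉ gen (pointedStructure γ) C →
      ∃ c ∈ gen (pointedStructure γ) C, a ⊓ c ≠ b ⊓ c)

/-- Branch-independence with respect to the branch `Γ`. -/
def BranchIndep {T : Type w} [SemilatticeInf T] (Γ : Set T) (A C B : Set T) : Prop :=
  (∀ a ∈ gen (branchedStructure Γ) (A ∪ C), ∀ b ∈ gen (branchedStructure Γ) (B ∪ C), b ≤ a →
    ∃ c ∈ gen (branchedStructure Γ) C, b ≤ c ∧ c ≤ a) ∧
  (∀ a ∈ gen (branchedStructure Γ) (A ∪ C), ∀ b ∈ gen (branchedStructure Γ) (B ∪ C),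
    branchProj Γ a = branchProj Γ b → a ⊓ b ∉ gen (branchedStructure Γ) C →
      ∃ c ∈ gen (branchedStructure Γ) C, a ⊓ c ≠ b ⊓ c)

/-- The mix of two independence relations, in a structure `S` in the union of the languages. -/
def MixIndep {L : FirstOrder.Language.{u, v}} {M : Type w} (S : L.Structure M)
    (Ind₁ Ind₂ : Set M → Set M → Set M → Prop) (A C B : Set M) : Prop :=
  Ind₁ (gen S (A ∪ C)) (gen S C) (gen S (B ∪ C)) ∧ Ind₂ (gen S (A ∪ C)) (gen S C) (gen S (B ∪ C))

/-- The independence relation on the expansion by the point `γ`, mixing cone-independence with the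
given independence relation of the `LR`-structure. -/
def PointedIndep (LR : FirstOrder.Language.{u, v}) {T : Type w} [LR.Structure T] [SemilatticeInf T]
    (IndR : Set T → Set T → Set T → Prop) (γ : T) : Set T → Set T → Set T → Prop :=
  MixIndep (expPointedStructure LR γ) (ConeIndep γ) IndR

/-- The independence relation on the expansion by the branch `Γ`, mixing branch-independence with
the given independence relation of the `LR`-structure. -/
def BranchedIndep (LR : FirstOrder.Language.{u, v}) {T : Type w} [LR.Structure T] [SemilatticeInf T]
    (IndR : Set T → Set T → Set T → Prop) (Γ : Set T) : Set T → Set T → Set T → Prop :=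
  MixIndep (expBranchedStructure LR Γ) (BranchIndep Γ) IndR

/-! ### Moving maximally -/

/-- The map `f` moves the type `p` over `C` right-maximally: some realisation `a` of `p` satisfies
`Ind a C (f a)`. -/
def MovesTypeRight {L : FirstOrder.Language.{u, v}} {M : Type w} [Nonempty M] (S : L.Structure M)
    (Ind : Set M → Set M → Set M → Prop) (f : M → M) (C : Set M) {n : ℕ}
    (p : (L[[C]].completeTheory M).CompleteType (Fin n)) : Prop :=
  ∃ a : Fin n → M, (L[[C]].completeTheory M).typeOf a = p ∧
    Ind (Set.range a) C (Set.range fun i => f (a i))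

/-- The map `f` moves the type `p` over `C` left-maximally: some realisation `a` of `p` satisfies
`Ind (f a) C a`. -/
def MovesTypeLeft {L : FirstOrder.Language.{u, v}} {M : Type w} [Nonempty M] (S : L.Structure M)
    (Ind : Set M → Set M → Set M → Prop) (f : M → M) (C : Set M) {n : ℕ}
    (p : (L[[C]].completeTheory M).CompleteType (Fin n)) : Prop :=
  ∃ a : Fin n → M, (L[[C]].completeTheory M).typeOf a = p ∧
    Ind (Set.range fun i => f (a i)) C (Set.range a)

/-- `f` moves right-maximally every type, in finitely many variables, over a finite set. -/
def MovesRightMaximally {L : FirstOrder.Language.{u, v}} {M : Type w} [Nonempty M] (S : L.Structure M)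
    (Ind : Set M → Set M → Set M → Prop) (f : M → M) : Prop :=
  ∀ (C : Set M), C.Finite → ∀ (n : ℕ) (p : (L[[C]].completeTheory M).CompleteType (Fin n)),
    MovesTypeRight S Ind f C p

/-- `f` moves left-maximally every type, in finitely many variables, over a finite set. -/
def MovesLeftMaximally {L : FirstOrder.Language.{u, v}} {M : Type w} [Nonempty M] (S : L.Structure M)
    (Ind : Set M → Set M → Set M → Prop) (f : M → M) : Prop :=
  ∀ (C : Set M), C.Finite → ∀ (n : ℕ) (p : (L[[C]].completeTheory M).CompleteType (Fin n)),
    MovesTypeLeft S Ind f C p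

/-- The commutator `[α, β] = α⁻¹ β⁻¹ α β`, where automorphisms act on the left. -/
def commutator {L : FirstOrder.Language.{u, v}} {M : Type w} [L.Structure M] (α β : M ≃[L] M) : M ≃[L] M :=
  α.symm.comp (β.symm.comp (α.comp β))

end MeetTree

namespace MeetTree

/-! ### Finite closed subsets of meet-trees and independence -/

section Tree

variable {S : Type w} [SemilatticeInf S]

/-- A finite set containing `γ` and closed under meets. -/
structure TreeClosed (γ : S) (X : Set S) : Prop where
  finite : X.Finite
  base : γ ∈ X
  inf : ∀ {x y}, x ∈ X → y ∈ X → x ⊓ y ∈ X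

/-- The set of all meets of two elements of `X ∪ {γ}`. -/
def treeClosure (γ : S) (X : Set S) : Set S :=
  {z | ∃ x ∈ insert γ X, ∃ y ∈ insert γ X, z = x ⊓ y}

/-- The pair `(e, z)` is independent over `C`, where `r` is `≤` or `≥`. -/
def Good (r : S → S → Prop) (C : Set S) (e z : S) : Prop :=
  (r z e → ∃ c ∈ C, r z c ∧ r c e) ∧ (e ⊓ z ∈ C ∨ ∃ c ∈ C, e ⊓ c ≠ z ⊓ c)

/-- The points `a` and `a'` have the same position relative to `D`. -/
def SamePosition (D : Set S) (a a' : S) : Prop :=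
  ∀ d ∈ D, (a ≤ d ∧ a' ≤ d) ∨ (¬ a ≤ d ∧ ¬ a' ≤ d ∧ a ⊓ d = a' ⊓ d)

/-- A relation which is either `≤` or `≥`. -/
def IsDirection (r : S → S → Prop) : Prop := r = (· ≤ ·) ∨ r = (· ≥ ·)

theorem IsDirection.flip {r : S → S → Prop} (h : IsDirection r) : IsDirection (flip r) := by
  rcases h with rfl | rfl
  · exact Or.inr rfl
  · exact Or.inl rfl

theorem IsDirection.refl {r : S → S → Prop} (h : IsDirection r) (x : S) : r x x := by
  rcases h with rfl | rfl <;> exact le_refl x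

theorem IsDirection.trans {r : S → S → Prop} (h : IsDirection r) {x y z : S} (hxy : r x y)
    (hyz : r y z) : r x z := by
  rcases h with rfl | rfl
  · exact le_trans hxy hyz
  · exact le_trans (α := S) hyz hxy

theorem IsDirection.antisymm {r : S → S → Prop} (h : IsDirection r) {x y : S} (hxy : r x y)
    (hyx : r y x) : x = y := by
  rcases h with rfl | rfl
  · exact le_antisymm hxy hyx
  · exact le_antisymm (α := S) hyx hxy

theorem IsDirection.map {r : S → S → Prop} (h : IsDirection r) (g : S ≃o S) {x y : S} :
    r (g x) (g y) ↔ r x y := by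
  rcases h with rfl | rfl <;> simp

theorem subset_treeClosure (γ : S) (X : Set S) : X ⊆ treeClosure γ X := fun x hx =>
  ⟨x, Or.inr hx, x, Or.inr hx, (inf_idem x).symm⟩

theorem treeClosure_minimal {γ : S} {X Y : Set S} (hY : TreeClosed γ Y) (h : X ⊆ Y) :
    treeClosure γ X ⊆ Y := by
  have h' : insert γ X ⊆ Y := Set.insert_subset hY.base h
  rintro z ⟨x, hx, y, hy, rfl⟩
  exact hY.inf (h' hx) (h' hy)

theorem treeClosure_mono {γ : S} {X Y : Set S} (h : X ⊆ Y) : treeClosure γ X ⊆ treeClosure γ Y := by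
  rintro z ⟨x, hx, y, hy, rfl⟩
  exact ⟨x, Set.insert_subset_insert h hx, y, Set.insert_subset_insert h hy, rfl⟩

theorem TreeClosed.image {γ : S} {X : Set S} (hX : TreeClosed γ X) (g : S ≃o S) (hg : g γ = γ) :
    TreeClosed γ (g '' X) := by
  refine ⟨hX.finite.image _, ⟨γ, hX.base, hg⟩, ?_⟩
  rintro _ _ ⟨x, hx, rfl⟩ ⟨y, hy, rfl⟩
  exact ⟨x ⊓ y, hX.inf hx hy, map_inf g x y⟩

theorem image_treeClosure {γ : S} (X : Set S) (g : S ≃o S) (hg : g γ = γ) :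
    g '' treeClosure γ X = treeClosure γ (g '' X) := by
  have h : insert γ (g '' X) = g '' insert γ X := by rw [Set.image_insert_eq, hg]
  ext z
  constructor
  · rintro ⟨_, ⟨x, hx, y, hy, rfl⟩, rfl⟩
    exact ⟨g x, h ▸ ⟨x, hx, rfl⟩, g y, h ▸ ⟨y, hy, rfl⟩, map_inf g x y⟩
  · rintro ⟨x, hx, y, hy, rfl⟩
    rw [h] at hx hy
    obtain ⟨x, hx, rfl⟩ := hx
    obtain ⟨y, hy, rfl⟩ := hy
    exact ⟨x ⊓ y, ⟨x, hx, y, hy, rfl⟩, map_inf g x y⟩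

theorem good_flip {r : S → S → Prop} {C : Set S} {e z : S} : Good (flip r) C z e ↔ Good r C e z := by
  simp only [Good, flip, inf_comm e z, ne_comm, and_comm]

theorem Good.map {r : S → S → Prop} (hr : IsDirection r) {C : Set S} {e z : S} (h : Good r C e z)
    (g : S ≃o S) : Good r (g '' C) (g e) (g z) := by
  refine ⟨fun hze => ?_, ?_⟩
  · obtain ⟨c, hc, h1, h2⟩ := h.1 ((hr.map g).1 hze)
    exact ⟨g c, ⟨c, hc, rfl⟩, (hr.map g).2 h1, (hr.map g).2 h2⟩
  · rcases h.2 with h | ⟨c, hc, h⟩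
    · exact Or.inl ⟨_, h, map_inf g e z⟩
    · refine Or.inr ⟨g c, ⟨c, hc, rfl⟩, ?_⟩
      rwa [← map_inf, ← map_inf, ne_eq, EmbeddingLike.apply_eq_iff_eq]

theorem good_of_mem_left {r : S → S → Prop} (hr : IsDirection r) {C : Set S} {e : S} (he : e ∈ C)
    (z : S) : Good r C e z := by
  refine ⟨fun h => ⟨e, he, h, hr.refl e⟩, ?_⟩
  by_cases h : e ≤ z
  · exact Or.inl (by rwa [inf_eq_left.2 h])
  · exact Or.inr ⟨e, he, fun h' => h (by rw [inf_idem] at h'; exact inf_eq_right.1 h'.symm)⟩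

theorem good_of_mem_right {r : S → S → Prop} (hr : IsDirection r) {C : Set S} (e : S) {z : S}
    (hz : z ∈ C) : Good r C e z :=
  good_flip.1 (good_of_mem_left hr.flip hz e)

theorem mem_of_good_self {r : S → S → Prop} (hr : IsDirection r) {C : Set S} {e : S}
    (h : Good r C e e) : e ∈ C := by
  obtain ⟨c, hc, h1, h2⟩ := h.1 (hr.refl e)
  rwa [hr.antisymm h1 h2]

theorem SamePosition.mono {D E : Set S} {a a' : S} (h : SamePosition E a a') (hDE : D ⊆ E) :
    SamePosition D a a' := fun d hd => h d (hDE hd)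

theorem SamePosition.trans {D : Set S} {a b c : S} (h : SamePosition D a b)
    (h' : SamePosition D b c) : SamePosition D a c := by
  intro d hd
  rcases h d hd with h1 | h1 <;> rcases h' d hd with h2 | h2
  · exact Or.inl ⟨h1.1, h2.2⟩
  · exact absurd h1.2 h2.1
  · exact absurd h2.1 h1.2.1
  · exact Or.inr ⟨h1.1, h2.2.1, h1.2.2.trans h2.2.2⟩

variable [IsMeetTree S]

theorem le_or_le_of_le {x y z : S} (hx : x ≤ z) (hy : y ≤ z) : x ≤ y ∨ y ≤ x := by
  rcases hx.eq_or_lt with rfl | hx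
  · exact Or.inr hy
  rcases hy.eq_or_lt with rfl | hy
  · exact Or.inl hx.le
  exact (IsMeetTree.isChain_Iio z).total hx hy

theorem inf_inf_eq_or (x y z : S) : x ⊓ y ⊓ z = x ⊓ y ∨ x ⊓ y ⊓ z = y ⊓ z := by
  rcases le_or_le_of_le (inf_le_right : x ⊓ y ≤ y) (inf_le_left : y ⊓ z ≤ y) with h | h
  · exact Or.inl (inf_eq_left.2 (h.trans inf_le_right))
  · exact Or.inr (le_antisymm (inf_le_inf_right _ inf_le_right) (le_inf h inf_le_right))

theorem inf_eq_of_inf_ne {x y c : S} (h : x ⊓ c ≠ y ⊓ c) : x ⊓ y = (x ⊓ c) ⊓ (y ⊓ c) := by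
  have key : ∀ x y : S, x ⊓ c ≤ y ⊓ c → x ⊓ c ≠ y ⊓ c → x ⊓ y ≤ c := by
    intro x y hle hne
    rcases le_or_le_of_le (inf_le_right : x ⊓ y ≤ y) (inf_le_left : y ⊓ c ≤ y) with h | h
    · exact h.trans inf_le_right
    · exact absurd (le_antisymm hle (le_inf (h.trans inf_le_left) inf_le_right)) hne
  have : x ⊓ y ≤ c := by
    rcases le_or_le_of_le (inf_le_right : x ⊓ c ≤ c) (inf_le_right : y ⊓ c ≤ c) with h' | h'
    · exact key x y h' h
    · rw [inf_comm]; exact key y x h' h.symm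
  refine le_antisymm (le_inf (le_inf inf_le_left this) (le_inf inf_le_right this)) ?_
  exact inf_le_inf inf_le_left inf_le_left

theorem treeClosed_treeClosure (γ : S) {X : Set S} (hX : X.Finite) :
    TreeClosed γ (treeClosure γ X) := by
  have hfin : (insert γ X).Finite := hX.insert γ
  refine ⟨?_, ⟨γ, Or.inl rfl, γ, Or.inl rfl, (inf_idem γ).symm⟩, ?_⟩
  · refine (hfin.image2 (fun x y => x ⊓ y) hfin).subset ?_
    rintro z ⟨x, hx, y, hy, rfl⟩
    exact ⟨x, hx, y, hy, rfl⟩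
  · have key : ∀ x ∈ insert γ X, ∀ z ∈ treeClosure γ X, z ⊓ x ∈ treeClosure γ X := by
      rintro z hz _ ⟨x, hx, y, hy, rfl⟩
      rcases inf_inf_eq_or x y z with h | h
      · exact ⟨x, hx, y, hy, h⟩
      · exact ⟨y, hy, z, hz, h⟩
    rintro x _ hx ⟨y, hy, z, hz, rfl⟩
    rw [← inf_assoc]
    exact key z hz _ (key y hy x hx)

theorem Good.left_trans {r : S → S → Prop} (hr : IsDirection r) {C D : Set S} {e z : S}
    (h : Good r D e z) (h' : ∀ d ∈ D, Good r C d z) : Good r C e z := by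
  refine ⟨fun hze => ?_, ?_⟩
  · obtain ⟨d, hd, h1, h2⟩ := h.1 hze
    obtain ⟨c, hc, h3, h4⟩ := (h' d hd).1 h1
    exact ⟨c, hc, h3, hr.trans h4 h2⟩
  · by_contra! hcon
    obtain ⟨hez, hc⟩ := hcon
    rcases h.2 with hd | ⟨d, hd, hne⟩
    · rcases (h' _ hd).2 with h1 | ⟨c, hcC, h1⟩
      · rw [inf_assoc, inf_idem] at h1
        exact hez h1
      · apply h1
        have hle : z ⊓ c ≤ e := (hc c hcC).symm.le.trans inf_le_left
        exact le_antisymm (inf_le_inf_right _ inf_le_right)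
          (le_inf (le_inf hle inf_le_left) inf_le_right)
    · rcases (h' _ hd).2 with h1 | ⟨c, hcC, h1⟩
      · have h2 := hc _ h1
        have hle : d ⊓ z ≤ e := by
          have : z ⊓ (d ⊓ z) = d ⊓ z := inf_eq_right.2 inf_le_right
          rw [this] at h2
          exact inf_eq_right.1 h2
        refine hez ?_
        convert h1 using 1
        refine le_antisymm (le_inf ?_ inf_le_right) (le_inf hle inf_le_right)
        rcases le_or_le_of_le (inf_le_left : e ⊓ z ≤ e) (inf_le_left : e ⊓ d ≤ e) with h3 | h3
        · exact h3.trans inf_le_right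
        · exfalso
          apply hne
          refine le_antisymm (le_inf (h3.trans inf_le_right) inf_le_right) ?_
          rw [inf_comm z d]
          exact le_inf hle inf_le_left
      · have h2 : e ⊓ c ≠ d ⊓ c := by rw [hc c hcC]; exact h1.symm
        apply hne
        rw [inf_eq_of_inf_ne h2, hc c hcC, inf_eq_of_inf_ne h1.symm]

theorem Good.right_trans {r : S → S → Prop} (hr : IsDirection r) {C D : Set S} {e z : S}
    (h : Good r D e z) (h' : ∀ d ∈ D, Good r C e d) : Good r C e z :=
  good_flip.1 (Good.left_trans hr.flip (good_flip.2 h) fun d hd => good_flip.2 (h' d hd))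

/-- If `A` and `B` are closed and independent over `C ⊆ A ∩ B`, then `A ∪ B` is closed. -/
theorem TreeClosed.union {γ : S} {r : S → S → Prop} {A B C : Set S} (hA : TreeClosed γ A)
    (hB : TreeClosed γ B) (hCA : C ⊆ A) (hCB : C ⊆ B) (h : ∀ a ∈ A, ∀ b ∈ B, Good r C a b) :
    TreeClosed γ (A ∪ B) := by
  have key : ∀ a ∈ A, ∀ b ∈ B, a ⊓ b ∈ A ∪ B := by
    intro a ha b hb
    rcases (h a ha b hb).2 with h1 | ⟨c, hc, h1⟩
    · exact Or.inl (hCA h1)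
    · rw [inf_eq_of_inf_ne h1]
      rcases le_or_le_of_le (inf_le_right : a ⊓ c ≤ c) (inf_le_right : b ⊓ c ≤ c) with h2 | h2
      · rw [inf_eq_left.2 h2]; exact Or.inl (hA.inf ha (hCA hc))
      · rw [inf_eq_right.2 h2]; exact Or.inr (hB.inf hb (hCB hc))
  refine ⟨hA.finite.union hB.finite, Or.inl hA.base, ?_⟩
  rintro x y (hx | hx) (hy | hy)
  · exact Or.inl (hA.inf hx hy)
  · exact key x hx y hy
  · rw [inf_comm]; exact key y hy x hx
  · exact Or.inr (hB.inf hx hy)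

/-- Richness of a meet-tree: density, no minimal elements, and infinite branching at every
point which is not maximal. -/
structure IsRichTree (S : Type w) [SemilatticeInf S] : Prop where
  dense : ∀ x y : S, x < y → ∃ z, x < z ∧ z < y
  lower : ∀ x : S, ∃ y, y < x
  cone : ∀ (u a : S), u < a → ∀ F : Set S, F.Finite → ∃ y, u < y ∧ ∀ b ∈ F, y ⊓ b = u ⊓ b

theorem exists_independent_position (hS : IsRichTree S) {γ : S} {r : S → S → Prop}
    (hr : IsDirection r) {D B : Set S} (hD : TreeClosed γ D) (hB : TreeClosed γ B) (hDB : D ⊆ B)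
    {a : S} (ha : a ∉ D) (haD : ∀ d ∈ D, a ⊓ d ∈ insert a D) :
    ∃ a', a' ∉ B ∧ (∀ b ∈ B, a' ⊓ b ∈ insert a' B) ∧ SamePosition D a a' ∧
      ∀ b ∈ B, Good r D a' b := by
  by_cases hab : ∃ d ∈ D, a < d
  · -- the position of `a` is on an edge with upper end `c`
    obtain ⟨c, ⟨hcD, hac⟩, hmin⟩ : ∃ c, (c ∈ D ∧ a < c) ∧ ∀ d ∈ D, a ≤ d → c ≤ d := by
      have hne : {d | d ∈ D ∧ a < d}.Nonempty := let ⟨d, hd⟩ := hab; ⟨d, hd⟩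
      obtain ⟨c, hc⟩ := (hD.finite.subset (fun d hd => hd.1 :
        {d | d ∈ D ∧ a < d} ⊆ D)).exists_minimal hne
      refine ⟨c, hc.1, fun d hd had => ?_⟩
      have h1 : a < c ⊓ d := lt_of_le_of_ne (le_inf hc.1.2.le had) fun h =>
        ha (h ▸ hD.inf hc.1.1 hd)
      exact (hc.2 ⟨hD.inf hc.1.1 hd, h1⟩ inf_le_left).trans inf_le_right
    obtain ⟨a', ha'c, hlow, hBa', hext⟩ : ∃ a', a' < c ∧ (∀ d ∈ D, d < a → d < a') ∧
        (∀ b ∈ B, b ≤ c → b < a' ∨ a' < b) ∧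
        (∀ b ∈ B, b ≤ c → r b a' → ∃ d ∈ D, r b d ∧ r d a') := by
      rcases hr with rfl | rfl
      · -- just above the lower end
        obtain ⟨v, ⟨hvB, hvc, hvD⟩, hvmin⟩ : ∃ v, (v ∈ B ∧ v ≤ c ∧ ∀ d ∈ D, d < a → d < v) ∧
            ∀ b ∈ B, b ≤ c → (∀ d ∈ D, d < a → d < b) → v ≤ b := by
          obtain ⟨v, hv⟩ := (hB.finite.subset (fun d hd => hd.1 :
            {b | b ∈ B ∧ b ≤ c ∧ ∀ d ∈ D, d < a → d < b} ⊆ B)).exists_minimal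
              ⟨c, hDB hcD, le_rfl, fun d _ h => h.trans hac⟩
          refine ⟨v, hv.1, fun b hb hbc hbD => ?_⟩
          rcases le_or_le_of_le hbc hv.1.2.1 with h | h
          · exact hv.2 ⟨hb, hbc, hbD⟩ h
          · exact h
        by_cases hne : ∃ d ∈ D, d < a
        · obtain ⟨u, hu⟩ := (hD.finite.subset (fun d hd => hd.1 :
            {d | d ∈ D ∧ d < a} ⊆ D)).exists_maximal (let ⟨d, hd⟩ := hne; ⟨d, hd⟩)
          have humax : ∀ d ∈ D, d < a → d ≤ u := by
            intro d hd hda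
            rcases le_or_le_of_le hda.le hu.1.2.le with h | h
            · exact h
            · exact hu.2 ⟨hd, hda⟩ h
          obtain ⟨a', h1, h2⟩ := hS.dense u v (hvD u hu.1.1 hu.1.2)
          have key : ∀ b ∈ B, b ≤ c → b ≤ u ∨ a' < b := by
            intro b hb hbc
            rcases le_or_le_of_le hbc ((h1.trans h2).le.trans hvc) with h | h
            · exact Or.inl h
            rcases h.eq_or_lt with rfl | h
            · exact Or.inl le_rfl
            · exact Or.inr (h2.trans_le (hvmin b hb hbc fun d hd hda => (humax d hd hda).trans_lt h))
          refine ⟨a', h2.trans_le hvc, fun d hd hda => (humax d hd hda).trans_lt h1,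
            fun b hb hbc => (key b hb hbc).imp_left fun h => h.trans_lt h1, fun b hb hbc hba => ?_⟩
          rcases key b hb hbc with h | h
          · exact ⟨u, hu.1.1, h, h1.le⟩
          · exact absurd hba h.not_ge
        · push Not at hne
          obtain ⟨a', h2⟩ := hS.lower v
          have key : ∀ b ∈ B, b ≤ c → a' < b := fun b hb hbc =>
            h2.trans_le (hvmin b hb hbc fun d hd hda => absurd hda (hne d hd))
          exact ⟨a', h2.trans_le hvc, fun d hd hda => absurd hda (hne d hd),
            fun b hb hbc => Or.inr (key b hb hbc), fun b hb hbc hba =>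
              absurd hba (key b hb hbc).not_ge⟩
      · -- just below the upper end
        obtain ⟨a', h1, h2⟩ : ∃ a', (∀ b ∈ B, b < c → b < a') ∧ a' < c := by
          by_cases hne : ∃ b ∈ B, b < c
          · obtain ⟨v, hv⟩ := (hB.finite.subset (fun d hd => hd.1 :
              {d | d ∈ B ∧ d < c} ⊆ B)).exists_maximal (let ⟨d, hd⟩ := hne; ⟨d, hd⟩)
            obtain ⟨a', h1, h2⟩ := hS.dense v c hv.1.2
            refine ⟨a', fun b hb hbc => ?_, h2⟩
            rcases le_or_le_of_le hbc.le hv.1.2.le with h | h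
            · exact h.trans_lt h1
            · exact (hv.2 ⟨hb, hbc⟩ h).trans_lt h1
          · push Not at hne
            obtain ⟨a', h2⟩ := hS.lower c
            exact ⟨a', fun b hb hbc => absurd hbc (hne b hb), h2⟩
        have key : ∀ b ∈ B, b ≤ c → b = c ∨ b < a' := fun b hb hbc =>
          hbc.eq_or_lt.imp_right (h1 b hb)
        refine ⟨a', h2, fun d hd hda => h1 d (hDB hd) (hda.trans hac), fun b hb hbc => ?_,
          fun b hb hbc hba => ?_⟩
        · rcases key b hb hbc with rfl | h
          · exact Or.inr h2
          · exact Or.inl h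
        · rcases key b hb hbc with rfl | h
          · exact ⟨b, hcD, le_refl b, h2.le⟩
          · exact absurd hba h.not_ge
    have hcB := hDB hcD
    have hdich : ∀ b ∈ B, (b ⊓ c < a' ∧ a' ⊓ b = b ⊓ c) ∨ (a' < b ⊓ c ∧ a' ≤ b) := by
      intro b hb
      rcases hBa' _ (hB.inf hb hcB) inf_le_right with h | h
      · refine Or.inl ⟨h, le_antisymm (le_inf inf_le_right (inf_le_left.trans ha'c.le)) ?_⟩
        exact le_inf h.le inf_le_left
      · exact Or.inr ⟨h, h.le.trans inf_le_left⟩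
    have hne : ∀ b ∈ B, a' ⊓ c ≠ b ⊓ c := by
      intro b hb h
      rw [inf_eq_left.2 ha'c.le] at h
      rcases hdich b hb with h' | h'
      · exact h'.1.ne h.symm
      · exact h'.1.ne h
    refine ⟨a', fun h => hne a' h rfl, fun b hb => ?_, fun d hd => ?_, fun b hb =>
      ⟨fun hba => ?_, Or.inr ⟨c, hcD, hne b hb⟩⟩⟩
    · rcases hdich b hb with h | h
      · exact Or.inr (h.2 ▸ hB.inf hb hcB)
      · exact Or.inl (inf_eq_left.2 h.2)
    · by_cases had : a ≤ d
      · exact Or.inl ⟨had, ha'c.le.trans (hmin d hd had)⟩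
      · have h1 : d ⊓ c < a := by
          rcases le_or_le_of_le (inf_le_right : d ⊓ c ≤ c) hac.le with h | h
          · exact lt_of_le_of_ne h fun h => ha (h ▸ hD.inf hd hcD)
          · exact absurd (h.trans inf_le_left) had
        have h2 := hlow _ (hD.inf hd hcD) h1
        rcases hdich d (hDB hd) with h | h
        · refine Or.inr ⟨had, fun h' => ?_, ?_⟩
          · rw [inf_eq_left.2 h'] at h
            exact h.1.ne h.2.symm
          · rw [h.2]
            exact le_antisymm (le_inf inf_le_right (inf_le_left.trans hac.le))
              (le_inf h1.le inf_le_left)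
        · exact absurd h.1 h2.not_gt
    · rcases hr with rfl | rfl
      · exact hext b hb (le_trans hba ha'c.le) hba
      · obtain ⟨d, hd, h1, h2⟩ := hext _ (hB.inf hb hcB) inf_le_right (le_inf hba ha'c.le)
        exact ⟨d, hd, le_trans (α := S) h1 inf_le_left, h2⟩
  · -- the position of `a` is in a new cone
    push Not at hab
    have hnle : ∀ d ∈ D, ¬ a ≤ d := fun d hd h =>
      h.eq_or_lt.elim (fun h => ha (h ▸ hd)) (hab d hd)
    have hinf : ∀ d ∈ D, a ⊓ d ∈ D ∧ a ⊓ d < a := fun d hd => by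
      rcases haD d hd with h | h
      · exact absurd (inf_eq_left.1 h) (hnle d hd)
      · exact ⟨h, lt_of_le_of_ne inf_le_left fun h' => hnle d hd (inf_eq_left.1 h')⟩
    obtain ⟨u, hu⟩ := (hD.finite.subset (fun d hd => hd.1 :
      {d | d ∈ D ∧ d < a} ⊆ D)).exists_maximal ⟨_, hinf γ hD.base⟩
    have humax : ∀ d ∈ D, d < a → d ≤ u := by
      intro d hd hda
      rcases le_or_le_of_le hda.le hu.1.2.le with h | h
      · exact h
      · exact hu.2 ⟨hd, hda⟩ h
    obtain ⟨a', hua, hcone⟩ := hS.cone u a hu.1.2 B hB.finite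
    have huB := hDB hu.1.1
    have hnle' : ∀ b ∈ B, ¬ a' ≤ b := fun b hb h => by
      have := hcone b hb
      rw [inf_eq_left.2 h] at this
      exact (hua.trans_le this.le).not_ge inf_le_left
    refine ⟨a', fun h => hnle' a' h le_rfl, fun b hb => Or.inr (hcone b hb ▸ hB.inf huB hb),
      fun d hd => Or.inr ⟨hnle d hd, hnle' d (hDB hd), ?_⟩, fun b hb => ⟨fun h => ?_, ?_⟩⟩
    · rw [hcone d (hDB hd)]
      exact le_antisymm (le_inf (humax _ (hinf d hd).1 (hinf d hd).2) inf_le_right)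
        (inf_le_inf_right _ hu.1.2.le)
    · rcases hr with rfl | rfl
      · refine ⟨u, hu.1.1, ?_, hua.le⟩
        have := hcone b hb
        rw [inf_eq_right.2 h] at this
        exact this.le.trans inf_le_left
      · exact absurd h (hnle' b hb)
    · rw [hcone b hb]
      by_cases hub : u ≤ b
      · exact Or.inl (by rw [inf_eq_left.2 hub]; exact hu.1.1)
      · refine Or.inr ⟨u, hu.1.1, fun h => hub ?_⟩
        rw [inf_eq_right.2 hua.le] at h
        exact h.le.trans inf_le_left

end Tree

/-! ### Maximally moving commutators in an abstract homogeneous meet-tree -/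

section Core

variable {S : Type w} [SemilatticeInf S]

/-- The properties of a free weak independence relation between finite subsets which are used for
a group `G` of automorphisms of a meet-tree. -/
structure FreeIndep (G : Subgroup (S ≃o S)) (I : Set S → Set S → Set S → Prop) : Prop where
  invariance : ∀ {g : S ≃o S} {A B C : Set S}, g ∈ G → A.Finite → B.Finite → C.Finite →
    I A C B → I (g '' A) (g '' C) (g '' B)
  mono : ∀ {A B C A₀ B₀ : Set S}, A.Finite → B.Finite → C.Finite → A₀ ⊆ A → B₀ ⊆ B →
    I A C B → I A₀ C B₀
  left_existence : ∀ {A B : Set S}, A.Finite → B.Finite → I A A B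
  right_existence : ∀ {A B : Set S}, A.Finite → B.Finite → I A B B
  left_trans : ∀ {A B C D : Set S}, A.Finite → B.Finite → C ⊆ D → D ⊆ A →
    I A D B → I D C B → I A C B
  right_trans : ∀ {A B C D : Set S}, A.Finite → B.Finite → C ⊆ D → D ⊆ B →
    I A D B → I A C D → I A C B
  free : ∀ {A B C D : Set S}, A.Finite → B.Finite → C.Finite → D ⊆ C → I A C B →
    C ∩ (A ∪ B) ⊆ D → I A D B

/-- The opposite of a ternary relation. -/
def opIndep (I : Set S → Set S → Set S → Prop) : Set S → Set S → Set S → Prop :=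
  fun A C B => I B C A

theorem FreeIndep.op {G : Subgroup (S ≃o S)} {I : Set S → Set S → Set S → Prop}
    (h : FreeIndep G I) : FreeIndep G (opIndep I) where
  invariance hg hA hB hC := h.invariance hg hB hA hC
  mono hA hB hC hA' hB' := h.mono hB hA hC hB' hA'
  left_existence hA hB := h.right_existence hB hA
  right_existence hA hB := h.left_existence hB hA
  left_trans hA hB hCD hDA h1 h2 := h.right_trans hB hA hCD hDA h1 h2
  right_trans hA hB hCD hDB h1 h2 := h.left_trans hB hA hCD hDB h1 h2
  free hA hB hC hDC h1 h2 := h.free hB hA hC hDC h1 (by rwa [Set.union_comm] at h2)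

/-- Independence both in the tree sense (in direction `r`) and in the sense of `I`. -/
def Indep (r : S → S → Prop) (I : Set S → Set S → Set S → Prop) (A C B : Set S) : Prop :=
  (∀ a ∈ A, ∀ b ∈ B, Good r C a b) ∧ I A C B

theorem indep_op {r : S → S → Prop} {I : Set S → Set S → Set S → Prop} {A C B : Set S} :
    Indep (flip r) (opIndep I) B C A ↔ Indep r I A C B :=
  and_congr ⟨fun h a ha b hb => good_flip.1 (h b hb a ha),
    fun h b hb a ha => good_flip.2 (h a ha b hb)⟩ Iff.rfl

/-- A group of automorphisms fixing `γ` such that every point can be moved to an independent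
position, in direction `r`, over finite closed sets. -/
structure IndepFrame (γ : S) (G : Subgroup (S ≃o S)) (r : S → S → Prop)
    (I : Set S → Set S → Set S → Prop) : Prop where
  direction : IsDirection r
  fix : ∀ g ∈ G, g γ = γ
  indep : FreeIndep G I
  extension : ∀ {D B : Set S} {a : S}, TreeClosed γ D → TreeClosed γ B → D ⊆ B → a ∉ D →
    (∀ d ∈ D, a ⊓ d ∈ insert a D) →
      ∃ g ∈ G, (∀ d ∈ D, g d = d) ∧ (∀ b ∈ B, Good r D (g a) b) ∧ I (insert (g a) D) D B

variable {γ : S} {G : Subgroup (S ≃o S)} {r : S → S → Prop} {I : Set S → Set S → Set S → Prop}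

theorem Indep.mono (hI : FreeIndep G I) {A B C A₀ B₀ : Set S} (h : Indep r I A C B)
    (hA : A.Finite) (hB : B.Finite) (hC : C.Finite) (hA' : A₀ ⊆ A) (hB' : B₀ ⊆ B) :
    Indep r I A₀ C B₀ :=
  ⟨fun a ha b hb => h.1 a (hA' ha) b (hB' hb), hI.mono hA hB hC hA' hB' h.2⟩

theorem Indep.map (hr : IsDirection r) (hI : FreeIndep G I) {A B C : Set S} (h : Indep r I A C B)
    (hA : A.Finite) (hB : B.Finite) (hC : C.Finite) {g : S ≃o S} (hg : g ∈ G) :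
    Indep r I (g '' A) (g '' C) (g '' B) := by
  refine ⟨?_, hI.invariance hg hA hB hC h.2⟩
  rintro _ ⟨a, ha, rfl⟩ _ ⟨b, hb, rfl⟩
  exact (h.1 a ha b hb).map hr g

theorem TreeClosed.diff_singleton {A C : Set S} (hA : TreeClosed γ A) (hC : TreeClosed γ C)
    {a : S} (haC : a ∉ C) (h : ∀ x ∈ A, ∀ y ∈ A, a < x → a < y → x ⊓ y ≠ a) :
    TreeClosed γ (A \ {a}) := by
  refine ⟨hA.finite.subset Set.sdiff_subset, ⟨hA.base, fun h => haC (h ▸ hC.base)⟩, ?_⟩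
  rintro x y ⟨hx, hxa⟩ ⟨hy, hya⟩
  refine ⟨hA.inf hx hy, fun h' => ?_⟩
  have h' : x ⊓ y = a := h'
  exact h x hx y hy (lt_of_le_of_ne (h' ▸ inf_le_left) fun h => hxa h.symm)
    (lt_of_le_of_ne (h' ▸ inf_le_right) fun h => hya h.symm) h'

theorem image_mul (g h : S ≃o S) (A : Set S) : (g * h) '' A = g '' (h '' A) := by
  rw [Set.image_image]; rfl

theorem image_eq_insert {A : Set S} {a : S} (ha : a ∈ A) (g : S ≃o S) :
    g '' A = insert (g a) (g '' (A \ {a})) := by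
  rw [← Set.image_insert_eq, Set.insert_sdiff_singleton, Set.insert_eq_of_mem ha]

variable [IsMeetTree S]

theorem Indep.left_trans (hr : IsDirection r) (hI : FreeIndep G I) {A B C D : Set S}
    (hA : A.Finite) (hB : B.Finite) (hCD : C ⊆ D) (hDA : D ⊆ A) (h : Indep r I A D B)
    (h' : Indep r I D C B) : Indep r I A C B :=
  ⟨fun a ha b hb => (h.1 a ha b hb).left_trans hr fun d hd => h'.1 d hd b hb,
    hI.left_trans hA hB hCD hDA h.2 h'.2⟩

/-- One step in building an independent copy: the point `a` of `A` is added to the copy of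
`A \ {a}`. -/
theorem IndepFrame.extension_step (F : IndepFrame γ G r I) {A B C : Set S} {a : S} {g : S ≃o S}
    (hA : TreeClosed γ A) (hB : TreeClosed γ B) (hCA : C ⊆ A) (ha : a ∈ A)
    (haC : a ∉ C) (hD : TreeClosed γ (A \ {a})) (hg : g ∈ G) (hgC : ∀ c ∈ C, g c = c)
    (hgB : g '' (A \ {a}) ⊆ B) {Y : Set S} (hYB : Y ⊆ B)
    (hi : Indep r I (g '' (A \ {a})) C Y) :
    ∃ h ∈ G, (∀ d ∈ g '' (A \ {a}), h d = d) ∧ (∀ c ∈ C, (h * g) c = c) ∧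
      (∀ b ∈ B, Good r (g '' (A \ {a})) ((h * g) a) b) ∧ Indep r I ((h * g) '' A) C Y := by
  have hD' := hD.image g (F.fix g hg)
  have hga : g a ∉ g '' (A \ {a}) := by
    rintro ⟨x, hx, hxa⟩
    exact hx.2 (g.injective hxa)
  obtain ⟨h, hhG, hhD, hgood, hI⟩ := F.extension hD' hB hgB hga (by
    rintro _ ⟨d, hd, rfl⟩
    rw [← map_inf, ← image_eq_insert ha g]
    exact ⟨_, hA.inf ha hd.1, rfl⟩)
  have himg : (h * g) '' A = insert (h (g a)) (g '' (A \ {a})) := by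
    rw [image_eq_insert ha, image_mul]
    congr 1
    conv_rhs => rw [← Set.image_id (g '' (A \ {a}))]
    exact Set.image_congr hhD
  have hCD : C ⊆ g '' (A \ {a}) := fun c hc => ⟨c, ⟨hCA hc, fun h => haC (h ▸ hc)⟩, hgC c hc⟩
  refine ⟨h, hhG, hhD, fun c hc => ?_, hgood, ?_⟩
  · exact (congrArg h (hgC c hc)).trans (hhD c (hCD hc))
  · rw [himg]
    have hYf := hB.finite.subset hYB
    refine Indep.left_trans F.direction F.indep (hD'.finite.insert _) hYf hCD
      (Set.subset_insert _ _) ⟨?_, ?_⟩ hi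
    · rintro x (rfl | hx) b hb
      · exact hgood b (hYB hb)
      · exact good_of_mem_left F.direction hx b
    · exact F.indep.mono (hD'.finite.insert _) hB.finite hD'.finite subset_rfl hYB hI

theorem IndepFrame.exists_indep (F : IndepFrame γ G r I) {A B C : Set S} (hA : TreeClosed γ A)
    (hB : TreeClosed γ B) (hC : TreeClosed γ C) (hCA : C ⊆ A) :
    ∃ g ∈ G, (∀ c ∈ C, g c = c) ∧ Indep r I (g '' A) C B := by
  induction hn : (A \ C).ncard generalizing A with
  | zero =>
    have h : A = C := (hCA.antisymm (Set.sdiff_eq_empty.1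
      ((Set.ncard_eq_zero (hA.finite.subset Set.sdiff_subset)).1 hn))).symm
    subst h
    refine ⟨1, G.one_mem, fun _ _ => rfl, ?_⟩
    have : ((1 : S ≃o S) '' A) = A := Set.image_id A
    rw [this]
    exact ⟨fun a ha b _ => good_of_mem_left F.direction ha b,
      F.indep.left_existence hA.finite hB.finite⟩
  | succ n ih =>
    have hfin : (A \ C).Finite := hA.finite.subset Set.sdiff_subset
    have hne : (A \ C).Nonempty := (Set.ncard_pos hfin).1 (by omega)
    obtain ⟨a, ha⟩ := hfin.exists_maximal hne
    have hD : TreeClosed γ (A \ {a}) := hA.diff_singleton hC ha.1.2 fun x hx y hy hax hay h => by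
      have hxC : x ∈ C := by
        by_contra hxC
        exact hax.not_ge (ha.2 ⟨hx, hxC⟩ hax.le)
      have hyC : y ∈ C := by
        by_contra hyC
        exact hay.not_ge (ha.2 ⟨hy, hyC⟩ hay.le)
      exact ha.1.2 (h ▸ hC.inf hxC hyC)
    obtain ⟨g, hg, hgC, hi⟩ := ih hD (fun c hc => ⟨hCA hc, fun h => ha.1.2 (h ▸ hc)⟩) (by
      have : (A \ {a}) \ C = (A \ C) \ {a} := by
        ext; simp only [Set.mem_sdiff]; tauto
      rw [this, Set.ncard_sdiff_singleton_of_mem ha.1, hn]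
      rfl)
    have hsub := subset_treeClosure γ (g '' (A \ {a}) ∪ B)
    obtain ⟨h, hh, -, hhC, -, hi'⟩ := F.extension_step hA
      (treeClosed_treeClosure γ ((hD.finite.image g).union hB.finite)) hCA ha.1.1 ha.1.2 hD hg hgC
      (Set.subset_union_left.trans hsub) (Set.subset_union_right.trans hsub) hi
    exact ⟨h * g, G.mul_mem hh hg, hhC, hi'⟩

theorem lt_inf_trans {x y z : S} (h : γ < x ⊓ y) (h' : γ < y ⊓ z) : γ < x ⊓ z := by
  have key : γ < x ⊓ y ⊓ (y ⊓ z) := by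
    rcases le_or_le_of_le (inf_le_right : x ⊓ y ≤ y) (inf_le_left : y ⊓ z ≤ y) with h1 | h1
    · rwa [inf_eq_left.2 h1]
    · rwa [inf_eq_right.2 h1]
  exact key.trans_le (inf_le_inf inf_le_left inf_le_right)

theorem Good.exists_lt_inf {C : Set S} {e x : S} (h : Good r C e x) (hx : γ < e ⊓ x) :
    ∃ c ∈ C, γ < e ⊓ c := by
  rcases h.2 with h | ⟨c, hc, h⟩
  · exact ⟨_, h, by rwa [← inf_assoc, inf_idem]⟩
  · exact ⟨c, hc, hx.trans_le ((inf_eq_of_inf_ne h).le.trans inf_le_left)⟩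

theorem good_of_inf_lt (hr : IsDirection r) {X : Set S} (hγ : γ ∈ X) {e z : S} (hz : z ⊓ γ < γ)
    (h : e ⊓ γ = γ ∨ (r (e ⊓ γ) (z ⊓ γ) ∧ e ⊓ γ ≠ z ⊓ γ)) : Good r X e z := by
  have hne : e ⊓ γ ≠ z ⊓ γ := by
    rcases h with h | h
    · rw [h]; exact hz.ne'
    · exact h.2
  refine ⟨fun hze => ?_, Or.inr ⟨γ, hγ, hne⟩⟩
  rcases h with h | h
  · have hγe : γ ≤ e := inf_eq_right.1 h
    rcases hr with rfl | rfl
    · rcases le_or_le_of_le hze hγe with h' | h'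
      · exact ⟨γ, hγ, h', hγe⟩
      · exact absurd (inf_eq_right.2 h') hz.ne
    · exact absurd (inf_eq_right.2 (hγe.trans hze)) hz.ne
  · rcases hr with rfl | rfl
    · exact absurd (le_antisymm h.1 (inf_le_inf_right γ hze)) hne
    · exact absurd (le_antisymm (inf_le_inf_right γ hze) h.1) hne

/-- The hypotheses on the automorphism `α`: it moves every point below `γ` in direction `r`, and
no positive power of it preserves a cone above `γ`. -/
structure MovesAll (γ : S) (r : S → S → Prop) (α : S ≃o S) : Prop where
  below : ∀ x, x < γ → r x (α x) ∧ x ≠ α x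
  above : ∀ n : ℕ, 0 < n → ∀ x, ¬ γ < x ⊓ (α ^ n) x

theorem MovesAll.exists_sink {α : S ≃o S} (hα : MovesAll γ r α) (hαγ : α γ = γ) {E C : Set S}
    (hE : E.Finite) (hne : E.Nonempty) (hγ : ∀ e ∈ E, γ < e) :
    ∃ a ∈ E, ∀ e ∈ E, ¬ ∃ c ∈ C, ∃ c' ∈ C, γ < a ⊓ c ∧ γ < e ⊓ c' ∧ γ < c' ⊓ α c := by
  by_contra! hcon
  have : ∀ a : E, ∃ e : E, γ < (e : S) ⊓ α a := by
    intro a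
    obtain ⟨e, he, c, -, c', -, h1, h2, h3⟩ := hcon a a.2
    refine ⟨⟨e, he⟩, lt_inf_trans h2 (lt_inf_trans h3 ?_)⟩
    rw [← map_inf, ← hαγ, inf_comm]
    exact α.strictMono h1
  choose f hf using this
  have : Finite E := hE
  obtain ⟨x, hx⟩ := hne
  obtain ⟨i, j, hij, heq⟩ := Finite.exists_ne_map_eq_of_infinite fun n : ℕ => f^[n] ⟨x, hx⟩
  have key : ∀ i j, i < j → f^[i] ⟨x, hx⟩ ≠ f^[j] ⟨x, hx⟩ := by
    intro i j hij heq
    obtain ⟨k, rfl⟩ := Nat.exists_eq_add_of_lt hij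
    have hn : ∀ n (b : E), γ < (f^[n] b : S) ⊓ (α ^ n) b := by
      intro n b
      induction n with
      | zero =>
        have : (α ^ 0) (b : S) = b := rfl
        rw [Function.iterate_zero, id, this, inf_idem]
        exact hγ b b.2
      | succ n ih =>
        rw [Function.iterate_succ_apply', pow_succ']
        refine lt_inf_trans (hf _) ?_
        change γ < α _ ⊓ α _
        rw [← map_inf, ← hαγ]
        exact α.strictMono ih
    have := hn (k + 1) (f^[i] ⟨x, hx⟩)
    rw [← Function.iterate_add_apply, show k + 1 + i = i + k + 1 by ring, ← heq] at this
    exact hα.above (k + 1) (Nat.succ_pos k) _ this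
  rcases lt_or_gt_of_ne hij with h | h
  · exact key i j h heq
  · exact key j i h heq.symm

/-- The choice of the point to be added last. -/
theorem MovesAll.exists_last (hr : IsDirection r) {α : S ≃o S} (hα : MovesAll γ r α)
    (hαγ : α γ = γ) {A C : Set S} (hA : TreeClosed γ A) (hC : TreeClosed γ C)
    (hne : (A \ C).Nonempty) :
    ∃ a ∈ A \ C, TreeClosed γ (A \ {a}) ∧
      ((a ⊓ γ < γ ∧ ∀ e ∈ A \ C, e ⊓ γ = γ ∨ r (e ⊓ γ) (a ⊓ γ)) ∨
        ∀ e ∈ A \ C, γ < e ∧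
          ¬ ∃ c ∈ C, ∃ c' ∈ C, γ < a ⊓ c ∧ γ < e ⊓ c' ∧ γ < c' ⊓ α c) := by
  have hfin : (A \ C).Finite := hA.finite.subset Set.sdiff_subset
  by_cases hcase : ∃ e ∈ A \ C, e ⊓ γ < γ
  · have hPfin : {e | e ∈ A \ C ∧ e ⊓ γ < γ}.Finite := hfin.subset fun e he => he.1
    obtain ⟨a₁, ha₁, hmax⟩ : ∃ a₁, (a₁ ∈ A \ C ∧ a₁ ⊓ γ < γ) ∧
        ∀ e ∈ A \ C, e ⊓ γ < γ → r (e ⊓ γ) (a₁ ⊓ γ) := by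
      rcases hr with rfl | rfl
      · obtain ⟨a₁, h⟩ := hPfin.exists_maximalFor (fun e => e ⊓ γ) _ (let ⟨e, h⟩ := hcase; ⟨e, h⟩)
        refine ⟨a₁, h.1, fun e he heγ => ?_⟩
        rcases le_or_le_of_le (inf_le_right : e ⊓ γ ≤ γ) (inf_le_right : a₁ ⊓ γ ≤ γ) with h' | h'
        · exact h'
        · exact h.2 ⟨he, heγ⟩ h'
      · obtain ⟨a₁, h⟩ := hPfin.exists_minimalFor (fun e => e ⊓ γ) _ (let ⟨e, h⟩ := hcase; ⟨e, h⟩)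
        refine ⟨a₁, h.1, fun e he heγ => ?_⟩
        rcases le_or_le_of_le (inf_le_right : e ⊓ γ ≤ γ) (inf_le_right : a₁ ⊓ γ ≤ γ) with h' | h'
        · exact h.2 ⟨he, heγ⟩ h'
        · exact h'
    obtain ⟨a, ha, hamax⟩ := (hfin.subset fun e he => he.1 :
      {e | e ∈ A \ C ∧ e ⊓ γ = a₁ ⊓ γ}.Finite).exists_maximal ⟨a₁, ha₁.1, rfl⟩
    refine ⟨a, ha.1, ?_, Or.inl ⟨ha.2 ▸ ha₁.2, fun e he => ?_⟩⟩
    · refine hA.diff_singleton hC ha.1.2 fun x hx y hy hax hay h => ?_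
      have haγ : a ⊓ γ < γ := ha.2 ▸ ha₁.2
      have key : ∀ x ∈ A, a < x → x ⊓ γ = a ⊓ γ → x ∈ C := fun x hx hax hxγ => by
        by_contra hxC
        exact hax.not_ge (hamax ⟨⟨hx, hxC⟩, hxγ.trans ha.2⟩ hax.le)
      by_cases hxγ : x ⊓ γ = a ⊓ γ
      · by_cases hyγ : y ⊓ γ = a ⊓ γ
        · exact ha.1.2 (h ▸ hC.inf (key x hx hax hxγ) (key y hy hay hyγ))
        · have h1 : x ⊓ y = x ⊓ γ ⊓ (y ⊓ γ) := inf_eq_of_inf_ne fun h' => hyγ (h' ▸ hxγ)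
          have h2 : x ⊓ γ ≤ y ⊓ γ := by
            rw [hxγ]; exact inf_le_inf_right γ hay.le
          rw [inf_eq_left.2 h2] at h1
          exact ha.1.2 (h ▸ h1 ▸ hC.inf (key x hx hax hxγ) hC.base)
      · by_cases hyγ : y ⊓ γ = a ⊓ γ
        · have h1 : x ⊓ y = x ⊓ γ ⊓ (y ⊓ γ) := inf_eq_of_inf_ne fun h' => hxγ (h' ▸ hyγ)
          have h2 : y ⊓ γ ≤ x ⊓ γ := by
            rw [hyγ]; exact inf_le_inf_right γ hax.le
          rw [inf_eq_right.2 h2] at h1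
          exact ha.1.2 (h ▸ h1 ▸ hC.inf (key y hy hay hyγ) hC.base)
        · have h1 : a ⊓ γ < x ⊓ γ := lt_of_le_of_ne (inf_le_inf_right γ hax.le) (Ne.symm hxγ)
          have h2 : a ⊓ γ < y ⊓ γ := lt_of_le_of_ne (inf_le_inf_right γ hay.le) (Ne.symm hyγ)
          have h3 : a ⊓ γ = x ⊓ γ ⊓ (y ⊓ γ) := by
            rw [← h, inf_inf_inf_comm, inf_idem]
          rcases le_or_le_of_le (inf_le_right : x ⊓ γ ≤ γ) (inf_le_right : y ⊓ γ ≤ γ) with h' | h'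
          · rw [inf_eq_left.2 h'] at h3
            exact h1.ne h3
          · rw [inf_eq_right.2 h'] at h3
            exact h2.ne h3
    · by_cases heγ : e ⊓ γ = γ
      · exact Or.inl heγ
      · exact Or.inr (ha.2 ▸ hmax e he (lt_of_le_of_ne inf_le_right heγ))
  · push Not at hcase
    have hγlt : ∀ e ∈ A \ C, γ < e := fun e he => by
      have h1 : γ ≤ e := by
        by_contra h
        exact hcase e he (lt_of_le_of_ne inf_le_right fun h' => h (inf_eq_right.1 h'))
      exact lt_of_le_of_ne h1 fun h => he.2 (h ▸ hC.base)
    obtain ⟨a₁, ha₁, hsink⟩ := hα.exists_sink hαγ (C := C) hfin hne hγlt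
    obtain ⟨a, ha, hamax⟩ := (hfin.subset fun e he => he.1 :
      {e | e ∈ A \ C ∧ γ < a₁ ⊓ e}.Finite).exists_maximal
        ⟨a₁, ha₁, by rw [inf_idem]; exact hγlt a₁ ha₁⟩
    refine ⟨a, ha.1, ?_, Or.inr fun e he => ⟨hγlt e he, ?_⟩⟩
    · refine hA.diff_singleton hC ha.1.2 fun x hx y hy hax hay h => ?_
      have key : ∀ x ∈ A, a < x → x ∈ C := fun x hx hax => by
        by_contra hxC
        exact hax.not_ge (hamax ⟨⟨hx, hxC⟩, ha.2.trans_le (inf_le_inf_left _ hax.le)⟩ hax.le)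
      exact ha.1.2 (h ▸ hC.inf (key x hx hax) (key y hy hay))
    · rintro ⟨c, hc, c', hc', h1, h2, h3⟩
      exact hsink e he ⟨c, hc, c', hc', lt_inf_trans ha.2 h1, h2, h3⟩

/-- An independent copy of `A` over `C` which is tree-independent from its image under `α`. -/
theorem IndepFrame.exists_indep_image (F : IndepFrame γ G r I) {α : S ≃o S} (hαG : α ∈ G)
    (hα : MovesAll γ r α) {A C X Y : Set S} (hA : TreeClosed γ A) (hC : TreeClosed γ C)
    (hY : TreeClosed γ Y) (hCA : C ⊆ A) (hCX : C ⊆ X) (hαCX : α '' C ⊆ X)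
    (hXY : X ⊆ Y) (hXY' : ∀ x ∈ X, α.symm x ∈ Y) :
    ∃ g ∈ G, (∀ c ∈ C, g c = c) ∧ Indep r I (g '' A) C Y ∧
      ∀ e ∈ g '' A, ∀ z ∈ g '' A, Good r X e (α z) := by
  have hr := F.direction
  have hαγ := F.fix α hαG
  induction hn : (A \ C).ncard generalizing A with
  | zero =>
    have h : A = C := (hCA.antisymm (Set.sdiff_eq_empty.1
      ((Set.ncard_eq_zero (hA.finite.subset Set.sdiff_subset)).1 hn))).symm
    subst h
    refine ⟨1, G.one_mem, fun _ _ => rfl, ?_⟩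
    have : ((1 : S ≃o S) '' A) = A := Set.image_id A
    rw [this]
    exact ⟨⟨fun a ha b _ => good_of_mem_left hr ha b,
      F.indep.left_existence hA.finite hY.finite⟩, fun e he z _ => good_of_mem_left hr (hCX he) _⟩
  | succ n ih =>
    have hfin : (A \ C).Finite := hA.finite.subset Set.sdiff_subset
    have hne : (A \ C).Nonempty := (Set.ncard_pos hfin).1 (by omega)
    obtain ⟨a, ha, hD, hlast⟩ := hα.exists_last hr hαγ hA hC hne
    obtain ⟨g, hg, hgC, hi, hgood⟩ := ih hD (fun c hc => ⟨hCA hc, fun h => ha.2 (h ▸ hc)⟩) (by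
      have : (A \ {a}) \ C = (A \ C) \ {a} := by
        ext; simp only [Set.mem_sdiff]; tauto
      rw [this, Set.ncard_sdiff_singleton_of_mem ha, hn]
      rfl)
    have hsub := subset_treeClosure γ
      (g '' (A \ {a}) ∪ Y ∪ α '' (g '' (A \ {a})) ∪ α.symm '' (g '' (A \ {a})))
    have hfin' := hD.finite.image g
    obtain ⟨h, hh, hhD, hhC, hgoodB, hi'⟩ := F.extension_step hA
      (treeClosed_treeClosure γ (((hfin'.union hY.finite).union (hfin'.image α)).union
        (hfin'.image α.symm))) hCA ha.1 ha.2 hD hg hgC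
      (fun x hx => hsub (Or.inl (Or.inl (Or.inl hx))))
      (fun x hx => hsub (Or.inl (Or.inl (Or.inr hx)))) hi
    have hhgG := G.mul_mem hh hg
    have hgγ : (h * g) γ = γ := F.fix _ hhgG
    refine ⟨h * g, hhgG, hhC, hi', ?_⟩
    have himg : (h * g) '' A = insert ((h * g) a) (g '' (A \ {a})) := by
      rw [image_eq_insert ha.1, image_mul]
      congr 1
      conv_rhs => rw [← Set.image_id (g '' (A \ {a}))]
      exact Set.image_congr hhD
    have hαlt : ∀ {x y : S}, γ < x ⊓ y → γ < α x ⊓ α y := fun {x y} hxy => by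
      rw [← map_inf, ← hαγ]; exact α.strictMono hxy
    have hαlt' : ∀ {x y : S}, γ < x ⊓ α y → γ < α.symm x ⊓ y := fun {x y} hxy => by
      rw [← α.lt_iff_lt, hαγ, map_inf, α.apply_symm_apply]; exact hxy
    have hlastgood : ∀ e ∈ (h * g) '' A, Good r X e (α ((h * g) a)) := by
      rintro _ ⟨e, he, rfl⟩
      by_cases heC : e ∈ C
      · rw [hhC e heC]; exact good_of_mem_left hr (hCX heC) _
      have hgl : ∀ {x y : S}, γ < (h * g) x ⊓ y → ∀ hy : y ∈ C, γ < x ⊓ y := fun {x y} hxy hy => by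
        rw [← hhC y hy, ← map_inf, ← hgγ] at hxy
        exact (h * g).lt_iff_lt.1 hxy
      rcases hlast with ⟨haγ, hmax⟩ | hsink
      · have h1 : (h * g) a ⊓ γ < γ := by
          conv_lhs => rw [← hgγ]
          rw [← map_inf]
          conv_rhs => rw [← hgγ]
          exact (h * g).strictMono haγ
        have h2 : α ((h * g) a) ⊓ γ = α ((h * g) a ⊓ γ) := by rw [map_inf, hαγ]
        have h3 := hα.below _ h1
        refine good_of_inf_lt hr (hCX hC.base) ?_ ?_
        · rw [h2]
          conv_rhs => rw [← hαγ]
          exact α.strictMono h1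
        · have h4 : (h * g) e ⊓ γ = (h * g) (e ⊓ γ) := by rw [map_inf, hgγ]
          have h5 : (h * g) a ⊓ γ = (h * g) (a ⊓ γ) := by rw [map_inf, hgγ]
          rcases hmax e ⟨he, heC⟩ with h' | h'
          · exact Or.inl (by rw [h4, h', hgγ])
          · have h6 : r ((h * g) e ⊓ γ) ((h * g) a ⊓ γ) := by
              rw [h4, h5]; exact (hr.map _).2 h'
            rw [h2]
            refine Or.inr ⟨hr.trans h6 h3.1, fun h' => h3.2 (hr.antisymm h3.1 ?_)⟩
            rw [← h']; exact h6
      · have hnot : ¬ γ < (h * g) e ⊓ α ((h * g) a) := by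
          intro hlt
          obtain ⟨hγe, hsink⟩ := hsink e ⟨he, heC⟩
          have hE : ∀ x ∈ Y, γ < (h * g) e ⊓ x → ∃ c ∈ C, γ < (h * g) e ⊓ c := fun x hx hxe =>
            (hi'.1 _ ⟨e, he, rfl⟩ x hx).exists_lt_inf hxe
          have hA' : ∀ x ∈ Y, γ < (h * g) a ⊓ x → ∃ c ∈ C, γ < (h * g) a ⊓ c := fun x hx hxe =>
            (hi'.1 _ ⟨a, ha.1, rfl⟩ x hx).exists_lt_inf hxe
          have hnone : ∀ c ∈ C, ¬ γ < (h * g) a ⊓ c := by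
            intro c hc hac
            have h1 : γ < (h * g) e ⊓ α c := lt_inf_trans hlt (hαlt hac)
            obtain ⟨c', hc', h2⟩ := hE _ (hXY (hαCX ⟨c, hc, rfl⟩)) h1
            exact hsink ⟨c, hc, c', hc', hgl hac hc, hgl h2 hc',
              lt_inf_trans (by rwa [inf_comm]) h1⟩
          have hnone' : ∀ c ∈ C, ¬ γ < (h * g) e ⊓ c := by
            intro c hc hec
            have h1 : γ < c ⊓ α ((h * g) a) := lt_inf_trans (by rwa [inf_comm]) hlt
            have h2 := hαlt' h1
            rw [inf_comm] at h2
            obtain ⟨c', hc', h3⟩ := hA' _ (hXY' c (hCX hc)) h2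
            exact hnone c' hc' h3
          by_cases hea : e = a
          · subst hea
            exact hα.above 1 one_pos _ (by rwa [pow_one])
          · have heD : (h * g) e ∈ g '' (A \ {a}) := by
              have : (h * g) e = g e := hhD _ ⟨e, ⟨he, hea⟩, rfl⟩
              rw [this]; exact ⟨e, ⟨he, hea⟩, rfl⟩
            have h1 := hαlt' hlt
            rw [inf_comm] at h1
            obtain ⟨d, hd, h2⟩ := (hgoodB _ (hsub (Or.inr ⟨_, heD, rfl⟩))).exists_lt_inf h1
            have h3 : γ < (h * g) e ⊓ α d := lt_inf_trans hlt (hαlt h2)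
            obtain ⟨x, hx, h4⟩ := (hgood _ heD d hd).exists_lt_inf h3
            obtain ⟨c, hc, h5⟩ := hE x (hXY hx) h4
            exact hnone' c hc h5
        have hγe : γ < (h * g) e := by
          conv_lhs => rw [← hgγ]
          exact (h * g).strictMono (hsink e ⟨he, heC⟩).1
        have hγa : γ < α ((h * g) a) := by
          have : γ < (h * g) a := by
            conv_lhs => rw [← hgγ]
            exact (h * g).strictMono (hsink a ha).1
          conv_lhs => rw [← hαγ]
          exact α.strictMono this
        have heq : (h * g) e ⊓ α ((h * g) a) = γ := by
          by_contra hne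
          exact hnot (lt_of_le_of_ne (le_inf hγe.le hγa.le) (Ne.symm hne))
        refine ⟨fun hre => ?_, Or.inl (heq ▸ hCX hC.base)⟩
        exfalso
        rcases hr with rfl | rfl
        · rw [inf_eq_right.2 hre] at heq
          exact hγa.ne' heq
        · rw [inf_eq_left.2 hre] at heq
          exact hγe.ne' heq
    intro e he z hz
    rw [himg] at hz
    rcases hz with rfl | hz
    · exact hlastgood e he
    · rw [himg] at he
      rcases he with rfl | he
      · refine Good.left_trans hr (hgoodB _ (hsub (Or.inl (Or.inr ⟨z, hz, rfl⟩)))) fun d hd => ?_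
        exact hgood d hd z hz
      · exact hgood e he z hz

end Core

/-! ### Back and forth -/

/-- A back-and-forth construction of a permutation of a countable set from finite approximations,
fulfilling countably many tasks on the way. -/
theorem exists_perm_of_approximations {Ω : Type*} [Countable Ω] {ι : Type*} [Countable ι]
    (Cond : Equiv.Perm Ω → Set Ω → Prop) (task : ι → Equiv.Perm Ω → Set Ω → Prop)
    (hstep : ∀ i σ X, X.Finite → Cond σ X → ∃ σ' X', X'.Finite ∧ Cond σ' X' ∧ X ⊆ X' ∧
      (∀ x ∈ X, σ' x = σ x) ∧ task i σ' X')
    (hdom : ∀ y σ X, X.Finite → Cond σ X → ∃ σ' X', X'.Finite ∧ Cond σ' X' ∧ X ⊆ X' ∧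
      (∀ x ∈ X, σ' x = σ x) ∧ y ∈ X')
    (hran : ∀ y σ X, X.Finite → Cond σ X → ∃ σ' X', X'.Finite ∧ Cond σ' X' ∧ X ⊆ X' ∧
      (∀ x ∈ X, σ' x = σ x) ∧ y ∈ σ' '' X')
    {σ₀ : Equiv.Perm Ω} {X₀ : Set Ω} (hX₀ : X₀.Finite) (h₀ : Cond σ₀ X₀) :
    ∃ σ : Equiv.Perm Ω, (∀ x ∈ X₀, σ x = σ₀ x) ∧
      (∀ i, ∃ σ' X', Cond σ' X' ∧ task i σ' X' ∧ ∀ x ∈ X', σ x = σ' x) ∧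
      ∀ F : Set Ω, F.Finite → ∃ σ' X', Cond σ' X' ∧ F ⊆ X' ∧ ∀ x ∈ X', σ x = σ' x := by
  classical
  let P : Type _ := {p : Equiv.Perm Ω × Set Ω // p.2.Finite ∧ Cond p.1 p.2}
  let K : Type _ := Option (ι ⊕ Ω ⊕ Ω)
  let goal : K → Equiv.Perm Ω → Set Ω → Prop := fun k σ X => match k with
    | none => True
    | some (Sum.inl i) => task i σ X
    | some (Sum.inr (Sum.inl y)) => y ∈ X
    | some (Sum.inr (Sum.inr y)) => y ∈ σ '' X
  have hnext : ∀ (k : K) (p : P), ∃ q : P, p.1.2 ⊆ q.1.2 ∧ (∀ x ∈ p.1.2, q.1.1 x = p.1.1 x) ∧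
      goal k q.1.1 q.1.2 := by
    rintro (_ | i | y | y) ⟨⟨σ, X⟩, hX, hc⟩
    · exact ⟨⟨⟨σ, X⟩, hX, hc⟩, subset_rfl, fun _ _ => rfl, trivial⟩
    · obtain ⟨σ', X', h1, h2, h3, h4, h5⟩ := hstep i σ X hX hc
      exact ⟨⟨⟨σ', X'⟩, h1, h2⟩, h3, h4, h5⟩
    · obtain ⟨σ', X', h1, h2, h3, h4, h5⟩ := hdom y σ X hX hc
      exact ⟨⟨⟨σ', X'⟩, h1, h2⟩, h3, h4, h5⟩
    · obtain ⟨σ', X', h1, h2, h3, h4, h5⟩ := hran y σ X hX hc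
      exact ⟨⟨⟨σ', X'⟩, h1, h2⟩, h3, h4, h5⟩
  choose next hnext1 hnext2 hnext3 using hnext
  obtain ⟨e, he⟩ := exists_surjective_nat K
  let s : ℕ → P := fun n => Nat.rec ⟨⟨σ₀, X₀⟩, hX₀, h₀⟩ (fun n p => next (e n) p) n
  have hs : ∀ n, s (n + 1) = next (e n) (s n) := fun n => rfl
  have hmono : ∀ m n, m ≤ n → (s m).1.2 ⊆ (s n).1.2 ∧ ∀ x ∈ (s m).1.2, (s n).1.1 x = (s m).1.1 x := by
    intro m n hmn
    induction n, hmn using Nat.le_induction with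
    | base => exact ⟨subset_rfl, fun _ _ => rfl⟩
    | succ n _ ih =>
      rw [hs]
      exact ⟨ih.1.trans (hnext1 _ _), fun x hx => (hnext2 _ _ x (ih.1 hx)).trans (ih.2 x hx)⟩
  have hgoal : ∀ k, ∃ n, goal k (s n).1.1 (s n).1.2 := fun k => by
    obtain ⟨n, rfl⟩ := he k
    exact ⟨n + 1, by rw [hs]; exact hnext3 _ _⟩
  have hmem : ∀ x, ∃ n, x ∈ (s n).1.2 := fun x => hgoal (some (Sum.inr (Sum.inl x)))
  choose N hN using hmem
  let f : Ω → Ω := fun x => (s (N x)).1.1 x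
  have hf : ∀ n, ∀ x ∈ (s n).1.2, f x = (s n).1.1 x := by
    intro n x hx
    rcases le_total n (N x) with h | h
    · exact (hmono _ _ h).2 x hx
    · exact ((hmono _ _ h).2 x (hN x)).symm
  have hcommon : ∀ F : Set Ω, F.Finite → ∃ n, F ⊆ (s n).1.2 := by
    intro F hF
    refine ⟨hF.toFinset.sup N, fun x hx => ?_⟩
    exact (hmono _ _ (Finset.le_sup (f := N) (hF.mem_toFinset.2 hx))).1 (hN x)
  have hbij : Function.Bijective f := by
    constructor
    · intro x y hxy
      obtain ⟨n, hn⟩ := hcommon {x, y} (by simp)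
      rw [hf n x (hn (by simp)), hf n y (hn (by simp))] at hxy
      exact (s n).1.1.injective hxy
    · intro y
      obtain ⟨n, x, hx, hxy⟩ := hgoal (some (Sum.inr (Sum.inr y)))
      exact ⟨x, (hf n x hx).trans hxy⟩
  refine ⟨Equiv.ofBijective f hbij, fun x hx => hf 0 x hx, fun i => ?_, fun F hF => ?_⟩
  · obtain ⟨n, hn⟩ := hgoal (some (Sum.inl i))
    exact ⟨(s n).1.1, (s n).1.2, (s n).2.2, hn, fun x hx => hf n x hx⟩
  · obtain ⟨n, hn⟩ := hcommon F hF
    exact ⟨(s n).1.1, (s n).1.2, (s n).2.2, hn, fun x hx => hf n x hx⟩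

section Core

variable {S : Type w} [SemilatticeInf S] [IsMeetTree S]
variable {γ : S} {G : Subgroup (S ≃o S)} {r : S → S → Prop} {I : Set S → Set S → Set S → Prop}

/-- An independent copy of `A` over `C` meeting the closure of its preimage under `α` only
in `C`. -/
theorem IndepFrame.exists_disjoint_image (F : IndepFrame γ G r I) {α : S ≃o S} (hαG : α ∈ G)
    (hα : MovesAll γ r α) {A C : Set S} (hA : TreeClosed γ A) (hC : TreeClosed γ C) (hCA : C ⊆ A) :
    ∃ g ∈ G, (∀ c ∈ C, g c = c) ∧
      ∀ x ∈ g '' A, x ∈ treeClosure γ (α.symm '' (g '' A) ∪ C) → x ∈ C := by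
  have hr := F.direction
  have hαγ := F.fix α hαG
  set X := treeClosure γ (C ∪ α '' C) with hXdef
  have hX : TreeClosed γ X := treeClosed_treeClosure γ (hC.finite.union (hC.finite.image α))
  have hXs : C ∪ α '' C ⊆ X := subset_treeClosure γ _
  set Y := treeClosure γ (X ∪ α.symm '' X) with hYdef
  have hY : TreeClosed γ Y := treeClosed_treeClosure γ (hX.finite.union (hX.finite.image α.symm))
  have hYs : X ∪ α.symm '' X ⊆ Y := subset_treeClosure γ _
  obtain ⟨g, hg, hgC, hi, hgood⟩ := F.exists_indep_image hαG hα hA hC hY hCA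
    (Set.subset_union_left.trans hXs) (Set.subset_union_right.trans hXs)
    (Set.subset_union_left.trans hYs) fun x hx => hYs (Or.inr ⟨x, hx, rfl⟩)
  refine ⟨g, hg, hgC, fun x hx hx' => ?_⟩
  have hCgA : C ⊆ g '' A := fun c hc => ⟨c, hCA hc, hgC c hc⟩
  have hun : TreeClosed γ (g '' A ∪ X) := (hA.image g (F.fix g hg)).union hX hCgA
    (Set.subset_union_left.trans hXs) fun a ha b hb => hi.1 a ha b (hYs (Or.inl hb))
  have h1 : α x ∈ g '' A ∪ X := by
    have h2 : α x ∈ α '' treeClosure γ (α.symm '' (g '' A) ∪ C) := ⟨x, hx', rfl⟩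
    rw [image_treeClosure _ α hαγ, Set.image_union, ← Set.image_comp] at h2
    refine treeClosure_minimal hun ?_ h2
    rintro _ (⟨y, hy, rfl⟩ | hy)
    · exact Or.inl (by simpa using hy)
    · exact Or.inr (hXs (Or.inr hy))
  have h2 : α x ∈ X := h1.elim (fun h => mem_of_good_self hr (hgood _ h x hx)) id
  have h3 : x ∈ Y := hYs (Or.inr ⟨α x, h2, α.symm_apply_apply x⟩)
  exact mem_of_good_self hr (hi.1 x hx x h3)

/-- The extension step in the construction of a maximally moving commutator. -/
theorem IndepFrame.exists_extension (F : IndepFrame γ G r I)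
    (F' : IndepFrame γ G (flip r) (opIndep I)) {α : S ≃o S} (hαG : α ∈ G) (hα : MovesAll γ r α)
    {β₀ : S ≃o S} (hβ₀ : β₀ ∈ G) {W : Set S} (hW : W.Finite) {A C : Set S} (hA : TreeClosed γ A)
    (hC : TreeClosed γ C) (hCA : C ⊆ A) :
    ∃ β ∈ G, ∃ W' : Set S, W'.Finite ∧ W ⊆ W' ∧ (∀ x ∈ W, β x = β₀ x) ∧
      ∀ β' ∈ G, (∀ x ∈ W', β' x = β x) → ∃ g ∈ G, (∀ c ∈ C, g c = c) ∧
        Indep r I (g '' A) C (treeClosure γ ((β'⁻¹ * α⁻¹ * β' * α) '' (g '' A) ∪ C)) := by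
  have hr := F.direction
  have hαγ := F.fix α hαG
  set X := treeClosure γ (W ∪ C ∪ α '' C) with hXdef
  have hX : TreeClosed γ X := treeClosed_treeClosure γ
    ((hW.union hC.finite).union (hC.finite.image α))
  have hXs : W ∪ C ∪ α '' C ⊆ X := subset_treeClosure γ _
  have hCX : C ⊆ X := fun c hc => hXs (Or.inl (Or.inr hc))
  have hαCX : α '' C ⊆ X := fun c hc => hXs (Or.inr hc)
  set Y := treeClosure γ (X ∪ α.symm '' X) with hYdef
  have hY : TreeClosed γ Y := treeClosed_treeClosure γ (hX.finite.union (hX.finite.image α.symm))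
  have hYs : X ∪ α.symm '' X ⊆ Y := subset_treeClosure γ _
  have hXY : X ⊆ Y := Set.subset_union_left.trans hYs
  have hXY' : ∀ x ∈ X, α.symm x ∈ Y := fun x hx => hYs (Or.inr ⟨x, hx, rfl⟩)
  obtain ⟨g, hg, hgC, hi, hgood⟩ := F.exists_indep_image hαG hα hA hC hY hCA hCX hαCX hXY hXY'
  have hgA := hA.image g (F.fix g hg)
  have hCgA : C ⊆ g '' A := fun c hc => ⟨c, hCA hc, hgC c hc⟩
  set Z := α '' (g '' A) ∪ X with hZdef
  have hZ : TreeClosed γ Z := by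
    refine (hgA.image α hαγ).union (r := r) (C := α '' C) hX (Set.image_mono hCgA) hαCX ?_
    rintro _ ⟨a, ha, rfl⟩ x hx
    have := (hi.1 a ha _ (hXY' x hx)).map hr α
    rwa [α.apply_symm_apply] at this
  have hXZ : X ⊆ Z := Set.subset_union_right
  have hβ₀γ := F.fix β₀ hβ₀
  obtain ⟨h, hh, hhY, hdisj⟩ := F.exists_disjoint_image hαG hα (hZ.image β₀ hβ₀γ)
    (hX.image β₀ hβ₀γ) (Set.image_mono hXZ)
  set β₁ := h * β₀ with hβ₁def
  have hβ₁ : β₁ ∈ G := G.mul_mem hh hβ₀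
  have hβ₁X : ∀ x ∈ X, β₁ x = β₀ x := fun x hx => hhY _ ⟨x, hx, rfl⟩
  set φ : S → S := fun e => β₁.symm (α.symm (β₁ (α e))) with hφ
  set B := treeClosure γ (Z ∪ φ '' (g '' A)) with hBdef
  have hB : TreeClosed γ B := treeClosed_treeClosure γ (hZ.finite.union (hgA.finite.image φ))
  have hBs : Z ∪ φ '' (g '' A) ⊆ B := subset_treeClosure γ _
  set A' := treeClosure γ (g '' A ∪ Z) with hA'def
  have hA' : TreeClosed γ A' := treeClosed_treeClosure γ (hgA.finite.union hZ.finite)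
  have hA's : g '' A ∪ Z ⊆ A' := subset_treeClosure γ _
  obtain ⟨k, hk, hkZ, hik⟩ := F'.exists_indep hB hA' hZ (Set.subset_union_left.trans hBs)
  rw [indep_op] at hik
  have hkB := hB.image k (F.fix k hk)
  have hkZ' : ∀ z ∈ Z, k⁻¹ z = z := fun z hz => by
    conv_lhs => rw [← hkZ z hz]
    exact k.symm_apply_apply z
  have hZkB : Z ⊆ k '' B := fun z hz => ⟨z, hBs (Or.inl hz), hkZ z hz⟩
  set β := β₁ * k⁻¹ with hβdef
  have hβ : β ∈ G := G.mul_mem hβ₁ (G.inv_mem hk)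
  have hβZ : ∀ z ∈ Z, β z = β₁ z := fun z hz => congrArg β₁ (hkZ' z hz)
  have hβφ : ∀ e, β (k (φ e)) = α.symm (β₁ (α e)) := fun e => by
    change β₁ (k.symm (k (φ e))) = _
    rw [k.symm_apply_apply, hφ, β₁.apply_symm_apply]
  have hWX : W ⊆ X := fun x hx => hXs (Or.inl (Or.inl hx))
  refine ⟨β, hβ, W ∪ Z ∪ k '' B, (hW.union hZ.finite).union hkB.finite,
    fun x hx => Or.inl (Or.inl hx), fun x hx =>
      (hβZ x (hXZ (hWX hx))).trans (hβ₁X x (hWX hx)), fun β' hβ' hagree => ⟨g, hg, hgC, ?_⟩⟩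
  have hf : ∀ e ∈ g '' A, (β'⁻¹ * α⁻¹ * β' * α) e = k (φ e) := by
    intro e he
    change β'.symm (α.symm (β' (α e))) = _
    have h1 : α e ∈ Z := Or.inl ⟨e, he, rfl⟩
    rw [hagree _ (Or.inl (Or.inr h1)), hβZ _ h1, ← hβφ, β'.symm_apply_eq]
    exact (hagree _ (Or.inr ⟨_, hBs (Or.inr ⟨e, he, rfl⟩), rfl⟩)).symm
  rw [Set.image_congr hf]
  set E := treeClosure γ ((fun e => k (φ e)) '' (g '' A) ∪ X) with hEdef
  have hE : TreeClosed γ E := treeClosed_treeClosure γ ((hgA.finite.image _).union hX.finite)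
  have hEs : (fun e => k (φ e)) '' (g '' A) ∪ X ⊆ E := subset_treeClosure γ _
  have hEkB : E ⊆ k '' B := by
    refine treeClosure_minimal hkB ?_
    rintro _ (⟨e, he, rfl⟩ | hx)
    · exact ⟨φ e, hBs (Or.inr ⟨e, he, rfl⟩), rfl⟩
    · exact hZkB (hXZ hx)
  have hgoodZ : ∀ e ∈ g '' A, ∀ z ∈ Z, Good r X e z := by
    rintro e he _ (⟨z, hz, rfl⟩ | hz)
    · exact hgood e he z hz
    · exact good_of_mem_right hr e hz
  have hZE : Z ∩ E ⊆ X := by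
    rintro z ⟨hzZ, hzE⟩
    have h1 : β z ∈ β '' E := ⟨z, hzE, rfl⟩
    rw [hEdef, image_treeClosure _ β (F.fix β hβ), hβZ z hzZ] at h1
    have h2 : β₁ z ∈ β₀ '' X := by
      refine hdisj _ ⟨β₀ z, ⟨z, hzZ, rfl⟩, rfl⟩ (treeClosure_mono ?_ h1)
      rintro _ ⟨_, ⟨e, he, rfl⟩ | hx, rfl⟩
      · refine Or.inl ⟨β₁ (α e), ?_, (hβφ e).symm⟩
        exact ⟨β₀ (α e), ⟨α e, Or.inl ⟨e, he, rfl⟩, rfl⟩, rfl⟩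
      · exact Or.inr ⟨_, hx, ((hβZ _ (hXZ hx)).trans (hβ₁X _ hx)).symm⟩
    obtain ⟨x, hx, hxz⟩ := h2
    rw [← hβ₁X x hx] at hxz
    exact β₁.injective hxz ▸ hx
  have hIE : I (g '' A) C E := by
    have hI := F.indep
    have h1 : I (g '' A ∪ X) Z E := hI.mono hA'.finite hkB.finite hZ.finite
      ((Set.union_subset_union_right _ hXZ).trans hA's) hEkB hik.2
    have h2 : I (g '' A ∪ X) X E := by
      refine hI.free (hgA.finite.union hX.finite) hE.finite hZ.finite hXZ h1 ?_
      rintro z ⟨hzZ, (hz | hz) | hz⟩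
      · exact mem_of_good_self hr (hgoodZ z hz z hzZ)
      · exact hz
      · exact hZE ⟨hzZ, hz⟩
    refine hI.right_trans hgA.finite hE.finite hCX (Set.subset_union_right.trans hEs)
      (hI.mono (hgA.finite.union hX.finite) hE.finite hX.finite Set.subset_union_left subset_rfl
        h2) ?_
    exact hI.mono hgA.finite hY.finite hC.finite subset_rfl hXY hi.2
  have hfin : Indep r I (g '' A) C E := by
    refine ⟨fun e he d hd => ?_, hIE⟩
    have h1 : Good r X e d := Good.right_trans hr
      (hik.1 e (hA's (Or.inl he)) d (hEkB hd)) (hgoodZ e he)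
    exact Good.right_trans hr h1 fun x hx => hi.1 e he x (hXY hx)
  exact hfin.mono F.indep hgA.finite hE.finite hC.finite subset_rfl
    (treeClosure_mono (Set.union_subset_union_right _ hCX))

theorem exists_maximally_moving_commutator [Countable S]
    (F : IndepFrame γ G (· ≤ ·) I) (F' : IndepFrame γ G (· ≥ ·) (opIndep I))
    (hlim : ∀ σ : S ≃o S, (∀ X : Set S, X.Finite → ∃ g ∈ G, ∀ x ∈ X, σ x = g x) → σ ∈ G)
    {α : S ≃o S} (hαG : α ∈ G) (hα : MovesAll γ (· ≤ ·) α) (hα' : MovesAll γ (· ≥ ·) α⁻¹) :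
    ∃ β ∈ G, ∀ A C : Set S, TreeClosed γ A → TreeClosed γ C → C ⊆ A →
      (∃ g ∈ G, (∀ c ∈ C, g c = c) ∧
        Indep (· ≤ ·) I (g '' A) C (treeClosure γ ((β⁻¹ * α⁻¹ * β * α) '' (g '' A) ∪ C))) ∧
      (∃ g ∈ G, (∀ c ∈ C, g c = c) ∧
        Indep (· ≤ ·) I (treeClosure γ ((α⁻¹ * β⁻¹ * α * β) '' (g '' A) ∪ C)) C (g '' A)) := by
  classical
  let Cond : Equiv.Perm S → Set S → Prop := fun σ _ => ∃ g ∈ G, g.toEquiv = σ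
  let R : Bool → Set S → Set S → (S ≃o S) → Prop := fun b A C β => cond b
    (∃ g ∈ G, (∀ c ∈ C, g c = c) ∧
      Indep (· ≤ ·) I (g '' A) C (treeClosure γ ((β⁻¹ * α⁻¹ * β * α) '' (g '' A) ∪ C)))
    (∃ g ∈ G, (∀ c ∈ C, g c = c) ∧ Indep (· ≥ ·) (opIndep I) (g '' A) C
      (treeClosure γ ((β⁻¹ * α⁻¹⁻¹ * β * α⁻¹) '' (g '' A) ∪ C)))
  let task : Bool × Finset S × Finset S → Equiv.Perm S → Set S → Prop := fun t σ X =>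
    TreeClosed γ (t.2.1 : Set S) → TreeClosed γ (t.2.2 : Set S) → t.2.2 ⊆ t.2.1 →
      ∀ β ∈ G, (∀ x ∈ X, β x = σ x) → R t.1 t.2.1 t.2.2 β
  obtain ⟨σ, -, htask, hloc⟩ := exists_perm_of_approximations Cond task (by
      rintro ⟨b, A, C⟩ _ X hX ⟨g, hg, rfl⟩
      by_cases hAC : TreeClosed γ (A : Set S) ∧ TreeClosed γ (C : Set S) ∧ C ⊆ A
      · obtain ⟨hA, hC, hCA⟩ := hAC
        cases b
        · obtain ⟨β, hβ, W', hW', hXW', hagree, h⟩ := F'.exists_extension F (G.inv_mem hαG) hα'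
            hg hX hA hC (Finset.coe_subset.2 hCA)
          exact ⟨β.toEquiv, W', hW', ⟨β, hβ, rfl⟩, hXW', hagree, fun _ _ _ => h⟩
        · obtain ⟨β, hβ, W', hW', hXW', hagree, h⟩ := F.exists_extension F' hαG hα
            hg hX hA hC (Finset.coe_subset.2 hCA)
          exact ⟨β.toEquiv, W', hW', ⟨β, hβ, rfl⟩, hXW', hagree, fun _ _ _ => h⟩
      · exact ⟨g.toEquiv, X, hX, ⟨g, hg, rfl⟩, subset_rfl, fun _ _ => rfl,
          fun hA hC hCA => absurd ⟨hA, hC, hCA⟩ hAC⟩)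
    (fun y σ X hX h => ⟨σ, insert y X, hX.insert y, h, Set.subset_insert _ _, fun _ _ => rfl,
      Set.mem_insert _ _⟩)
    (fun y σ X hX h => ⟨σ, insert (σ.symm y) X, hX.insert _, h, Set.subset_insert _ _,
      fun _ _ => rfl, ⟨σ.symm y, Set.mem_insert _ _, σ.apply_symm_apply y⟩⟩)
    (σ₀ := 1) (X₀ := ∅) Set.finite_empty ⟨1, G.one_mem, rfl⟩
  let β : S ≃o S := ⟨σ, fun {x y} => by
    obtain ⟨_, X', ⟨g, hg, rfl⟩, hF, h⟩ := hloc {x, y} (by simp)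
    rw [h x (hF (by simp)), h y (hF (by simp))]
    exact g.le_iff_le⟩
  have hβ : β ∈ G := hlim β fun X hX => by
    obtain ⟨_, X', ⟨g, hg, rfl⟩, hF, h⟩ := hloc X hX
    exact ⟨g, hg, fun x hx => h x (hF hx)⟩
  have hR : ∀ b (A C : Set S), TreeClosed γ A → TreeClosed γ C → C ⊆ A → R b A C β := by
    intro b A C hA hC hCA
    obtain ⟨σ', X', -, h1, h2⟩ := htask (b, hA.finite.toFinset, hC.finite.toFinset)
    have h3 := h1 (by simpa using hA) (by simpa using hC) (by simpa using hCA) β hβ h2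
    simpa only [Set.Finite.coe_toFinset] using h3
  refine ⟨β, hβ, fun A C hA hC hCA => ⟨hR true A C hA hC hCA, ?_⟩⟩
  have hαγ := F.fix α hαG
  obtain ⟨g, hg, hgC, hi⟩ := hR false (α '' A) (α '' C) (hA.image α hαγ) (hC.image α hαγ)
    (Set.image_mono hCA)
  have hi : Indep (· ≤ ·) I _ _ _ := indep_op.1 hi
  have hαG' := G.inv_mem hαG
  have hgA := ((hA.image α hαγ).image g (F.fix g hg)).finite
  have hi' := hi.map F.direction F.indep
    (treeClosed_treeClosure γ ((hgA.image _).union (hC.image α hαγ).finite)).finite hgA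
    (hC.image α hαγ).finite hαG'
  refine ⟨α⁻¹ * g * α, G.mul_mem (G.mul_mem hαG' hg) hαG, fun c hc => ?_, ?_⟩
  · change α.symm (g (α c)) = c
    rw [hgC _ ⟨c, hc, rfl⟩, α.symm_apply_apply]
  · have h1 : (α⁻¹ : S ≃o S) '' (α '' C) = C := by rw [← image_mul, inv_mul_cancel]; exact Set.image_id C
    rw [image_treeClosure _ _ (F.fix _ hαG'), Set.image_union, h1] at hi'
    simp only [← image_mul] at hi' ⊢
    have h2 : α⁻¹ * β⁻¹ * α * β * (α⁻¹ * g * α) =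
        α⁻¹ * (β⁻¹ * α⁻¹⁻¹ * β * α⁻¹ * (g * α)) := by group
    rw [h2, mul_assoc α⁻¹ g α]
    exact hi'

end Core

/-! ### Extension properties of generic meet-tree expansions -/

section Generic

open FirstOrder.Language FirstOrder.Language.Structure

/-- The map `f` preserves and reflects the relations of `LR` on `X`. -/
def RelPreserving (LR : FirstOrder.Language.{u, v}) {T : Type w} [LR.Structure T] (X : Set T)
    (f : T → T) : Prop :=
  ∀ (n : ℕ) (R : LR.Relations n) (x : Fin n → T), (∀ i, x i ∈ X) →
    (RelMap R (f ∘ x) ↔ RelMap R x)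

/-- A map on a finite substructure of an ultrahomogeneous relational structure which preserves all
relations extends to an automorphism. -/
theorem exists_relational_automorphism {LR : FirstOrder.Language.{u, v}} [LR.IsRelational]
    {T : Type w} [LR.Structure T] (h : LR.IsUltrahomogeneous T) {X : Set T} (hX : X.Finite)
    {f : T → T} (hf : Set.InjOn f X) (hR : RelPreserving LR X f) :
    ∃ σ : T ≃[LR] T, ∀ x ∈ X, σ x = f x := by
  have : Finite X := hX
  let A : LR.Substructure T := ⟨X, fun {n} f => isEmptyElim f⟩
  have : Finite A := hX
  let e : A ↪[LR] T :=
    { toFun := fun x => f x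
      inj' := fun x y hxy => Subtype.ext (hf x.2 y.2 hxy)
      map_fun' := fun {n} f => isEmptyElim f
      map_rel' := fun {n} R x => hR n R (fun i => x i) fun i => (x i).2 }
  obtain ⟨σ, hσ⟩ := h A Substructure.FG.of_finite e
  exact ⟨σ, fun x hx => (DFunLike.congr_fun hσ ⟨x, hx⟩).symm⟩

variable {LR : FirstOrder.Language.{u, v}} {T : Type w} [LR.Structure T] [SemilatticeInf T]

theorem map_inf_of_equiv (σ : T ≃[LR.sum treeLang] T) (x y : T) : σ (x ⊓ y) = σ x ⊓ σ y :=
  σ.map_fun (Sum.inr TreeFunctions.meet : (LR.sum treeLang).Functions 2) ![x, y]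

theorem relMap_equiv (σ : T ≃[LR.sum treeLang] T) {n : ℕ} (R : LR.Relations n) (x : Fin n → T) :
    RelMap R (σ ∘ x) ↔ RelMap R x :=
  σ.map_rel (Sum.inl R : (LR.sum treeLang).Relations n) x

theorem le_equiv_iff (σ : T ≃[LR.sum treeLang] T) {x y : T} : σ x ≤ σ y ↔ x ≤ y :=
  σ.map_rel (Sum.inr TreeRelations.le : (LR.sum treeLang).Relations 2) ![x, y]

theorem le_iff_of_inf {P Q : Type*} [SemilatticeInf P] [SemilatticeInf Q] {X : Set P} {f : P → Q}
    (hX : ∀ {x y}, x ∈ X → y ∈ X → x ⊓ y ∈ X) (hf : Set.InjOn f X)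
    (hinf : ∀ x ∈ X, ∀ y ∈ X, f (x ⊓ y) = f x ⊓ f y) {x y : P} (hx : x ∈ X) (hy : y ∈ X) :
    f x ≤ f y ↔ x ≤ y := by
  rw [← inf_eq_left, ← inf_eq_left, ← hinf x hx y hy, hf.eq_iff (hX hx hy) hx]

variable [LR.IsRelational] [Countable T]

theorem exists_automorphism (hT : IsGenericMeetTreeExpansion LR T) {X : Set T} (hX : X.Finite)
    (hXinf : ∀ {x y}, x ∈ X → y ∈ X → x ⊓ y ∈ X) {f : T → T} (hf : Set.InjOn f X)
    (hinf : ∀ x ∈ X, ∀ y ∈ X, f (x ⊓ y) = f x ⊓ f y) (hR : RelPreserving LR X f) :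
    ∃ σ : T ≃[LR.sum treeLang] T, ∀ x ∈ X, σ x = f x := by
  let A : (LR.sum treeLang).Substructure T := ⟨X, by
    rintro n (F | F)
    · exact isEmptyElim F
    · exact match n, F with
        | _, TreeFunctions.meet => fun x hx => hXinf (hx 0) (hx 1)⟩
  have : Finite A := hX
  let e : A ↪[LR.sum treeLang] T :=
    { toFun := fun x => f x
      inj' := fun x y hxy => Subtype.ext (hf x.2 y.2 hxy)
      map_fun' := by
        rintro n (F | F) x
        · exact isEmptyElim F
        · exact match n, F, x with
            | _, TreeFunctions.meet, x => hinf _ (x 0).2 _ (x 1).2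
      map_rel' := by
        rintro n (R | R) x
        · exact hR n R (fun i => x i) fun i => (x i).2
        · exact match n, R, x with
            | _, TreeRelations.le, x => le_iff_of_inf hXinf hf hinf (x 0).2 (x 1).2 }
  obtain ⟨σ, hσ⟩ := hT.ultrahomogeneous A Substructure.FG.of_finite e
  exact ⟨σ, fun x hx => (DFunLike.congr_fun hσ ⟨x, hx⟩).symm⟩

/-- Every finite meet-tree, with any `LR`-structure from the age, embeds. -/
theorem exists_embedding (hT : IsGenericMeetTreeExpansion LR T) {P : Type w} [Finite P]
    [SemilatticeInf P] [IsMeetTree P] {j : P → T} (hj : Function.Injective j) :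
    ∃ e : P → T, Function.Injective e ∧ (∀ x y, e (x ⊓ y) = e x ⊓ e y) ∧
      ∀ (n : ℕ) (R : LR.Relations n) (x : Fin n → P), RelMap R (e ∘ x) ↔ RelMap R (j ∘ x) := by
  let _ : LR.Structure P := ⟨fun {n} f => isEmptyElim f, fun {n} R x => RelMap R (j ∘ x)⟩
  let N : Bundled.{w} (LR.sum treeLang).Structure := ⟨P, inferInstance⟩
  have hN : N ∈ mix (LR.age T) finiteMeetTrees := by
    refine ⟨⟨?_, ⟨?_⟩⟩, ‹Finite P›, ‹SemilatticeInf P›, ‹IsMeetTree P›, rfl⟩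
    · have : Finite N := ‹Finite P›
      exact @Structure.FG.of_finite _ N _ this
    · exact
        { toFun := j
          inj' := hj
          map_fun' := fun {n} f => isEmptyElim f
          map_rel' := fun {n} R x => Iff.rfl }
  rw [← hT.age] at hN
  obtain ⟨-, ⟨e⟩⟩ := hN
  refine ⟨e, e.injective, fun x y => ?_, fun n R x => ?_⟩
  · exact e.map_fun (Sum.inr TreeFunctions.meet : (LR.sum treeLang).Functions 2) ![x, y]
  · exact e.map_rel (Sum.inl R : (LR.sum treeLang).Relations n) x

theorem exists_embedding_extending (hT : IsGenericMeetTreeExpansion LR T) {P : Type w} [Finite P]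
    [SemilatticeInf P] [IsMeetTree P] {j : P → T} (hj : Function.Injective j) {Q : Set P}
    (hQ : ∀ x ∈ Q, ∀ y ∈ Q, x ⊓ y ∈ Q ∧ j (x ⊓ y) = j x ⊓ j y) :
    ∃ e : P → T, Function.Injective e ∧ (∀ x y, e (x ⊓ y) = e x ⊓ e y) ∧
      (∀ (n : ℕ) (R : LR.Relations n) (x : Fin n → P), RelMap R (e ∘ x) ↔ RelMap R (j ∘ x)) ∧
      ∀ q ∈ Q, e q = j q := by
  obtain ⟨e, he, heinf, heR⟩ := exists_embedding hT hj
  by_cases hP : IsEmpty P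
  · exact ⟨e, he, heinf, heR, fun q => (hP.false q).elim⟩
  have : Nonempty P := not_isEmpty_iff.1 hP
  have hinv : ∀ p, j (Function.invFun e (e p)) = j p := fun p => by
    rw [Function.leftInverse_invFun he p]
  obtain ⟨σ, hσ⟩ := exists_automorphism hT (X := e '' Q) (f := fun t => j (Function.invFun e t))
    (Set.toFinite _) (by
      rintro _ _ ⟨x, hx, rfl⟩ ⟨y, hy, rfl⟩
      exact ⟨x ⊓ y, (hQ x hx y hy).1, heinf x y⟩) (by
      rintro _ ⟨x, hx, rfl⟩ _ ⟨y, hy, rfl⟩ hxy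
      simp only [hinv] at hxy
      rw [hj hxy]) (by
      rintro _ ⟨x, hx, rfl⟩ _ ⟨y, hy, rfl⟩
      rw [← heinf]
      simp only [hinv]
      exact (hQ x hx y hy).2) (by
      intro n R x hx
      choose y hy hyx using hx
      obtain rfl : e ∘ y = x := funext hyx
      rw [heR]
      have : (fun t => j (Function.invFun e t)) ∘ e ∘ y = j ∘ y := funext fun i => hinv _
      rw [this])
  refine ⟨σ ∘ e, σ.injective.comp he, fun x y => ?_, fun n R x => ?_, fun q hq => ?_⟩
  · exact (congrArg σ (heinf x y)).trans (map_inf_of_equiv σ _ _)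
  · rw [Function.comp_assoc, relMap_equiv, heR]
  · exact (hσ _ ⟨q, hq, rfl⟩).trans (hinv q)

/-- The one-point extension property: any position over a finite closed set is realised together
with any `LR`-type of a point outside. -/
theorem exists_position_type [IsMeetTree T] (hT : IsGenericMeetTreeExpansion LR T)
    [DecidableEq T] {B : Set T} (hB : B.Finite) (hBinf : ∀ {x y}, x ∈ B → y ∈ B → x ⊓ y ∈ B)
    {a m : T} (ha : a ∉ B) (haB : ∀ b ∈ B, a ⊓ b ∈ insert a B) (hm : m ∉ B) :
    ∃ y, y ∉ B ∧ SamePosition B a y ∧ RelPreserving LR (insert y B) (Function.update id y m) := by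
  have hclosed : ∀ x y, x ∈ insert a B → y ∈ insert a B → x ⊓ y ∈ insert a B := by
    rintro x y (rfl | hx) (rfl | hy)
    · exact Or.inl (inf_idem _)
    · exact haB y hy
    · rw [inf_comm]; exact haB x hx
    · exact Or.inr (hBinf hx hy)
  let P : Type w := {x // x ∈ insert a B}
  let _ : SemilatticeInf P := Subtype.semilatticeInf fun x y hx hy => hclosed x y hx hy
  have : Finite P := hB.insert a
  have : IsMeetTree P := ⟨fun p x hx y hy hxy => by
    exact le_or_le_of_le (x := x.1) (y := y.1) (z := p.1) hx.le hy.le⟩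
  have hjB : ∀ p : P, p.1 ∈ B → Function.update id a m p.1 = p.1 := fun p hp =>
    Function.update_of_ne (fun h => ha (by rwa [h] at hp)) _ _
  have hja : ∀ p : P, p.1 ∉ B → p.1 = a := fun p hp => p.2.resolve_right hp
  have hinj : Function.Injective fun p : P => Function.update id a m p.1 := by
    intro p q hpq
    simp only at hpq
    by_cases hp : p.1 ∈ B <;> by_cases hq : q.1 ∈ B
    · rw [hjB p hp, hjB q hq] at hpq; exact Subtype.ext hpq
    · rw [hjB p hp, hja q hq, Function.update_self] at hpq
      exact absurd (hpq ▸ hp) hm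
    · rw [hjB q hq, hja p hp, Function.update_self] at hpq
      exact absurd (hpq ▸ hq) hm
    · exact Subtype.ext ((hja p hp).trans (hja q hq).symm)
  obtain ⟨e, he, heinf, heR, heQ⟩ := exists_embedding_extending hT hinj (Q := {p : P | p.1 ∈ B})
    (fun x hx y hy => ⟨hBinf hx hy, by
      rw [hjB x hx, hjB y hy]
      exact hjB (x ⊓ y) (hBinf hx hy)⟩)
  let a' : P := ⟨a, Or.inl rfl⟩
  have heB : ∀ b (hb : b ∈ B), e ⟨b, Or.inr hb⟩ = b := fun b hb =>
    (heQ ⟨b, Or.inr hb⟩ hb).trans (hjB ⟨b, Or.inr hb⟩ hb)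
  have hyB : e a' ∉ B := fun h => by
    have h1 := he (heB _ h)
    have h2 : e a' = a := congrArg Subtype.val h1
    rw [h2] at h
    exact ha h
  refine ⟨e a', hyB, fun b hb => ?_, fun n R x hx => ?_⟩
  · have h1 : e a' ⊓ b = e (a' ⊓ ⟨b, Or.inr hb⟩) := by rw [heinf, heB b hb]
    by_cases hab : a ≤ b
    · refine Or.inl ⟨hab, ?_⟩
      have h2 : a' ⊓ ⟨b, Or.inr hb⟩ = a' := Subtype.ext (inf_eq_left.2 hab)
      rw [h2] at h1
      exact inf_eq_left.1 h1
    · have hmem : a ⊓ b ∈ B := (haB b hb).resolve_left fun h => hab (inf_eq_left.1 h)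
      have h2 : a' ⊓ ⟨b, Or.inr hb⟩ = ⟨a ⊓ b, Or.inr hmem⟩ := rfl
      rw [h2, heB _ hmem] at h1
      refine Or.inr ⟨hab, fun h => hyB ?_, h1.symm⟩
      rw [inf_eq_left.2 h] at h1
      rwa [h1]
  · have h1 : ∀ i, ∃ p : P, e p = x i := fun i => by
      rcases hx i with h | h
      · exact ⟨a', h.symm⟩
      · exact ⟨⟨x i, Or.inr h⟩, heB _ h⟩
    choose p hp using h1
    obtain rfl : e ∘ p = x := funext hp
    rw [heR]
    have : Function.update id (e a') m ∘ e ∘ p = (fun p : P => Function.update id a m p.1) ∘ p := by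
      funext i
      simp only [Function.comp_apply]
      by_cases hpi : (p i).1 ∈ B
      · have h2 : e (p i) = (p i).1 := heB _ hpi
        rw [hjB _ hpi, Function.update_of_ne fun h => hyB (by rw [← h, h2]; exact hpi)]
        exact h2
      · have h2 : p i = a' := Subtype.ext (hja _ hpi)
        rw [h2, Function.update_self, Function.update_self]
    rw [this]

/-- The meet-tree with a root and `n` leaves. -/
inductive Star (n : ℕ) : Type w
  | root : Star n
  | leaf : Fin n → Star n

open Classical in
noncomputable instance (n : ℕ) : Min (Star.{w} n) := ⟨fun x y => if x = y then x else Star.root⟩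

open Classical in
theorem Star.min_def {n : ℕ} (x y : Star.{w} n) : x ⊓ y = if x = y then x else Star.root := rfl

noncomputable instance (n : ℕ) : SemilatticeInf (Star.{w} n) := SemilatticeInf.mk'
  (fun a b => by simp only [Star.min_def]; grind) (fun a b c => by simp only [Star.min_def]; grind)
  (fun a => by simp only [Star.min_def]; grind)

open Classical in
theorem Star.inf_def {n : ℕ} (x y : Star.{w} n) : x ⊓ y = if x = y then x else Star.root := rfl

instance (n : ℕ) : Finite (Star.{w} n) :=
  Finite.of_injective (fun x : Star.{w} n => match x with
    | Star.root => (none : Option (Fin n))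
    | Star.leaf i => some i) fun x y => by cases x <;> cases y <;> simp

instance (n : ℕ) : IsMeetTree (Star.{w} n) := by
  have hle : ∀ x y : Star.{w} n, x < y → x = Star.root := fun x y h => by
    have h1 : x ⊓ y = x := inf_eq_left.2 h.le
    rw [Star.inf_def, if_neg h.ne] at h1
    exact h1.symm
  exact ⟨fun p x hx y hy hxy => absurd ((hle x p hx).trans (hle y p hy).symm) hxy⟩

theorem exists_cone_family [Infinite T] (hT : IsGenericMeetTreeExpansion LR T) (u : T) (n : ℕ) :
    ∃ y : Fin n → T, (∀ i, u < y i) ∧ ∀ i j, i ≠ j → y i ⊓ y j = u := by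
  classical
  let P : Type w := Star.{w} n
  obtain ⟨j, hj⟩ : ∃ j : P → T, Function.Injective j := by
    obtain ⟨k, ⟨f⟩⟩ := Finite.exists_equiv_fin P
    exact ⟨fun p => Infinite.natEmbedding T (f p), fun p q h => by
      simpa [Fin.val_inj] using (Infinite.natEmbedding T).injective h⟩
  let j' : P → T := fun p => Equiv.swap (j Star.root) u (j p)
  have hj' : Function.Injective j' := (Equiv.injective _).comp hj
  have hj'u : j' Star.root = u := Equiv.swap_apply_left _ _
  obtain ⟨e, he, heinf, -, heQ⟩ := exists_embedding_extending hT hj' (Q := {Star.root}) (by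
    rintro _ rfl _ rfl
    rw [inf_idem, inf_idem]
    exact ⟨rfl, rfl⟩)
  have heu : e Star.root = u := (heQ _ rfl).trans hj'u
  refine ⟨fun i => e (Star.leaf i), fun i => ?_, fun i k hik => ?_⟩
  · refine lt_of_le_of_ne ?_ fun h => ?_
    · rw [← inf_eq_left, ← heu, ← heinf, Star.inf_def, if_neg (by simp)]
    · rw [← heu] at h
      simpa using he h
  · rw [← heinf, Star.inf_def, if_neg (by simpa using hik), heu]

theorem isRichTree [Infinite T] [IsMeetTree T] (hT : IsGenericMeetTreeExpansion LR T) :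
    IsRichTree T := by
  have chain : ∀ n, IsMeetTree (ULift.{w} (Fin n)) := fun n =>
    ⟨fun p x _ y _ _ => le_total x y⟩
  refine ⟨fun x y hxy => ?_, fun x => ?_, fun u _ _ F hF => ?_⟩
  · obtain ⟨m, hm⟩ := (({x, y} : Set T).toFinite).exists_notMem
    simp only [Set.mem_insert_iff, Set.mem_singleton_iff, not_or] at hm
    let j : ULift.{w} (Fin 3) → T := fun i => ![x, m, y] i.down
    have hj : Function.Injective j := by
      rintro ⟨i⟩ ⟨k⟩ h
      fin_cases i <;> fin_cases k <;> simp_all [j, hxy.ne, hxy.ne', eq_comm]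
    obtain ⟨e, he, heinf, -, heQ⟩ := exists_embedding_extending hT hj (Q := {⟨0⟩, ⟨2⟩}) (by
      have h02 : (⟨0⟩ : ULift.{w} (Fin 3)) ⊓ ⟨2⟩ = ⟨0⟩ := rfl
      rintro _ (rfl | rfl) _ (rfl | rfl)
      · simp
      · rw [h02]; exact ⟨Or.inl rfl, (inf_eq_left.2 hxy.le).symm⟩
      · rw [inf_comm, h02, inf_comm]; exact ⟨Or.inl rfl, (inf_eq_left.2 hxy.le).symm⟩
      · simp)
    have h0 : e ⟨0⟩ = x := heQ _ (Or.inl rfl)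
    have h2 : e ⟨2⟩ = y := heQ _ (Or.inr rfl)
    refine ⟨e ⟨1⟩, ?_, ?_⟩
    · rw [← h0]
      refine lt_of_le_of_ne (inf_eq_left.1 ((heinf _ _).symm.trans (congrArg e rfl))) fun h => ?_
      simpa using he h
    · rw [← h2]
      refine lt_of_le_of_ne (inf_eq_left.1 ((heinf _ _).symm.trans (congrArg e rfl))) fun h => ?_
      simpa using he h
  · obtain ⟨m, hm⟩ := (({x} : Set T).toFinite).exists_notMem
    simp only [Set.mem_singleton_iff] at hm
    let j : ULift.{w} (Fin 2) → T := fun i => ![m, x] i.down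
    have hj : Function.Injective j := by
      rintro ⟨i⟩ ⟨k⟩ h
      fin_cases i <;> fin_cases k <;> simp_all [j, eq_comm]
    obtain ⟨e, he, heinf, -, heQ⟩ := exists_embedding_extending hT hj (Q := {⟨1⟩}) (by
      rintro _ rfl _ rfl
      simp)
    have h1 : e ⟨1⟩ = x := heQ _ rfl
    refine ⟨e ⟨0⟩, ?_⟩
    rw [← h1]
    refine lt_of_le_of_ne (inf_eq_left.1 ((heinf _ _).symm.trans (congrArg e rfl))) fun h => ?_
    simpa using he h
  · obtain ⟨y, hy, hyinf⟩ := exists_cone_family hT u (F.ncard + 1)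
    by_contra! hcon
    choose b hbF hb using fun i => hcon (y i) (hy i)
    have : Finite F := hF
    have hlt : ∀ i, u ⊓ b i < y i ⊓ b i := fun i =>
      lt_of_le_of_ne (inf_le_inf_right _ (hy i).le) (hb i).symm
    have hbinj : Function.Injective fun i => (⟨b i, hbF i⟩ : F) := by
      intro i k hik
      have hik : b i = b k := congrArg Subtype.val hik
      by_contra hne
      have h1 := hlt i
      have h2 := hlt k
      rw [← hik] at h2
      have h3 : y i ⊓ b i ⊓ (y k ⊓ b i) = u ⊓ b i := by
        rw [inf_inf_inf_comm, hyinf i k hne, inf_idem]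
      rcases le_or_le_of_le (inf_le_right : y i ⊓ b i ≤ b i) (inf_le_right : y k ⊓ b i ≤ b i)
        with h | h
      · rw [inf_eq_left.2 h] at h3; exact h1.ne' h3
      · rw [inf_eq_right.2 h] at h3; exact h2.ne' h3
    have := Nat.card_le_card_of_injective _ hbinj
    rw [Nat.card_fin, Nat.card_coe_set_eq] at this
    omega

end Generic

/-! ### Automorphisms, formulas and types -/

section Types

open FirstOrder.Language FirstOrder.Language.Structure

variable {L : FirstOrder.Language.{u, v}} {M : Type w} [L.Structure M]

theorem realize_comp_of_fixes (σ : M ≃[L] M) {C : Set M} (hσ : ∀ c ∈ C, σ c = c) {ι : Type*}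
    (φ : L[[C]].Formula ι) (a : ι → M) : φ.Realize (σ ∘ a) ↔ φ.Realize a := by
  let e : M ≃[L[[C]]] M :=
    { toEquiv := σ.toEquiv
      map_fun' := by
        rintro n (f | c) x
        · exact σ.map_fun f x
        · cases n with
          | zero => exact hσ _ c.2
          | succ n => exact isEmptyElim c
      map_rel' := by
        rintro n (R | R) x
        · exact σ.map_rel R x
        · exact isEmptyElim R }
  exact StrongHomClass.realize_formula e φ

/-- In a structure with finitely many orbits of `n`-tuples, every complete `n`-type is realised. -/
theorem exists_typeOf_eq [Nonempty M] {n : ℕ} (p : (L.completeTheory M).CompleteType (Fin n))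
    {F : Set (Fin n → M)} (hF : F.Finite)
    (h : ∀ a : Fin n → M, ∃ b ∈ F, ∀ φ : L.Formula (Fin n), φ.Realize a ↔ φ.Realize b) :
    ∃ a : Fin n → M, (L.completeTheory M).typeOf a = p := by
  by_contra! hcon
  have hsep : ∀ a : Fin n → M, ∃ φ : L.Formula (Fin n),
      Formula.equivSentence φ ∈ p ∧ ¬ φ.Realize a := by
    intro a
    by_contra! hall
    have hle : ∀ ψ, ψ ∈ p → ψ ∈ (L.completeTheory M).typeOf a := fun ψ hψ =>
      (Theory.CompleteType.mem_typeOf (v := a)).2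
        (hall (Formula.equivSentence.symm ψ) (by simpa using hψ))
    refine hcon a (SetLike.ext fun ψ => ⟨fun hψ => ?_, hle ψ⟩)
    by_contra hψp
    exact ((Theory.CompleteType.not_mem_iff _ _).1
      (hle _ ((Theory.CompleteType.not_mem_iff _ _).2 hψp))) hψ
  choose φ hφp hφa using hsep
  obtain ⟨N, v, hv⟩ := Theory.exists_modelType_is_realized_in (L.completeTheory M) p
  have : Finite F := hF
  let ψ : L.Formula (Fin n) := Formula.iInf fun b : F => φ b
  have hN : ψ.Realize v := by
    refine Formula.realize_iInf.2 fun b => ?_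
    have := hφp b
    rw [← hv] at this
    exact Theory.CompleteType.formula_mem_typeOf.1 this
  let s : L.Sentence := Formula.iExs (Fin n) (ψ.relabel (Sum.inr : Fin n → Empty ⊕ Fin n))
  have hs : ∀ (K : Type _) [L.Structure K], K ⊨ s ↔ ∃ a : Fin n → K, ψ.Realize a := by
    intro K _
    refine Formula.realize_iExs.trans (exists_congr fun a => ?_)
    rw [Formula.realize_relabel]
    rfl
  have hs' : M ⊨ s ↔ ∃ a : Fin n → M, ψ.Realize a := by
    refine Formula.realize_iExs.trans (exists_congr fun a => ?_)
    rw [Formula.realize_relabel]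
    rfl
  have hMs : M ⊨ s := by
    by_contra hMs
    have h1 : s.not ∈ L.completeTheory M := mem_completeTheory.2 hMs
    have h2 : N ⊨ s.not := N.is_model.realize_of_mem _ h1
    exact (h2 : ¬ N ⊨ s) ((hs N).2 ⟨v, hN⟩)
  obtain ⟨a, ha⟩ := hs'.1 hMs
  obtain ⟨b, hb, hab⟩ := h a
  exact hφa b ((hab _).1 (Formula.realize_iInf.1 ha ⟨b, hb⟩))

theorem typeOf_comp_of_fixes [Nonempty M] (σ : M ≃[L] M) {C : Set M} (hσ : ∀ c ∈ C, σ c = c)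
    {n : ℕ} (a : Fin n → M) :
    (L[[C]].completeTheory M).typeOf (σ ∘ a) = (L[[C]].completeTheory M).typeOf a := by
  refine SetLike.ext fun ψ => ?_
  rw [Theory.CompleteType.mem_typeOf, Theory.CompleteType.mem_typeOf]
  exact realize_comp_of_fixes σ hσ _ a

end Types

/-! ### Weak independence in relational structures -/

section Relational

open FirstOrder.Language FirstOrder.Language.Structure

variable {LR : FirstOrder.Language.{u, v}} {T : Type w} [SR : LR.Structure T]
  {IndR : Set T → Set T → Set T → Prop}

theorem exists_range_eq {X : Set T} (hX : X.Finite) : ∃ (n : ℕ) (x : Fin n → T), Set.range x = X := by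
  obtain ⟨n, x, -, hx⟩ := hX.fin_param
  exact ⟨n, x, hx⟩

theorem indR_image (hR : IsFreeWeakIndependence SR IndR) (σ : T ≃[LR] T) {A B C : Set T}
    (hA : A.Finite) (hB : B.Finite) (hC : C.Finite) (h : IndR A C B) :
    IndR (σ '' A) (σ '' C) (σ '' B) := by
  obtain ⟨k, a, rfl⟩ := exists_range_eq hA
  obtain ⟨l, b, rfl⟩ := exists_range_eq hB
  obtain ⟨m, c, rfl⟩ := exists_range_eq hC
  rw [← Set.range_comp, ← Set.range_comp, ← Set.range_comp]
  refine hR.invariance a (σ ∘ a) c (σ ∘ c) b (σ ∘ b) (fun φ => ?_) h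
  rw [← realize_comp_of_fixes σ (C := ∅) (fun c hc => hc.elim) φ, Sum.comp_elim, Sum.comp_elim]

theorem relPreserving_of_eqType [DecidableEq T] {D : Set T} {a : T} (ha : a ∉ D) {l : ℕ}
    {x x' : Fin l → T} (hx : Set.range x = insert a D) (h : EqType SR D x' x) :
    ∃ m, m ∉ D ∧ Set.range x' = insert m D ∧
      RelPreserving LR (insert a D) (Function.update id a m) := by
  have hconst : ∀ i (d : T), d ∈ D → (x' i = d ↔ x i = d) := fun i d hd =>
    h (Term.equal (Term.var i) (LR.con (⟨d, hd⟩ : D)).term)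
  obtain ⟨i₀, hi₀⟩ : a ∈ Set.range x := hx ▸ Or.inl rfl
  have heq : ∀ i k, x' i = x' k ↔ x i = x k := fun i k =>
    h (Term.equal (Term.var i) (Term.var k))
  have hx' : ∀ i, x' i = Function.update id a (x' i₀) (x i) := fun i => by
    by_cases hi : x i = a
    · rw [hi, Function.update_self, heq, hi, hi₀]
    · rw [Function.update_of_ne hi, id, hconst]
      have : x i ∈ insert a D := hx ▸ ⟨i, rfl⟩
      exact this.resolve_left hi
  have hm : x' i₀ ∉ D := fun hmem => by
    have := (hconst i₀ _ hmem).1 rfl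
    exact ha (by rwa [← hi₀, this])
  refine ⟨x' i₀, hm, ?_, fun n R y hy => ?_⟩
  · ext t
    constructor
    · rintro ⟨i, rfl⟩
      have : x i ∈ insert a D := hx ▸ ⟨i, rfl⟩
      rcases this with h | h
      · exact Or.inl ((heq _ _).2 (h.trans hi₀.symm))
      · exact Or.inr (by rwa [(hconst i _ h).2 rfl])
    · rintro (rfl | ht)
      · exact ⟨i₀, rfl⟩
      · obtain ⟨i, rfl⟩ : t ∈ Set.range x := hx ▸ Or.inr ht
        exact ⟨i, (hconst i _ ht).2 rfl⟩
  · have : ∀ i, ∃ k, x k = y i := fun i => by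
      have := hy i
      rwa [← hx] at this
    choose k hk using this
    obtain rfl : x ∘ k = y := funext hk
    have h1 : Function.update id a (x' i₀) ∘ x ∘ k = x' ∘ k := funext fun i => (hx' (k i)).symm
    rw [h1]
    exact h (Relations.formula (Sum.inl R : LR[[D]].Relations n) fun i => Term.var (k i))

variable [LR.IsRelational]

theorem mem_of_indR_self (hR : IsFreeWeakIndependence SR IndR) {C : Set T} (hC : C.Finite) {m : T}
    (h : IndR {m} C {m}) : m ∈ C := by
  have := hR.reflexivity hC h
  rwa [gen, Substructure.closure_eq_of_isRelational] at this

theorem exists_indR_left (hR : IsFreeWeakIndependence SR IndR) [DecidableEq T] {D B : Set T}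
    (hD : D.Finite) (hB : B.Finite) {a : T} (ha : a ∉ D) :
    ∃ m, m ∉ B ∧ RelPreserving LR (insert a D) (Function.update id a m) ∧
      IndR (insert m D) D B := by
  obtain ⟨k, d, hd⟩ := exists_range_eq hD
  obtain ⟨l, x, hx⟩ := exists_range_eq (hD.insert a)
  obtain ⟨n, b, rfl⟩ := exists_range_eq hB
  obtain ⟨x', h1, h2⟩ := hR.left_extension d x b hD (by rw [hd, hx]; exact Set.subset_insert _ _)
    (by rw [hd]; exact hR.left_existence hD hB)
  obtain ⟨m, hm, hrange, hrel⟩ := relPreserving_of_eqType ha hx h1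
  rw [hrange] at h2
  refine ⟨m, fun hmB => hm ?_, hrel, h2⟩
  exact mem_of_indR_self hR hD (hR.monotonicity (hD.insert m) hB hD
    (Set.singleton_subset_iff.2 (Or.inl rfl)) (Set.singleton_subset_iff.2 hmB) h2)

theorem exists_indR_right (hR : IsFreeWeakIndependence SR IndR) [DecidableEq T] {D B : Set T}
    (hD : D.Finite) (hB : B.Finite) {a : T} (ha : a ∉ D) :
    ∃ m, m ∉ B ∧ RelPreserving LR (insert a D) (Function.update id a m) ∧
      IndR B D (insert m D) := by
  obtain ⟨k, d, hd⟩ := exists_range_eq hD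
  obtain ⟨l, x, hx⟩ := exists_range_eq (hD.insert a)
  obtain ⟨n, b, rfl⟩ := exists_range_eq hB
  obtain ⟨x', h1, h2⟩ := hR.right_extension b d x hD (by rw [hd, hx]; exact Set.subset_insert _ _)
    (by rw [hd]; exact hR.right_existence hB hD)
  obtain ⟨m, hm, hrange, hrel⟩ := relPreserving_of_eqType ha hx h1
  rw [hrange] at h2
  refine ⟨m, fun hmB => hm ?_, hrel, h2⟩
  exact mem_of_indR_self hR hD (hR.monotonicity hB (hD.insert m) hD
    (Set.singleton_subset_iff.2 hmB) (Set.singleton_subset_iff.2 (Or.inl rfl)) h2)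

end Relational

/-! ### Meet-trees extending a generic meet-tree expansion by at most one point -/

section Extension

open FirstOrder.Language FirstOrder.Language.Structure

variable {LR : FirstOrder.Language.{u, v}} {T : Type w} [SR : LR.Structure T] [SemilatticeInf T]
  {S : Type w} [SemilatticeInf S] {γ : S} {ι : T → S}

/-- The meet-tree `S` extends `T` by at most the point `γ`. -/
structure IsPointExtension (γ : S) (ι : T → S) : Prop where
  injective : Function.Injective ι
  map_inf : ∀ x y, ι (x ⊓ y) = ι x ⊓ ι y
  exists_eq : ∀ s, s ≠ γ → ∃ t, ι t = s

/-- The map `f` preserves the relations of `LR` between points of `X` coming from `T`. -/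
def RelCompatible (LR : FirstOrder.Language.{u, v}) [LR.Structure T] (ι : T → S) (X : Set S)
    (f : S → S) : Prop :=
  ∀ (n : ℕ) (R : LR.Relations n) (x y : Fin n → T), (∀ i, ι (x i) ∈ X) →
    (∀ i, ι (y i) = f (ι (x i))) → (RelMap R y ↔ RelMap R x)

theorem IsPointExtension.exists_eq_apply (h : IsPointExtension γ ι) {σ : S ≃o S} (hσ : σ γ = γ)
    (t : T) : ∃ t', ι t' = σ (ι t) := by
  by_cases ht : σ (ι t) = γ
  · exact ⟨t, by rw [ht]; exact σ.injective (by rw [ht, hσ])⟩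
  · exact h.exists_eq _ ht

/-- The automorphisms of `S` which fix `γ` and preserve the relations of `LR`. -/
def pointedAut (LR : FirstOrder.Language.{u, v}) [LR.Structure T] {γ : S} {ι : T → S}
    (h : IsPointExtension γ ι) : Subgroup (S ≃o S) where
  carrier := {σ | σ γ = γ ∧ RelCompatible LR ι Set.univ σ}
  one_mem' := by
    refine ⟨rfl, fun n R x y _ hy => ?_⟩
    rw [funext fun i => h.injective (hy i)]
  mul_mem' := by
    rintro σ τ ⟨hσ, hσR⟩ ⟨hτ, hτR⟩
    refine ⟨(congrArg σ hτ).trans hσ, fun n R x y _ hy => ?_⟩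
    choose z hz using fun i => h.exists_eq_apply hτ (x i)
    exact (hσR n R z y (fun _ => trivial) fun i => by rw [hz]; exact hy i).trans
      (hτR n R x z (fun _ => trivial) hz)
  inv_mem' := by
    rintro σ ⟨hσ, hσR⟩
    refine ⟨σ.injective ((σ.apply_symm_apply γ).trans hσ.symm), fun n R x y _ hy => ?_⟩
    refine (hσR n R y x (fun _ => trivial) fun i => ?_).symm
    rw [hy]
    exact (σ.apply_symm_apply _).symm

theorem pointedAut_of_approximations (h : IsPointExtension γ ι) {σ : S ≃o S}
    (hσ : ∀ X : Set S, X.Finite → ∃ g ∈ pointedAut LR h, ∀ x ∈ X, σ x = g x) :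
    σ ∈ pointedAut LR h := by
  constructor
  · obtain ⟨g, hg, hgσ⟩ := hσ {γ} (Set.finite_singleton _)
    rw [hgσ γ rfl, hg.1]
  · intro n R x y _ hy
    obtain ⟨g, hg, hgσ⟩ := hσ (Set.range fun i => ι (x i)) (Set.finite_range _)
    exact hg.2 n R x y (fun _ => trivial) fun i => by rw [hy, hgσ _ ⟨i, rfl⟩]

/-- An automorphism of `S` lifts to an automorphism of the structure on `T`. -/
theorem exists_lift [LR.IsRelational] (h : IsPointExtension γ ι) {σ : S ≃o S}
    (hσ : σ ∈ pointedAut LR h) : ∃ τ : T ≃[LR.sum treeLang] T, ∀ t, ι (τ t) = σ (ι t) := by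
  choose f hf using h.exists_eq_apply hσ.1
  choose g hg using h.exists_eq_apply (inv_mem hσ).1
  refine ⟨{ toFun := f, invFun := g, left_inv := fun t => ?_, right_inv := fun t => ?_,
            map_fun' := ?_, map_rel' := ?_ }, hf⟩
  · exact h.injective (by rw [hg, hf]; exact σ.symm_apply_apply _)
  · exact h.injective (by rw [hf, hg]; exact σ.apply_symm_apply _)
  · rintro n (F | F) x
    · exact isEmptyElim F
    · cases F
      exact h.injective (by
        change ι (f (x 0 ⊓ x 1)) = ι (f (x 0) ⊓ f (x 1))
        rw [hf, h.map_inf, h.map_inf, hf, hf]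
        exact map_inf σ _ _)
  · rintro n (R | R) x
    · exact hσ.2 n R x (f ∘ x) (fun _ => trivial) fun i => hf _
    · cases R
      change f (x 0) ≤ f (x 1) ↔ x 0 ≤ x 1
      rw [← inf_eq_left, ← inf_eq_left, ← h.injective.eq_iff (a := f (x 0) ⊓ f (x 1)),
        ← h.injective.eq_iff (a := x 0 ⊓ x 1), h.map_inf, h.map_inf, hf, hf, ← map_inf,
        σ.injective.eq_iff]

theorem exists_reduct (σ : T ≃[LR.sum treeLang] T) : ∃ τ : T ≃[LR] T, ∀ t, τ t = σ t :=
  ⟨{ toEquiv := σ.toEquiv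
     map_fun' := fun {_} f x => σ.map_fun (Sum.inl f : (LR.sum treeLang).Functions _) x
     map_rel' := fun {_} R x => σ.map_rel (Sum.inl R : (LR.sum treeLang).Relations _) x },
    fun _ => rfl⟩

/-- The independence relation on `S` induced by one on `T`. -/
def pullIndep (ι : T → S) (IndR : Set T → Set T → Set T → Prop) :
    Set S → Set S → Set S → Prop :=
  fun A C B => IndR (ι ⁻¹' A) (ι ⁻¹' C) (ι ⁻¹' B)

theorem image_eq_self {X : Type*} {f : X → X} {A : Set X} (h : ∀ x ∈ A, f x = x) : f '' A = A :=
  (Set.image_congr h).trans (Set.image_id' A)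

variable [LR.IsRelational]

theorem freeIndep_pullIndep (h : IsPointExtension γ ι) {IndR : Set T → Set T → Set T → Prop}
    (hR : IsFreeWeakIndependence SR IndR) :
    FreeIndep (pointedAut LR h) (pullIndep ι IndR) where
  invariance {g A B C} hg hA hB hC hI := by
    obtain ⟨σ, hσ⟩ := exists_lift h hg
    obtain ⟨τ, hτ⟩ := exists_reduct σ
    have key : ∀ X : Set S, ι ⁻¹' (g '' X) = τ '' (ι ⁻¹' X) := by
      intro X
      ext t
      constructor
      · rintro ⟨s, hs, hst⟩
        refine ⟨τ.symm t, ?_, τ.apply_symm_apply t⟩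
        have : ι (τ.symm t) = s := g.injective (by
          rw [hst, ← hσ, ← hτ, τ.apply_symm_apply])
        rwa [Set.mem_preimage, this]
      · rintro ⟨s, hs, rfl⟩
        exact ⟨ι s, hs, by rw [← hσ, hτ]⟩
    rw [pullIndep, key, key, key]
    exact indR_image hR τ (hA.preimage h.injective.injOn) (hB.preimage h.injective.injOn)
      (hC.preimage h.injective.injOn) hI
  mono hA hB hC hA' hB' hI := hR.monotonicity (hA.preimage h.injective.injOn)
    (hB.preimage h.injective.injOn) (hC.preimage h.injective.injOn) (Set.preimage_mono hA')
    (Set.preimage_mono hB') hI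
  left_existence hA hB := hR.left_existence (hA.preimage h.injective.injOn)
    (hB.preimage h.injective.injOn)
  right_existence hA hB := hR.right_existence (hA.preimage h.injective.injOn)
    (hB.preimage h.injective.injOn)
  left_trans hA hB hCD hDA h1 h2 := hR.left_transitivity (hA.preimage h.injective.injOn)
    (hB.preimage h.injective.injOn) (Set.preimage_mono hCD) (Set.preimage_mono hDA) h1 h2
  right_trans hA hB hCD hDB h1 h2 := hR.right_transitivity (hA.preimage h.injective.injOn)
    (hB.preimage h.injective.injOn) (Set.preimage_mono hCD) (Set.preimage_mono hDB) h1 h2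
  free hA hB hC hDC h1 h2 := hR.freeness (hA.preimage h.injective.injOn)
    (hB.preimage h.injective.injOn) (hC.preimage h.injective.injOn) (Set.preimage_mono hDC) h1
    (by
      rw [gen, gen, gen, Substructure.closure_eq_of_isRelational,
        Substructure.closure_eq_of_isRelational, Substructure.closure_eq_of_isRelational]
      exact fun t ht => h2 ht)

/-- A homogeneous meet-tree extending `T` by at most one point. -/
structure IsHomogeneousExtension (LR : FirstOrder.Language.{u, v}) [LR.Structure T] (γ : S)
    (ι : T → S) : Prop extends IsPointExtension γ ι where
  rich : IsRichTree S
  hom : ∀ {X : Set S} {f : S → S}, TreeClosed γ X → f γ = γ → Set.InjOn f X →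
    (∀ x ∈ X, ∀ y ∈ X, f (x ⊓ y) = f x ⊓ f y) → RelCompatible LR ι X f →
      ∃ σ ∈ pointedAut LR toIsPointExtension, ∀ x ∈ X, σ x = f x
  position : ∀ [DecidableEq T] {B : Set S} {a : S} {m : T}, TreeClosed γ B → a ∉ B →
    (∀ b ∈ B, a ⊓ b ∈ insert a B) → ι m ∉ B →
      ∃ y : T, ι y ∉ B ∧ SamePosition B a (ι y) ∧
        RelPreserving LR (insert y (ι ⁻¹' B)) (Function.update id y m)

theorem Good.of_samePosition {r : S → S → Prop} (hr : IsDirection r) {D B : Set S}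
    (hB : ∀ {x y}, x ∈ B → y ∈ B → x ⊓ y ∈ B) (hDB : D ⊆ B) {a a' b : S} (ha : a ∉ B)
    (ha' : a' ∉ B) (h : SamePosition B a a') (hb : b ∈ B) (hg : Good r D a b) :
    Good r D a' b := by
  refine ⟨fun hba => ?_, ?_⟩
  · rcases hr with rfl | rfl
    · have hba' : b ≤ a := by
        rcases h b hb with h1 | h1
        · exact absurd (le_antisymm h1.2 hba ▸ hb) ha'
        · exact inf_eq_right.1 (h1.2.2.trans (inf_eq_right.2 hba))
      obtain ⟨c, hc, hbc, hca⟩ := hg.1 hba'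
      refine ⟨c, hc, hbc, ?_⟩
      rcases h c (hDB hc) with h1 | h1
      · exact absurd (le_antisymm h1.1 hca ▸ hDB hc) ha
      · exact inf_eq_right.1 (h1.2.2.symm.trans (inf_eq_right.2 hca))
    · have hba' : a ≤ b := by
        rcases h b hb with h1 | h1
        · exact h1.1
        · exact absurd hba h1.2.1
      obtain ⟨c, hc, hbc, hca⟩ := hg.1 hba'
      refine ⟨c, hc, hbc, ?_⟩
      rcases h c (hDB hc) with h1 | h1
      · exact h1.2
      · exact absurd hca h1.1
  · rcases hg.2 with h2 | ⟨c, hc, h2⟩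
    · rcases h b hb with h1 | h1
      · rw [inf_eq_left.2 h1.1] at h2
        exact absurd (hDB h2) ha
      · exact Or.inl (h1.2.2 ▸ h2)
    · refine Or.inr ⟨c, hc, ?_⟩
      rcases h c (hDB hc) with h1 | h1
      · rw [inf_eq_left.2 h1.2]
        exact fun h3 => ha' (h3 ▸ hB hb (hDB hc))
      · rwa [← h1.2.2]

theorem IsHomogeneousExtension.exists_move [IsMeetTree S] (h : IsHomogeneousExtension LR γ ι)
    (hU : LR.IsUltrahomogeneous T) {r : S → S → Prop} (hr : IsDirection r) {D B : Set S}
    (hD : TreeClosed γ D) (hB : TreeClosed γ B) (hDB : D ⊆ B) {a : S} (ha : a ∉ D)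
    (haD : ∀ d ∈ D, a ⊓ d ∈ insert a D) {P : Set T → Prop}
    (hP : ∀ σ : T ≃[LR] T, (∀ b ∈ ι ⁻¹' B, σ b = b) → ∀ A : Set T, A.Finite → P A → P (σ '' A))
    (hext : ∀ [DecidableEq T] (t : T), t ∉ ι ⁻¹' D → ∃ m, m ∉ ι ⁻¹' B ∧
      RelPreserving LR (insert t (ι ⁻¹' D)) (Function.update id t m) ∧ P (insert m (ι ⁻¹' D))) :
    ∃ g ∈ pointedAut LR h.toIsPointExtension, (∀ d ∈ D, g d = d) ∧
      (∀ b ∈ B, Good r D (g a) b) ∧ P (ι ⁻¹' (insert (g a) D)) := by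
  classical
  have haγ : a ≠ γ := fun h => ha (h ▸ hD.base)
  obtain ⟨a', ha', ha'B, hpos, hgood⟩ := exists_independent_position h.rich hr hD hB hDB ha haD
  obtain ⟨t, rfl⟩ := h.exists_eq a haγ
  obtain ⟨m, hmB, hmrel, hmP⟩ := hext t ha
  obtain ⟨y, hyB, hypos, hyrel⟩ := h.position hB ha' ha'B hmB
  have hyD : ι y ∉ D := fun h => hyB (hDB h)
  have hpos' : SamePosition D (ι t) (ι y) := hpos.trans (hypos.mono hDB)
  obtain ⟨τ, hτ⟩ := exists_relational_automorphism hU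
    ((hB.finite.preimage h.injective.injOn).insert y) (f := Function.update id y m)
    (by
      intro x hx x' hx' hxx
      rcases hx with rfl | hx <;> rcases hx' with rfl | hx'
      · rfl
      · have hne : x' ≠ x := fun h => hyB (h ▸ hx')
        rw [Function.update_self, Function.update_of_ne hne, id] at hxx
        exact absurd (hxx ▸ hx') hmB
      · have hne : x ≠ x' := fun h => hyB (h ▸ hx)
        rw [Function.update_self, Function.update_of_ne hne, id] at hxx
        exact absurd (hxx ▸ hx) hmB
      · have hne : x ≠ y := fun h => hyB (h ▸ hx)
        have hne' : x' ≠ y := fun h => hyB (h ▸ hx')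
        rwa [Function.update_of_ne hne, Function.update_of_ne hne'] at hxx) hyrel
  have hτy : τ.symm m = y := by
    have := hτ y (Or.inl rfl)
    rw [Function.update_self] at this
    rw [← this, τ.symm_apply_apply]
  have hτB : ∀ b ∈ ι ⁻¹' B, τ.symm b = b := fun b hb => by
    have := hτ b (Or.inr hb)
    rw [Function.update_of_ne (fun h' : b = y => hyB (show ι y ∈ B from h' ▸ hb)), id] at this
    conv_lhs => rw [← this]
    exact τ.symm_apply_apply b
  have hPy : P (insert y (ι ⁻¹' D)) := by
    have := hP τ.symm hτB _ ((hD.finite.preimage h.injective.injOn).insert m) hmP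
    rw [Set.image_insert_eq, hτy] at this
    convert this using 2
    exact (image_eq_self fun d hd => hτB d (hDB hd)).symm
  have hfD : ∀ d ∈ D, Function.update id (ι t) (ι y) d = d := fun d hd =>
    Function.update_of_ne (fun h' : d = ι t => ha (h' ▸ hd)) _ _
  have hfa : Function.update id (ι t) (ι y) (ι t) = ι y := Function.update_self _ _ _
  have hmeet : ∀ d ∈ D, Function.update id (ι t) (ι y) (ι t ⊓ d) = ι y ⊓ d := by
    intro d hd
    rcases hpos' d hd with h1 | h1
    · rw [inf_eq_left.2 h1.1, inf_eq_left.2 h1.2, hfa]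
    · have : ι t ⊓ d ∈ D := (haD d hd).resolve_left fun h => h1.1 (inf_eq_left.1 h)
      rw [hfD _ this, h1.2.2]
  obtain ⟨g, hg, hgf⟩ := h.hom (X := insert (ι t) D) (f := Function.update id (ι t) (ι y))
    ⟨hD.finite.insert _, Or.inr hD.base, by
      rintro x x' (rfl | hx) (rfl | hx')
      · exact Or.inl (inf_idem _)
      · exact haD _ hx'
      · rw [inf_comm]; exact haD _ hx
      · exact Or.inr (hD.inf hx hx')⟩ (hfD _ hD.base)
    (by
      rintro x (rfl | hx) x' (rfl | hx') hxx
      · rfl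
      · rw [hfa, hfD _ hx'] at hxx
        exact absurd (hxx ▸ hx') hyD
      · rw [hfa, hfD _ hx] at hxx
        exact absurd (hxx ▸ hx) hyD
      · rwa [hfD _ hx, hfD _ hx'] at hxx)
    (by
      rintro x (rfl | hx) x' (rfl | hx')
      · rw [inf_idem, inf_idem]
      · rw [hmeet _ hx', hfa, hfD _ hx']
      · rw [inf_comm, hmeet _ hx, hfa, hfD _ hx, inf_comm]
      · rw [hfD _ (hD.inf hx hx'), hfD _ hx, hfD _ hx'])
    (by
      intro n R x z hx hz
      have hx' : ∀ i, x i ∈ insert t (ι ⁻¹' D) := fun i =>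
        (hx i).imp (fun h' => h.injective h') id
      have hz' : z = Function.update id t y ∘ x := funext fun i => h.injective (by
        rw [hz]
        rcases hx' i with h' | h'
        · rw [h', hfa, Function.comp_apply, h', Function.update_self]
        · rw [hfD _ h', Function.comp_apply,
            Function.update_of_ne (fun h'' : x i = t => ha (h'' ▸ h')), id])
      have h1 := hyrel n R z fun i => by
        rw [hz', Function.comp_apply]
        rcases hx' i with h' | h'
        · rw [h', Function.update_self]; exact Or.inl rfl
        · rw [Function.update_of_ne (fun h'' : x i = t => ha (h'' ▸ h'))]
          exact Or.inr (hDB h')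
      have h2 := hmrel n R x hx'
      rw [← h1, ← h2]
      refine iff_of_eq (congrArg _ (funext fun i => ?_))
      rw [hz', Function.comp_apply, Function.comp_apply, Function.comp_apply]
      rcases hx' i with h' | h'
      · rw [h', Function.update_self, Function.update_self, Function.update_self]
      · have hne : x i ≠ t := fun h'' => ha (h'' ▸ h')
        rw [Function.update_of_ne hne, Function.update_of_ne hne, id,
          Function.update_of_ne (fun h'' : x i = y => hyD (show ι y ∈ D from h'' ▸ h')), id])
  have hga : g (ι t) = ι y := by rw [hgf _ (Or.inl rfl), hfa]
  refine ⟨g, hg, fun d hd => by rw [hgf d (Or.inr hd), hfD d hd], fun b hb => ?_, ?_⟩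
  · rw [hga]
    exact (hgood b hb).of_samePosition hr hB.inf hDB ha' hyB hypos hb
  · rw [hga]
    convert hPy using 1
    ext s
    exact or_congr h.injective.eq_iff Iff.rfl

theorem IsHomogeneousExtension.indepFrame_le [IsMeetTree S] (h : IsHomogeneousExtension LR γ ι)
    (hU : LR.IsUltrahomogeneous T) {IndR : Set T → Set T → Set T → Prop}
    (hR : IsFreeWeakIndependence SR IndR) :
    IndepFrame γ (pointedAut LR h.toIsPointExtension) (· ≤ ·) (pullIndep ι IndR) where
  direction := Or.inl rfl
  fix _ hg := hg.1
  indep := freeIndep_pullIndep _ hR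
  extension {D B a} hD hB hDB ha haD := by
    have hD' := hD.finite.preimage h.injective.injOn
    have hB' := hB.finite.preimage h.injective.injOn
    refine h.exists_move hU (Or.inl rfl) hD hB hDB ha haD
      (P := fun A => IndR A (ι ⁻¹' D) (ι ⁻¹' B)) (fun σ hσ A hA hI => ?_)
      fun t ht => exists_indR_left hR hD' hB' ht
    have := indR_image hR σ hA hB' hD' hI
    rwa [image_eq_self hσ, image_eq_self (A := ι ⁻¹' D) fun d hd => hσ d (hDB hd)] at this

theorem IsHomogeneousExtension.indepFrame_ge [IsMeetTree S] (h : IsHomogeneousExtension LR γ ι)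
    (hU : LR.IsUltrahomogeneous T) {IndR : Set T → Set T → Set T → Prop}
    (hR : IsFreeWeakIndependence SR IndR) :
    IndepFrame γ (pointedAut LR h.toIsPointExtension) (· ≥ ·) (opIndep (pullIndep ι IndR)) where
  direction := Or.inr rfl
  fix _ hg := hg.1
  indep := (freeIndep_pullIndep _ hR).op
  extension {D B a} hD hB hDB ha haD := by
    have hD' := hD.finite.preimage h.injective.injOn
    have hB' := hB.finite.preimage h.injective.injOn
    refine h.exists_move hU (Or.inr rfl) hD hB hDB ha haD
      (P := fun A => IndR (ι ⁻¹' B) (ι ⁻¹' D) A) (fun σ hσ A hA hI => ?_)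
      fun t ht => exists_indR_right hR hD' hB' ht
    have := indR_image hR σ hB' hA hD' hI
    rwa [image_eq_self hσ, image_eq_self (A := ι ⁻¹' D) fun d hd => hσ d (hDB hd)] at this

end Extension

/-! ### Types in homogeneous extensions and maximally moving commutators -/

section Moving

open FirstOrder.Language FirstOrder.Language.Structure

variable {LR : FirstOrder.Language.{u, v}} {T : Type w} [SR : LR.Structure T]
  {S : Type w} [SemilatticeInf S] {γ : S} {ι : T → S}

/-- The elements of the closure of a tuple, indexed by pairs. -/
def pairMeet (γ : S) (ι : T → S) {V : Type} (w : V → T) (p : Option V × Option V) : S :=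
  p.1.elim γ (fun v => ι (w v)) ⊓ p.2.elim γ (fun v => ι (w v))

/-- The isomorphism type of the closure of a tuple. -/
def diagram (LR : FirstOrder.Language.{u, v}) [LR.Structure T] (γ : S) (ι : T → S) {V : Type}
    (w : V → T) :
    ((Option V × Option V) × (Option V × Option V) × (Option V × Option V) → Prop) ×
      (∀ R : Σ n, LR.Relations n, (Fin R.1 → Option V × Option V) → Prop) :=
  (fun p => pairMeet γ ι w p.1 ⊓ pairMeet γ ι w p.2.1 = pairMeet γ ι w p.2.2,
    fun R p => ∃ t : Fin R.1 → T, (∀ i, ι (t i) = pairMeet γ ι w (p i)) ∧ RelMap R.2 t)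

theorem pairMeet_none {V : Type} (w : V → T) : pairMeet γ ι w (none, none) = γ := inf_idem _

theorem pairMeet_some {V : Type} (w : V → T) (v : V) :
    pairMeet γ ι w (some v, some v) = ι (w v) := inf_idem _

theorem range_pairMeet {V : Type} (w : V → T) :
    Set.range (pairMeet γ ι w) = treeClosure γ (Set.range (ι ∘ w)) := by
  have key : ∀ s, s ∈ insert γ (Set.range (ι ∘ w)) ↔
      ∃ o : Option V, o.elim γ (fun v => ι (w v)) = s := by
    intro s
    constructor
    · rintro (rfl | ⟨v, rfl⟩)
      · exact ⟨none, rfl⟩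
      · exact ⟨some v, rfl⟩
    · rintro ⟨_ | v, rfl⟩
      · exact Or.inl rfl
      · exact Or.inr ⟨v, rfl⟩
  ext s
  constructor
  · rintro ⟨p, rfl⟩
    exact ⟨_, (key _).2 ⟨p.1, rfl⟩, _, (key _).2 ⟨p.2, rfl⟩, rfl⟩
  · rintro ⟨x, hx, y, hy, rfl⟩
    obtain ⟨o, rfl⟩ := (key _).1 hx
    obtain ⟨o', rfl⟩ := (key _).1 hy
    exact ⟨(o, o'), rfl⟩

variable [SemilatticeInf T]

theorem IsHomogeneousExtension.exists_of_diagram_eq [IsMeetTree S]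
    (h : IsHomogeneousExtension LR γ ι) {V : Type} [Finite V] {w w' : V → T}
    (hw : diagram LR γ ι w = diagram LR γ ι w') :
    ∃ σ ∈ pointedAut LR h.toIsPointExtension, ∀ v, σ (ι (w v)) = ι (w' v) := by
  have hinf : ∀ p q r, pairMeet γ ι w p ⊓ pairMeet γ ι w q = pairMeet γ ι w r ↔
      pairMeet γ ι w' p ⊓ pairMeet γ ι w' q = pairMeet γ ι w' r := fun p q r =>
    iff_of_eq (congrFun (congrArg Prod.fst hw) (p, q, r))
  have heq : ∀ p q, pairMeet γ ι w p = pairMeet γ ι w q ↔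
      pairMeet γ ι w' p = pairMeet γ ι w' q := fun p q => by
    have := hinf p p q
    rwa [inf_idem, inf_idem] at this
  have hrel : ∀ (n : ℕ) (R : LR.Relations n) (p : Fin n → Option V × Option V),
      (∃ t : Fin n → T, (∀ i, ι (t i) = pairMeet γ ι w (p i)) ∧ RelMap R t) ↔
        ∃ t : Fin n → T, (∀ i, ι (t i) = pairMeet γ ι w' (p i)) ∧ RelMap R t := fun n R p =>
    iff_of_eq (congrFun (congrFun (congrArg Prod.snd hw) ⟨n, R⟩) p)
  have hrel' : ∀ (w : V → T) (n : ℕ) (R : LR.Relations n) (p : Fin n → Option V × Option V)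
      (x : Fin n → T), (∀ i, ι (x i) = pairMeet γ ι w (p i)) →
        ((∃ t : Fin n → T, (∀ i, ι (t i) = pairMeet γ ι w (p i)) ∧ RelMap R t) ↔
          RelMap R x) := by
    intro w n R p x hx
    refine ⟨fun ⟨t, ht, htR⟩ => ?_, fun hR => ⟨x, hx, hR⟩⟩
    have : t = x := funext fun i => h.injective (by rw [ht, hx])
    rwa [this] at htR
  have hX : TreeClosed γ (Set.range (pairMeet γ ι w)) := by
    rw [range_pairMeet]
    exact treeClosed_treeClosure γ (Set.finite_range _)
  obtain ⟨f, hf⟩ : ∃ f : S → S, ∀ p, f (pairMeet γ ι w p) = pairMeet γ ι w' p := by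
    classical
    refine ⟨fun s => if hs : ∃ p, pairMeet γ ι w p = s then pairMeet γ ι w' hs.choose else s,
      fun p => ?_⟩
    have hs : ∃ q, pairMeet γ ι w q = pairMeet γ ι w p := ⟨p, rfl⟩
    refine (dif_pos hs).trans ?_
    exact (heq _ _).1 hs.choose_spec
  obtain ⟨σ, hσ, hσf⟩ := h.hom (f := f) hX
    (by
      have := hf (none, none)
      rwa [pairMeet_none, pairMeet_none] at this)
    (by
      rintro _ ⟨p, rfl⟩ _ ⟨q, rfl⟩ hpq
      rw [hf, hf] at hpq
      exact (heq _ _).2 hpq)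
    (by
      rintro _ ⟨p, rfl⟩ _ ⟨q, rfl⟩
      obtain ⟨s, hs⟩ := hX.inf ⟨p, rfl⟩ ⟨q, rfl⟩
      rw [← hs, hf, hf, hf]
      exact ((hinf _ _ _).1 hs.symm).symm)
    (by
      intro n R x y hx hy
      choose p hp using hx
      rw [← hrel' w n R p x fun i => (hp i).symm,
        ← hrel' w' n R p y fun i => by rw [hy, ← hp, hf], hrel])
  exact ⟨σ, hσ, fun v => by
    rw [← pairMeet_some (γ := γ) (ι := ι) w v, hσf _ ⟨_, rfl⟩, hf, pairMeet_some]⟩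

/-- There are finitely many orbits of tuples over a finite set. -/
theorem IsHomogeneousExtension.finite_orbits [IsMeetTree S] (h : IsHomogeneousExtension LR γ ι)
    [Finite (Σ n, LR.Relations n)] {C : Set T} (hC : C.Finite) (n : ℕ) :
    ∃ F : Set (Fin n → T), F.Finite ∧ ∀ a : Fin n → T, ∃ b ∈ F,
      ∃ σ ∈ pointedAut LR h.toIsPointExtension, (∀ c ∈ C, σ (ι c) = ι c) ∧
        ∀ i, σ (ι (a i)) = ι (b i) := by
  obtain ⟨k, e, rfl⟩ := exists_range_eq hC
  let D := fun a : Fin n → T => diagram LR γ ι (Sum.elim a e)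
  refine ⟨Set.range fun z : Set.range D => z.2.choose, Set.finite_range _, fun a => ?_⟩
  let z : Set.range D := ⟨D a, ⟨a, rfl⟩⟩
  obtain ⟨σ, hσ, hσw⟩ := h.exists_of_diagram_eq (w := Sum.elim a e)
    (w' := Sum.elim z.2.choose e) z.2.choose_spec.symm
  refine ⟨_, ⟨z, rfl⟩, σ, hσ, ?_, fun i => hσw (Sum.inl i)⟩
  rintro _ ⟨i, rfl⟩
  exact hσw (Sum.inr i)

/-- The structure on `T` has the same automorphisms and finitely generated substructures as the
pointed meet-tree `S`, and the relation `Ind` is implied by tree independence in `S`. -/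
structure IsInducedStructure {L : FirstOrder.Language.{u', v'}} (Str : L.Structure T)
    (h : IsPointExtension γ ι) (LR : FirstOrder.Language.{u, v}) [LR.Structure T]
    (Ind : Set T → Set T → Set T → Prop) : Prop where
  lift : ∀ σ ∈ pointedAut LR h, ∃ τ : T ≃[L] T, ∀ t, ι (τ t) = σ (ι t)
  gen_eq : ∀ X : Set T, X.Finite → gen Str X = ι ⁻¹' treeClosure γ (ι '' X)
  indep : ∀ {A B C : Set S}, TreeClosed γ A → TreeClosed γ B → TreeClosed γ C → C ⊆ A → C ⊆ B →
    (∀ a ∈ A, ∀ b ∈ B, Good (· ≤ ·) C a b) → Ind (ι ⁻¹' A) (ι ⁻¹' C) (ι ⁻¹' B)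

theorem IsInducedStructure.exists_realization {L : FirstOrder.Language.{u', v'}}
    [Str : L.Structure T] [IsMeetTree S] [Nonempty T] [Finite (Σ n, LR.Relations n)]
    {h : IsHomogeneousExtension LR γ ι} {Ind : Set T → Set T → Set T → Prop}
    (hStr : IsInducedStructure Str h.toIsPointExtension LR Ind) {C : Set T} (hC : C.Finite) {n : ℕ}
    (p : (L[[C]].completeTheory T).CompleteType (Fin n)) :
    ∃ a : Fin n → T, (L[[C]].completeTheory T).typeOf a = p := by
  obtain ⟨F, hF, hF'⟩ := h.finite_orbits hC n
  refine exists_typeOf_eq p hF fun a => ?_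
  obtain ⟨b, hb, σ, hσ, hσC, hσa⟩ := hF' a
  obtain ⟨τ, hτ⟩ := hStr.lift σ hσ
  refine ⟨b, hb, fun φ => ?_⟩
  rw [← realize_comp_of_fixes τ (C := C) (fun c hc => h.injective (by rw [hτ, hσC c hc])) φ a]
  have : τ ∘ a = b := funext fun i => h.injective (by rw [Function.comp_apply, hτ, hσa])
  rw [this]

theorem IsInducedStructure.mixIndep {L : FirstOrder.Language.{u', v'}} [Str : L.Structure T]
    [IsMeetTree S] {h : IsPointExtension γ ι} {Ind IndR : Set T → Set T → Set T → Prop}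
    (hStr : IsInducedStructure Str h LR Ind) {A B C : Set T} (hA : A.Finite) (hB : B.Finite)
    (hC : C.Finite)
    (hI : Indep (· ≤ ·) (pullIndep ι IndR) (treeClosure γ (ι '' (A ∪ C))) (treeClosure γ (ι '' C))
      (treeClosure γ (ι '' (B ∪ C)))) :
    MixIndep Str Ind IndR A C B := by
  rw [MixIndep, hStr.gen_eq _ (hA.union hC), hStr.gen_eq _ (hB.union hC), hStr.gen_eq _ hC]
  exact ⟨hStr.indep (treeClosed_treeClosure _ ((hA.union hC).image _))
    (treeClosed_treeClosure _ ((hB.union hC).image _)) (treeClosed_treeClosure _ (hC.image _))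
    (treeClosure_mono (Set.image_mono Set.subset_union_right))
    (treeClosure_mono (Set.image_mono Set.subset_union_right)) hI.1, hI.2⟩

theorem IsHomogeneousExtension.exists_commutator [IsMeetTree S] [Countable S] [Nonempty T]
    [LR.IsRelational] [Finite (Σ n, LR.Relations n)] (h : IsHomogeneousExtension LR γ ι)
    (hU : LR.IsUltrahomogeneous T) {Ind IndR : Set T → Set T → Set T → Prop}
    (hR : IsFreeWeakIndependence SR IndR) {L : FirstOrder.Language.{u', v'}} [Str : L.Structure T]
    (hStr : IsInducedStructure Str h.toIsPointExtension LR Ind) (α : T ≃[LR.sum treeLang] T)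
    {α' : S ≃o S} (hα' : α' ∈ pointedAut LR h.toIsPointExtension)
    (hαα' : ∀ t, ι (α t) = α' (ι t)) (hm : MovesAll γ (· ≤ ·) α') (hm' : MovesAll γ (· ≥ ·) α'⁻¹) :
    ∃ (β : T ≃[LR.sum treeLang] T) (β' : S ≃o S),
      β' ∈ pointedAut LR h.toIsPointExtension ∧ (∀ t, ι (β t) = β' (ι t)) ∧
        MovesRightMaximally Str (MixIndep Str Ind IndR) (commutator β α) ∧
        MovesLeftMaximally Str (MixIndep Str Ind IndR) (commutator α β) := by
  obtain ⟨β', hβ', hmax⟩ := exists_maximally_moving_commutator (h.indepFrame_le hU hR)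
    (h.indepFrame_ge hU hR) (fun σ hσ => pointedAut_of_approximations _ hσ) hα' hm hm'
  obtain ⟨β, hβ⟩ := exists_lift h.toIsPointExtension hβ'
  have symm_lift : ∀ (σ : T ≃[LR.sum treeLang] T) (σ' : S ≃o S), (∀ t, ι (σ t) = σ' (ι t)) →
      ∀ t, ι (σ.symm t) = σ'⁻¹ (ι t) := fun σ σ' hσ t => σ'.injective (by
    rw [← hσ, σ.apply_symm_apply]
    exact (σ'.apply_symm_apply _).symm)
  have comm_lift : ∀ (σ τ : T ≃[LR.sum treeLang] T) (σ' τ' : S ≃o S),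
      (∀ t, ι (σ t) = σ' (ι t)) → (∀ t, ι (τ t) = τ' (ι t)) →
        ∀ t, ι (commutator σ τ t) = (σ'⁻¹ * τ'⁻¹ * σ' * τ') (ι t) := by
    intro σ τ σ' τ' hσ hτ t
    change ι (σ.symm (τ.symm (σ (τ t)))) = σ'⁻¹ (τ'⁻¹ (σ' (τ' (ι t))))
    rw [symm_lift σ σ' hσ, symm_lift τ τ' hτ, hσ, hτ]
  have key : ∀ (C : Set T), C.Finite → ∀ (n : ℕ) (a : Fin n → T) (g : S ≃o S)
      (c : T ≃[LR.sum treeLang] T) (c' : S ≃o S), g ∈ pointedAut LR h.toIsPointExtension →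
      (∀ x ∈ treeClosure γ (ι '' C), g x = x) → (∀ t, ι (c t) = c' (ι t)) →
      ∃ b : Fin n → T, (L[[C]].completeTheory T).typeOf b = (L[[C]].completeTheory T).typeOf a ∧
        treeClosure γ (ι '' (Set.range b ∪ C)) = g '' treeClosure γ (ι '' (Set.range a ∪ C)) ∧
        treeClosure γ (ι '' ((Set.range fun i => c (b i)) ∪ C)) ⊆
          treeClosure γ (c' '' (g '' treeClosure γ (ι '' (Set.range a ∪ C))) ∪
            treeClosure γ (ι '' C)) := by
    intro C hC n a g c c' hg hgC hc
    obtain ⟨τ, hτ⟩ := hStr.lift g hg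
    have hgC' : ∀ x ∈ C, g (ι x) = ι x := fun x hx =>
      hgC _ (subset_treeClosure _ _ ⟨x, hx, rfl⟩)
    refine ⟨τ ∘ a, typeOf_comp_of_fixes τ
      (fun x hx => h.injective (by rw [hτ, hgC' x hx])) a, ?_, ?_⟩
    · rw [image_treeClosure _ _ hg.1, Set.image_union, Set.image_union, Set.image_union,
        ← Set.range_comp, ← Set.range_comp, ← Set.range_comp]
      have h1 : ι ∘ τ ∘ a = g ∘ ι ∘ a := funext fun i => hτ _
      rw [h1]
      congr 2
      refine (image_eq_self ?_).symm
      rintro _ ⟨x, hx, rfl⟩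
      exact hgC' x hx
    · refine treeClosure_mono ?_
      rintro _ ⟨t, ⟨i, rfl⟩ | ht, rfl⟩
      · refine Or.inl ⟨_, ⟨ι (a i), subset_treeClosure _ _ ⟨_, Or.inl ⟨i, rfl⟩, rfl⟩, rfl⟩, ?_⟩
        rw [hc, Function.comp_apply, hτ]
      · exact Or.inr (subset_treeClosure _ _ ⟨t, ht, rfl⟩)
  have hI := freeIndep_pullIndep h.toIsPointExtension hR
  refine ⟨β, β', hβ', hβ, fun C hC n p => ?_, fun C hC n p => ?_⟩
  · obtain ⟨a, rfl⟩ := hStr.exists_realization (h := h) hC p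
    have hA : TreeClosed γ (treeClosure γ (ι '' (Set.range a ∪ C))) :=
      treeClosed_treeClosure _ (((Set.finite_range a).union hC).image _)
    have hC' : TreeClosed γ (treeClosure γ (ι '' C)) := treeClosed_treeClosure _ (hC.image _)
    obtain ⟨⟨g, hg, hgC, hind⟩, -⟩ := hmax _ _ hA hC'
      (treeClosure_mono (Set.image_mono Set.subset_union_right))
    obtain ⟨b, hb, hb1, hb2⟩ := key C hC n a g (commutator β α) _ hg hgC
      (comm_lift β α β' α' hβ hαα')
    refine ⟨b, hb, hStr.mixIndep (Set.finite_range _) (Set.finite_range _) hC ?_⟩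
    rw [hb1]
    exact hind.mono hI (hA.finite.image _) (treeClosed_treeClosure _
      (((hA.finite.image _).image _).union hC'.finite)).finite hC'.finite subset_rfl hb2
  · obtain ⟨a, rfl⟩ := hStr.exists_realization (h := h) hC p
    have hA : TreeClosed γ (treeClosure γ (ι '' (Set.range a ∪ C))) :=
      treeClosed_treeClosure _ (((Set.finite_range a).union hC).image _)
    have hC' : TreeClosed γ (treeClosure γ (ι '' C)) := treeClosed_treeClosure _ (hC.image _)
    obtain ⟨-, g, hg, hgC, hind⟩ := hmax _ _ hA hC'
      (treeClosure_mono (Set.image_mono Set.subset_union_right))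
    obtain ⟨b, hb, hb1, hb2⟩ := key C hC n a g (commutator α β) _ hg hgC
      (comm_lift α β α' β' hαα' hβ)
    refine ⟨b, hb, hStr.mixIndep (Set.finite_range _) (Set.finite_range _) hC ?_⟩
    rw [hb1]
    exact hind.mono hI (treeClosed_treeClosure _
      (((hA.finite.image _).image _).union hC'.finite)).finite (hA.finite.image _) hC'.finite hb2
      subset_rfl

end Moving

section MovesAll

variable {S : Type w} [SemilatticeInf S] {γ : S}

theorem MovesAll.inv {α : S ≃o S} (hα : MovesAll γ (· ≤ ·) α) (hγ : α γ = γ) :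
    MovesAll γ (· ≥ ·) α⁻¹ := by
  have hpow : ∀ n : ℕ, (α ^ n) γ = γ := fun n => by
    induction n with
    | zero => rfl
    | succ n ih => rw [pow_succ]; exact (congrArg _ hγ).trans ih
  have happ : ∀ x, α (α⁻¹ x) = x := α.apply_symm_apply
  refine ⟨fun x hx => ?_, fun n hn x hx => ?_⟩
  · have h : α⁻¹ x < γ := by rwa [← α.lt_iff_lt, happ, hγ]
    have := hα.below _ h
    rw [happ] at this
    exact ⟨this.1, this.2.symm⟩
  · refine hα.above n hn ((α⁻¹ ^ n) x) ?_
    have h : (α ^ n) ((α⁻¹ ^ n) x) = x := by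
      rw [inv_pow]
      exact (α ^ n).apply_symm_apply x
    rwa [h, inf_comm]

end MovesAll

/-! ### Generic meet-tree expansions with a distinguished point -/

section Pointed

open FirstOrder.Language FirstOrder.Language.Structure

variable {LR : FirstOrder.Language.{u, v}} {T : Type w} [SR : LR.Structure T]

theorem relCompatible_id {X : Set T} {f : T → T} :
    RelCompatible LR id X f ↔ RelPreserving LR X f := by
  refine ⟨fun h n R x hx => h n R x _ hx fun _ => rfl, fun h n R x y hx hy => ?_⟩
  rw [show y = f ∘ x from funext hy]
  exact h n R x hx

variable [SemilatticeInf T]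

/-- The order automorphism underlying an automorphism. -/
def orderIsoOfEquiv (σ : T ≃[LR.sum treeLang] T) : T ≃o T :=
  ⟨σ.toEquiv, le_equiv_iff σ⟩

theorem isPointExtension_id (γ : T) : IsPointExtension γ (id : T → T) :=
  ⟨Function.injective_id, fun _ _ => rfl, fun s _ => ⟨s, rfl⟩⟩

theorem orderIsoOfEquiv_mem {γ : T} {σ : T ≃[LR.sum treeLang] T} (hσ : σ γ = γ) :
    orderIsoOfEquiv σ ∈ pointedAut LR (isPointExtension_id γ) :=
  ⟨hσ, relCompatible_id.2 fun _ R x _ => relMap_equiv σ R x⟩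

theorem isHomogeneousExtension_id [LR.IsRelational] [Countable T] [Infinite T] [IsMeetTree T]
    (hT : IsGenericMeetTreeExpansion LR T) (γ : T) :
    IsHomogeneousExtension LR γ (id : T → T) where
  toIsPointExtension := isPointExtension_id γ
  rich := isRichTree hT
  hom hX hfγ hf hinf hR := by
    obtain ⟨σ, hσ⟩ := exists_automorphism hT hX.finite hX.inf hf hinf (relCompatible_id.1 hR)
    exact ⟨orderIsoOfEquiv σ, orderIsoOfEquiv_mem ((hσ _ hX.base).trans hfγ), hσ⟩
  position hB ha haB hm := exists_position_type hT hB.finite hB.inf ha haB hm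

theorem closure_pointed_subset {γ : T} {X Y : Set T} (hY : ∀ {x y}, x ∈ Y → y ∈ Y → x ⊓ y ∈ Y)
    (hγ : γ ∈ Y) (hXY : X ⊆ Y) : gen (pointedStructure γ) X ⊆ Y := by
  let _ := pointedStructure γ
  let Z : pointedLang.Substructure T := ⟨Y, by
    intro n F
    exact match n, F with
      | _, PointedFunctions.meet => fun x hx => hY (hx 0) (hx 1)
      | _, PointedFunctions.point => fun x hx => hγ⟩
  exact (Substructure.closure_le (S := Z)).2 hXY

theorem gen_expPointedStructure [LR.IsRelational] [IsMeetTree T] {γ : T} {X : Set T} (hX : X.Finite) :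
    gen (expPointedStructure LR γ) X = id ⁻¹' treeClosure γ (id '' X) := by
  let _ := expPointedStructure LR γ
  rw [Set.preimage_id, Set.image_id]
  have hcl := treeClosed_treeClosure γ hX
  apply Set.Subset.antisymm
  · let Z : (LR.sum pointedLang).Substructure T := ⟨treeClosure γ X, by
      rintro n (F | F)
      · exact isEmptyElim F
      · exact match n, F with
          | _, PointedFunctions.meet => fun x hx => hcl.inf (hx 0) (hx 1)
          | _, PointedFunctions.point => fun x hx => hcl.base⟩
    exact (Substructure.closure_le (S := Z)).2 (subset_treeClosure γ X)
  · let Z := Substructure.closure (LR.sum pointedLang) X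
    have hγ : γ ∈ Z := Z.fun_mem (Sum.inr PointedFunctions.point) ![] fun i => i.elim0
    have hX : ∀ x ∈ insert γ X, x ∈ Z := by
      rintro x (rfl | hx)
      · exact hγ
      · exact Substructure.subset_closure hx
    rintro _ ⟨x, hx, y, hy, rfl⟩
    refine Z.fun_mem (Sum.inr PointedFunctions.meet) ![x, y] fun i => ?_
    fin_cases i
    · exact hX x hx
    · exact hX y hy

theorem coneIndep_of_good {γ : T} {A B C : Set T} (hA : TreeClosed γ A) (hB : TreeClosed γ B)
    (hCA : C ⊆ A) (hCB : C ⊆ B) (h : ∀ a ∈ A, ∀ b ∈ B, Good (· ≤ ·) C a b) :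
    ConeIndep γ A C B := by
  have hgA := closure_pointed_subset hA.inf hA.base (Set.union_subset subset_rfl hCA)
  have hgB := closure_pointed_subset hB.inf hB.base (Set.union_subset subset_rfl hCB)
  have hgC : C ⊆ gen (pointedStructure γ) C := by
    let _ := pointedStructure γ
    exact Substructure.subset_closure
  refine ⟨fun a ha b hb hba => ?_, fun a ha b hb hab => ?_⟩
  · obtain ⟨c, hc, h1⟩ := (h a (hgA ha) b (hgB hb)).1 hba
    exact ⟨c, hgC hc, h1⟩
  · obtain ⟨c, hc, h1⟩ := (h a (hgA ha) b (hgB hb)).2.resolve_left fun h' => hab (hgC h')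
    exact ⟨c, hgC hc, h1⟩

theorem isInducedStructure_pointed [LR.IsRelational] [IsMeetTree T] (γ : T) :
    IsInducedStructure (expPointedStructure LR γ) (isPointExtension_id γ) LR (ConeIndep γ) where
  lift σ hσ := by
    obtain ⟨τ, hτ⟩ := exists_lift (isPointExtension_id γ) hσ
    let _ := expPointedStructure LR γ
    refine ⟨{ toEquiv := τ.toEquiv, map_fun' := ?_, map_rel' := ?_ }, hτ⟩
    · rintro n (F | F) x
      · exact isEmptyElim F
      · exact match n, F, x with
          | _, PointedFunctions.meet, x => map_inf_of_equiv τ (x 0) (x 1)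
          | _, PointedFunctions.point, x => (hτ γ).trans hσ.1
    · rintro n (R | R) x
      · exact relMap_equiv τ R x
      · exact match n, R, x with
          | _, TreeRelations.le, x => le_equiv_iff τ
  gen_eq X hX := gen_expPointedStructure hX
  indep hA hB _ hCA hCB h := coneIndep_of_good hA hB hCA hCB h

theorem IsInfiniteFanAbove.apply_eq {γ : T} {α : T ≃o T} (h : IsInfiniteFanAbove α γ) :
    α γ = γ := by
  have h1 : γ ≤ α γ := inf_eq_left.1 (h 1 Nat.one_pos γ le_rfl)
  have h2 : α γ ⊓ α (α γ) = γ := h 1 Nat.one_pos (α γ) h1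
  rwa [inf_eq_left.2 (α.monotone h1)] at h2

theorem movesAll_of_infiniteFan {γ : T} {α : T ≃o T} (h : IsInfiniteFanAbove α γ)
    (hlt : StrictlyIncreasingOn α (Set.Iio γ)) : MovesAll γ (· ≤ ·) α := by
  refine ⟨fun x hx => ⟨(hlt x hx).le, (hlt x hx).ne⟩, fun n hn x hx => ?_⟩
  have hpow : ∀ (n : ℕ) x, (α ^ n) x = α^[n] x := fun n => by
    induction n with
    | zero => exact fun _ => rfl
    | succ n ih => exact fun x => by rw [pow_succ, Function.iterate_succ_apply, ← ih]; rfl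
  rw [hpow, h n hn x (hx.le.trans inf_le_left)] at hx
  exact hx.false

theorem exists_pointed_commutator [LR.IsRelational] [Finite (Σ n, LR.Relations n)] [Countable T]
    [Infinite T] [IsMeetTree T] (hU : LR.IsUltrahomogeneous T)
    (hT : IsGenericMeetTreeExpansion LR T) {IndR : Set T → Set T → Set T → Prop}
    (hR : IsFreeWeakIndependence SR IndR) (γ : T) (α : T ≃[LR.sum treeLang] T)
    (hα : IsInfiniteFanAbove α γ) (hlt : StrictlyIncreasingOn α (Set.Iio γ)) :
    ∃ β : T ≃[LR.sum treeLang] T, β γ = γ ∧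
      MovesRightMaximally (expPointedStructure LR γ) (PointedIndep LR IndR γ) (commutator β α) ∧
      MovesLeftMaximally (expPointedStructure LR γ) (PointedIndep LR IndR γ)
        (commutator α β) := by
  have hα' : IsInfiniteFanAbove (orderIsoOfEquiv α) γ := hα
  have hm := movesAll_of_infiniteFan hα' hlt
  let _ := expPointedStructure LR γ
  obtain ⟨β, β', hβ', hβ, h⟩ := (isHomogeneousExtension_id hT γ).exists_commutator hU hR
    (isInducedStructure_pointed γ) α (orderIsoOfEquiv_mem hα'.apply_eq) (fun _ => rfl) hm
    (hm.inv hα'.apply_eq)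
  exact ⟨β, (hβ γ).trans hβ'.1, h⟩

end Pointed

/-! ### Branches of meet-trees -/

section Branch

variable {T : Type w} [SemilatticeInf T] {Γ : Set T}

/-- The meet-tree obtained from `T` by adding a point on top of the branch `Γ`. -/
def BranchExt {T : Type w} [SemilatticeInf T] {Γ : Set T} (_ : IsBranch Γ) : Type w := Option T

namespace BranchExt

variable {hΓ : IsBranch Γ}

/-- The embedding of `T`. -/
def of (hΓ : IsBranch Γ) (a : T) : BranchExt hΓ := (some a : Option T)

/-- The point added on top of `Γ`. -/
def top (hΓ : IsBranch Γ) : BranchExt hΓ := (none : Option T)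

theorem of_injective : Function.Injective (of hΓ) := Option.some_injective T

theorem of_ne_top (a : T) : of hΓ a ≠ top hΓ := Option.some_ne_none a

theorem cases (s : BranchExt hΓ) : s = top hΓ ∨ ∃ a, of hΓ a = s :=
  match s with
  | none => Or.inl rfl
  | some a => Or.inr ⟨a, rfl⟩

end BranchExt

variable [IsMeetTree T]

theorem IsBranch.proj_mem (hΓ : IsBranch Γ) (a : T) : branchProj Γ a ∈ Γ :=
  (hΓ.branchProj_isGreatest a).1.1

theorem IsBranch.proj_le (hΓ : IsBranch Γ) (a : T) : branchProj Γ a ≤ a :=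
  (hΓ.branchProj_isGreatest a).1.2

theorem IsBranch.le_proj (hΓ : IsBranch Γ) {a b : T} (hb : b ∈ Γ) (hba : b ≤ a) :
    b ≤ branchProj Γ a :=
  (hΓ.branchProj_isGreatest a).2 ⟨hb, hba⟩

theorem IsBranch.proj_eq_self (hΓ : IsBranch Γ) {a : T} : branchProj Γ a = a ↔ a ∈ Γ :=
  ⟨fun h => h ▸ hΓ.proj_mem a, fun h => le_antisymm (hΓ.proj_le a) (hΓ.le_proj h le_rfl)⟩

theorem IsBranch.mem_of_le (hΓ : IsBranch Γ) {a b : T} (hb : b ∈ Γ) (hab : a ≤ b) : a ∈ Γ := by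
  have hc : IsChain (· ≤ ·) (insert a Γ) := hΓ.1.insert fun g hg _ => by
    rcases hΓ.1.total hb hg with h | h
    · exact Or.inl (hab.trans h)
    · exact le_or_le_of_le hab h
  exact (hΓ.2 hc (Set.subset_insert a Γ)).symm ▸ Set.mem_insert a Γ

/-- Below a point of the branch which is not below `a`, the projection of `a` is a meet. -/
theorem IsBranch.proj_eq_inf (hΓ : IsBranch Γ) {a t : T} (ht : t ∈ Γ) (h : ¬ t ≤ a) :
    branchProj Γ a = a ⊓ t := by
  refine le_antisymm (le_inf (hΓ.proj_le a) ?_)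
    (hΓ.le_proj (hΓ.mem_of_le ht inf_le_right) inf_le_left)
  exact (hΓ.1.total (hΓ.proj_mem a) ht).resolve_right fun h' => h (h'.trans (hΓ.proj_le a))

theorem IsBranch.exists_not_le (hΓ : IsBranch Γ) [Nonempty T] (habove : ∀ x : T, ∃ y, x < y)
    {F : Set T} (hF : F.Finite) : ∃ t ∈ Γ, ∀ b ∈ F, ¬ t ≤ b := by
  have hne : Γ.Nonempty := ⟨_, hΓ.proj_mem (Classical.arbitrary T)⟩
  have hmax : ∀ x ∈ Γ, ∃ y ∈ Γ, x < y := by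
    intro x hx
    by_contra! hcon
    obtain ⟨y, hy⟩ := habove x
    have hc : IsChain (· ≤ ·) (insert y Γ) := hΓ.1.insert fun g hg _ => Or.inr (by
      rcases hΓ.1.total hx hg with h | h
      · exact (h.eq_of_not_lt (hcon g hg)) ▸ hy.le
      · exact h.trans hy.le)
    have hyΓ : y ∈ Γ := (hΓ.2 hc (Set.subset_insert y Γ)).symm ▸ Set.mem_insert y Γ
    exact hcon y hyΓ hy
  induction F, hF using Set.Finite.induction_on with
  | empty => exact ⟨_, hne.some_mem, fun _ h => h.elim⟩
  | @insert a s _ _ ih =>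
    obtain ⟨t, ht, hts⟩ := ih
    obtain ⟨u, hu, hau⟩ := hmax _ (hΓ.proj_mem a)
    have hua : ¬ u ≤ a := fun h => (hau.trans_le (hΓ.le_proj hu h)).false
    rcases hΓ.1.total ht hu with h | h
    · refine ⟨u, hu, ?_⟩
      rintro b (rfl | hb)
      · exact hua
      · exact fun h' => hts b hb (h.trans h')
    · refine ⟨t, ht, ?_⟩
      rintro b (rfl | hb)
      · exact fun h' => hua (h.trans h')
      · exact hts b hb

namespace BranchExt

variable {hΓ : IsBranch Γ}

/-- The order on the extension. -/
def le : BranchExt hΓ → BranchExt hΓ → Prop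
  | some a, some b => a ≤ b
  | some a, none => a ∈ Γ
  | none, some _ => False
  | none, none => True

/-- The meet on the extension. -/
noncomputable def inf : BranchExt hΓ → BranchExt hΓ → BranchExt hΓ
  | some a, some b => of hΓ (a ⊓ b)
  | some a, none => of hΓ (branchProj Γ a)
  | none, some b => of hΓ (branchProj Γ b)
  | none, none => top hΓ

noncomputable instance : SemilatticeInf (BranchExt hΓ) where
  le := le
  inf := inf
  le_refl := by
    rintro (_ | a)
    · trivial
    · exact le_refl a
  le_trans := by
    rintro (_ | a) (_ | b) (_ | c) hab hbc
    · trivial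
    · exact hbc
    · trivial
    · exact hab.elim
    · exact hab
    · exact hbc.elim
    · exact hΓ.mem_of_le hbc hab
    · exact le_trans (α := T) hab hbc
  le_antisymm := by
    rintro (_ | a) (_ | b) hab hba
    · rfl
    · exact hab.elim
    · exact hba.elim
    · exact congrArg (of hΓ) (le_antisymm (α := T) hab hba)
  inf_le_left := by
    rintro (_ | a) (_ | b)
    · trivial
    · exact hΓ.proj_mem b
    · exact hΓ.proj_le a
    · exact inf_le_left (α := T)
  inf_le_right := by
    rintro (_ | a) (_ | b)
    · trivial
    · exact hΓ.proj_le b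
    · exact hΓ.proj_mem a
    · exact inf_le_right (α := T)
  le_inf := by
    rintro (_ | a) (_ | b) (_ | c) hab hac
    · trivial
    · exact hac
    · exact hab
    · exact hab
    · exact hab
    · exact hΓ.le_proj hab hac
    · exact hΓ.le_proj hac hab
    · exact le_inf (α := T) hab hac

theorem of_le_of {a b : T} : of hΓ a ≤ of hΓ b ↔ a ≤ b := Iff.rfl

theorem of_le_top {a : T} : of hΓ a ≤ top hΓ ↔ a ∈ Γ := Iff.rfl

theorem not_top_le_of {a : T} : ¬ top hΓ ≤ of hΓ a := fun h => h

theorem of_inf_of (a b : T) : of hΓ a ⊓ of hΓ b = of hΓ (a ⊓ b) := rfl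

theorem of_inf_top (a : T) : of hΓ a ⊓ top hΓ = of hΓ (branchProj Γ a) := rfl

theorem top_inf_of (a : T) : top hΓ ⊓ of hΓ a = of hΓ (branchProj Γ a) := rfl

theorem not_top_lt (s : BranchExt hΓ) : ¬ top hΓ < s := by
  intro h
  rcases cases s with rfl | ⟨a, rfl⟩
  · exact h.false
  · exact not_top_le_of h.le

theorem of_lt_of {a b : T} : of hΓ a < of hΓ b ↔ a < b := by
  rw [lt_iff_le_not_ge, lt_iff_le_not_ge, of_le_of, of_le_of]

instance : IsMeetTree (BranchExt hΓ) where
  isChain_Iio s x hx y hy _ := by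
    rcases cases x with rfl | ⟨a, rfl⟩
    · exact absurd hx (not_top_lt s)
    rcases cases y with rfl | ⟨b, rfl⟩
    · exact absurd hy (not_top_lt s)
    rcases cases s with rfl | ⟨c, rfl⟩
    · exact hΓ.1.total (of_le_top.1 (le_of_lt hx)) (of_le_top.1 (le_of_lt hy))
    · have hx' : a ≤ c := of_le_of.1 (show of hΓ a < of hΓ c from hx).le
      have hy' : b ≤ c := of_le_of.1 (show of hΓ b < of hΓ c from hy).le
      have hxy : a ≤ b ∨ b ≤ a := le_or_le_of_le hx' hy'
      exact hxy

instance [Countable T] : Countable (BranchExt hΓ) := inferInstanceAs (Countable (Option T))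

theorem isRichTree [Nonempty T] (hrich : IsRichTree T) (habove : ∀ x : T, ∃ y, x < y) :
    IsRichTree (BranchExt hΓ) where
  dense x y hxy := by
    rcases cases x with rfl | ⟨a, rfl⟩
    · exact absurd hxy (not_top_lt _)
    rcases cases y with rfl | ⟨b, rfl⟩
    · obtain ⟨t, ht, hta⟩ := hΓ.exists_not_le habove (Set.finite_singleton a)
      have hat : a ≤ t := (hΓ.1.total (of_le_top.1 hxy.le) ht).resolve_right (hta a rfl)
      exact ⟨of hΓ t, of_lt_of.2 (lt_of_le_not_ge hat (hta a rfl)),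
        lt_of_le_of_ne (of_le_top.2 ht) (of_ne_top t)⟩
    · obtain ⟨z, hz⟩ := hrich.dense a b (of_lt_of.1 hxy)
      exact ⟨of hΓ z, of_lt_of.2 hz.1, of_lt_of.2 hz.2⟩
  lower x := by
    rcases cases x with rfl | ⟨a, rfl⟩
    · obtain ⟨t, ht, -⟩ := hΓ.exists_not_le habove Set.finite_empty
      exact ⟨of hΓ t, lt_of_le_of_ne (of_le_top.2 ht) (of_ne_top t)⟩
    · obtain ⟨y, hy⟩ := hrich.lower a
      exact ⟨of hΓ y, of_lt_of.2 hy⟩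
  cone x y hxy F hF := by
    rcases cases x with rfl | ⟨u, rfl⟩
    · exact absurd hxy (not_top_lt _)
    obtain ⟨a, ha⟩ := habove u
    obtain ⟨t, ht, htu⟩ := hΓ.exists_not_le habove (Set.finite_singleton u)
    obtain ⟨z, huz, hz⟩ := hrich.cone u a ha (insert t (of hΓ ⁻¹' F))
      ((hF.preimage of_injective.injOn).insert t)
    refine ⟨of hΓ z, of_lt_of.2 huz, fun b hb => ?_⟩
    rcases cases b with rfl | ⟨b, rfl⟩
    · have htz : ¬ t ≤ z := fun h => htu u rfl (by
        rw [← inf_eq_right, ← hz t (Or.inl rfl), inf_eq_right.2 h])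
      rw [of_inf_top, of_inf_top, hΓ.proj_eq_inf ht htz, hΓ.proj_eq_inf ht (htu u rfl),
        hz t (Or.inl rfl)]
    · rw [of_inf_of, of_inf_of, hz b (Or.inr hb)]

/-- The extension to `BranchExt hΓ` of an automorphism of `T` preserving `Γ`. -/
def lift (hΓ : IsBranch Γ) (σ : T ≃o T) (hσ : ∀ x, σ x ∈ Γ ↔ x ∈ Γ) :
    BranchExt hΓ ≃o BranchExt hΓ where
  toEquiv := Equiv.optionCongr σ.toEquiv
  map_rel_iff' := by
    rintro (_ | a) (_ | b)
    · exact Iff.rfl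
    · exact Iff.rfl
    · exact hσ a
    · exact σ.le_iff_le

theorem lift_of (σ : T ≃o T) (hσ : ∀ x, σ x ∈ Γ ↔ x ∈ Γ) (a : T) :
    lift hΓ σ hσ (of hΓ a) = of hΓ (σ a) := rfl

theorem isPointExtension (hΓ : IsBranch Γ) : IsPointExtension (top hΓ) (of hΓ) :=
  ⟨of_injective, fun _ _ => rfl, fun s hs => (cases s).resolve_left hs⟩

theorem movesAll_lift {σ : T ≃o T} (hσ : ∀ x, σ x ∈ Γ ↔ x ∈ Γ)
    (hlt : StrictlyIncreasingOn σ Γ) : MovesAll (top hΓ) (· ≤ ·) (lift hΓ σ hσ) := by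
  refine ⟨fun x hx => ?_, fun _ _ x => not_top_lt _⟩
  rcases cases x with rfl | ⟨a, rfl⟩
  · exact absurd hx (not_top_lt _)
  · have := of_lt_of (hΓ := hΓ).2 (hlt a (of_le_top.1 hx.le))
    exact ⟨this.le, this.ne⟩

end BranchExt

end Branch

/-! ### Generic meet-tree expansions with a distinguished branch -/

section Branched

open FirstOrder.Language FirstOrder.Language.Structure

variable {LR : FirstOrder.Language.{u, v}} {T : Type w} [SR : LR.Structure T] [SemilatticeInf T]

theorem exists_gt [LR.IsRelational] [Countable T] [Infinite T]
    (hT : IsGenericMeetTreeExpansion LR T) (x : T) : ∃ y, x < y :=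
  let ⟨y, hy, _⟩ := exists_cone_family hT x 1
  ⟨y 0, hy 0⟩

variable [IsMeetTree T] {Γ : Set T}

/-- A set closed under meets and the projection to the branch. -/
structure BranchClosed (Γ X : Set T) : Prop where
  inf : ∀ {x y}, x ∈ X → y ∈ X → x ⊓ y ∈ X
  proj : ∀ {x}, x ∈ X → branchProj Γ x ∈ X

theorem branchClosed_preimage (hΓ : IsBranch Γ) {X : Set (BranchExt hΓ)}
    (hX : TreeClosed (BranchExt.top hΓ) X) : BranchClosed Γ (BranchExt.of hΓ ⁻¹' X) :=
  ⟨fun hx hy => hX.inf hx hy, fun hx => hX.inf hx hX.base⟩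

theorem exists_branchClosed (hΓ : IsBranch Γ) {X : Set T} (hX : X.Finite) :
    ∃ W, X ⊆ W ∧ W.Finite ∧ BranchClosed Γ W := by
  have h := treeClosed_treeClosure (BranchExt.top hΓ) (hX.image (BranchExt.of hΓ))
  exact ⟨BranchExt.of hΓ ⁻¹' treeClosure (BranchExt.top hΓ) (BranchExt.of hΓ '' X),
    fun x hx => subset_treeClosure _ _ ⟨x, hx, rfl⟩,
    h.finite.preimage BranchExt.of_injective.injOn, branchClosed_preimage hΓ h⟩

theorem proj_comm_of_mem_iff (hΓ : IsBranch Γ) {σ : T ≃o T} (hσ : ∀ x, σ x ∈ Γ ↔ x ∈ Γ) (x : T) :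
    branchProj Γ (σ x) = σ (branchProj Γ x) := by
  refine le_antisymm ?_ (hΓ.le_proj ((hσ _).2 (hΓ.proj_mem x)) (σ.monotone (hΓ.proj_le x)))
  rw [← σ.symm_apply_le]
  refine hΓ.le_proj ?_ ?_
  · rw [← hσ, σ.apply_symm_apply]
    exact hΓ.proj_mem _
  · rw [σ.symm_apply_le]
    exact hΓ.proj_le _

theorem mem_iff_of_proj_comm (hΓ : IsBranch Γ) {σ : T → T} (hinj : Function.Injective σ)
    (hσ : ∀ x, branchProj Γ (σ x) = σ (branchProj Γ x)) (x : T) : σ x ∈ Γ ↔ x ∈ Γ := by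
  rw [← hΓ.proj_eq_self, ← hΓ.proj_eq_self, hσ, hinj.eq_iff]

theorem lift_mem_pointedAut (hΓ : IsBranch Γ) {σ : T ≃o T} (hσ : ∀ x, σ x ∈ Γ ↔ x ∈ Γ)
    (hR : RelPreserving LR Set.univ σ) :
    BranchExt.lift hΓ σ hσ ∈ pointedAut LR (BranchExt.isPointExtension hΓ) := by
  refine ⟨rfl, fun n R x y _ hy => ?_⟩
  rw [show y = σ ∘ x from funext fun i => BranchExt.of_injective (hy i)]
  exact hR n R x fun _ => trivial

variable [LR.IsRelational] [Countable T] [Infinite T]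

/-- An automorphism which commutes with the projection on a finite closed set can be changed
outside of this set to commute with the projection on a larger set. -/
theorem exists_proj_comm_extension (hT : IsGenericMeetTreeExpansion LR T) (hΓ : IsBranch Γ)
    (σ : T ≃[LR.sum treeLang] T) {X W : Set T} (hX : X.Finite) (hXc : BranchClosed Γ X)
    (hσ : ∀ x ∈ X, branchProj Γ (σ x) = σ (branchProj Γ x)) (hW : W.Finite) (hXW : X ⊆ W) :
    ∃ τ : T ≃[LR.sum treeLang] T, (∀ x ∈ X, τ x = σ x) ∧
      ∀ x ∈ W, branchProj Γ (τ x) = τ (branchProj Γ x) := by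
  classical
  obtain ⟨s, hs, hsW⟩ := hΓ.exists_not_le (exists_gt hT) hW
  have hσX := hX.image σ
  have hle : ∀ z ∈ σ '' X, ¬ σ s ≤ z := by
    rintro _ ⟨x, hx, rfl⟩ h
    exact hsW x (hXW hx) ((le_equiv_iff σ).1 h)
  obtain ⟨a, ha, haX⟩ := hΓ.exists_not_le (exists_gt hT) hσX
  obtain ⟨t, ht, htX⟩ := hΓ.exists_not_le (exists_gt hT) ((hσX.insert (σ s)).insert a)
  have hat : a ≤ t := (hΓ.1.total ha ht).resolve_right (htX a (Or.inl rfl))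
  have hproj : ∀ z ∈ σ '' X, branchProj Γ z ∈ σ '' X := by
    rintro _ ⟨x, hx, rfl⟩
    exact ⟨_, hXc.proj hx, (hσ x hx).symm⟩
  have hinfX : ∀ {x y}, x ∈ σ '' X → y ∈ σ '' X → x ⊓ y ∈ σ '' X := by
    rintro _ _ ⟨x, hx, rfl⟩ ⟨y, hy, rfl⟩
    exact ⟨_, hXc.inf hx hy, map_inf_of_equiv σ x y⟩
  have hσs : ∀ z ∈ σ '' X, z ⊓ σ s = branchProj Γ z := by
    rintro _ ⟨x, hx, rfl⟩
    rw [hσ x hx, hΓ.proj_eq_inf hs (hsW x (hXW hx)), map_inf_of_equiv]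
  have htz : ∀ z ∈ σ '' X, z ⊓ t = branchProj Γ z := fun z hz =>
    (hΓ.proj_eq_inf ht (htX z (Or.inr (Or.inr hz)))).symm
  have haz : ∀ z ∈ σ '' X, z ⊓ a = branchProj Γ z := fun z hz =>
    (hΓ.proj_eq_inf ha (haX z hz)).symm
  have hsσX : σ s ∉ σ '' X := fun h => hle _ h le_rfl
  obtain ⟨y, hy, hpos, hrel⟩ := exists_position_type hT (B := insert t (σ '' X)) (hσX.insert t)
    (by
      rintro x z (rfl | hx) (rfl | hz)
      · exact Or.inl (inf_idem _)
      · rw [inf_comm, htz z hz]; exact Or.inr (hproj z hz)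
      · rw [htz x hx]; exact Or.inr (hproj x hx)
      · exact Or.inr (hinfX hx hz)) (a := a) (m := σ s)
    (by
      rintro (rfl | h)
      · exact htX a (Or.inl rfl) le_rfl
      · exact haX a h le_rfl)
    (by
      rintro b (rfl | hb)
      · exact Or.inl (inf_eq_left.2 hat)
      · rw [inf_comm, haz b hb]; exact Or.inr (Or.inr (hproj b hb)))
    (by
      rintro (h | h)
      · exact htX _ (Or.inr (Or.inl rfl)) h.ge
      · exact hsσX h)
  have hyt : y ≤ t := by
    rcases hpos t (Or.inl rfl) with h | h
    · exact h.2
    · exact absurd hat h.1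
  have hyΓ : y ∈ Γ := hΓ.mem_of_le ht hyt
  have hyz : ∀ z ∈ σ '' X, z ⊓ y = branchProj Γ z := fun z hz => by
    rcases hpos z (Or.inr hz) with h | h
    · exact absurd h.1 (haX z hz)
    · rw [inf_comm, ← h.2.2, inf_comm, haz z hz]
  have hyX : y ∉ σ '' X := fun h => hy (Or.inr h)
  have hne : ∀ z ∈ σ '' X, z ≠ σ s := fun z hz h => hsσX (h ▸ hz)
  have hfX : ∀ z ∈ σ '' X, Function.update id (σ s) y z = z := fun z hz =>
    Function.update_of_ne (hne z hz) _ _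
  have hfs : Function.update id (σ s) y (σ s) = y := Function.update_self _ _ _
  obtain ⟨g, hg⟩ := exists_automorphism hT (X := insert (σ s) (σ '' X)) (hσX.insert _)
    (f := Function.update id (σ s) y)
    (by
      rintro x z (rfl | hx) (rfl | hz)
      · exact Or.inl (inf_idem _)
      · rw [inf_comm, hσs z hz]; exact Or.inr (hproj z hz)
      · rw [hσs x hx]; exact Or.inr (hproj x hx)
      · exact Or.inr (hinfX hx hz))
    (by
      rintro x (rfl | hx) z (rfl | hz) hxz
      · rfl
      · rw [hfs, hfX z hz] at hxz
        exact absurd (hxz ▸ hz) hyX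
      · rw [hfs, hfX x hx] at hxz
        exact absurd (hxz ▸ hx) hyX
      · rwa [hfX x hx, hfX z hz] at hxz)
    (by
      rintro x (rfl | hx) z (rfl | hz)
      · rw [inf_idem, inf_idem]
      · rw [inf_comm, hσs z hz, hfX _ (hproj z hz), hfs, hfX z hz, inf_comm, hyz z hz]
      · rw [hσs x hx, hfX _ (hproj x hx), hfs, hfX x hx, hyz x hx]
      · rw [hfX _ (hinfX hx hz), hfX x hx, hfX z hz])
    (by
      intro n R x hx
      have h1 := hrel n R (Function.update id (σ s) y ∘ x) fun i => by
        rcases hx i with h | h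
        · rw [Function.comp_apply, h, hfs]; exact Or.inl rfl
        · rw [Function.comp_apply, hfX _ h]; exact Or.inr (Or.inr h)
      rw [← h1]
      refine iff_of_eq (congrArg _ (funext fun i => ?_))
      rw [Function.comp_apply, Function.comp_apply]
      rcases hx i with h | h
      · rw [h, hfs, Function.update_self]
      · rw [hfX _ h, Function.update_of_ne (fun h' : x i = y => hyX (show y ∈ σ '' X from h' ▸ h)), id])
  refine ⟨g.comp σ, fun x hx => (hg _ (Or.inr ⟨x, hx, rfl⟩)).trans (hfX _ ⟨x, hx, rfl⟩),
    fun x hx => ?_⟩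
  have hgs : (g.comp σ) s = y := (hg _ (Or.inl rfl)).trans hfs
  rw [hΓ.proj_eq_inf hs (hsW x hx), map_inf_of_equiv, hgs]
  refine hΓ.proj_eq_inf hyΓ fun h => hsW x hx ?_
  rwa [← hgs, le_equiv_iff] at h

theorem exists_branch_automorphism (hT : IsGenericMeetTreeExpansion LR T) (hΓ : IsBranch Γ)
    {σ₀ : T ≃[LR.sum treeLang] T} {X₀ : Set T} (hX₀ : X₀.Finite) (hX₀c : BranchClosed Γ X₀)
    (hσ₀ : ∀ x ∈ X₀, branchProj Γ (σ₀ x) = σ₀ (branchProj Γ x)) :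
    ∃ σ : T ≃o T, (∀ x, σ x ∈ Γ ↔ x ∈ Γ) ∧ RelPreserving LR Set.univ σ ∧
      ∀ x ∈ X₀, σ x = σ₀ x := by
  let Cond : Equiv.Perm T → Set T → Prop := fun π X => BranchClosed Γ X ∧
    ∃ σ : T ≃[LR.sum treeLang] T, σ.toEquiv = π ∧
      ∀ x ∈ X, branchProj Γ (σ x) = σ (branchProj Γ x)
  have hdom : ∀ y (π : Equiv.Perm T) X, X.Finite → Cond π X → ∃ π' X', X'.Finite ∧ Cond π' X' ∧
      X ⊆ X' ∧ (∀ x ∈ X, π' x = π x) ∧ y ∈ X' := by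
    rintro y _ X hX ⟨hXc, σ, rfl, hσ⟩
    obtain ⟨W, hyW, hW, hWc⟩ := exists_branchClosed hΓ (hX.insert y)
    have hXW : X ⊆ W := (Set.subset_insert _ _).trans hyW
    obtain ⟨τ, hτ, hτW⟩ := exists_proj_comm_extension hT hΓ σ hX hXc hσ hW hXW
    exact ⟨τ.toEquiv, W, hW, ⟨hWc, τ, rfl, hτW⟩, hXW, hτ, hyW (Or.inl rfl)⟩
  have hsymm : ∀ (π : Equiv.Perm T) X, Cond π X → Cond π.symm (π '' X) := by
    rintro _ X ⟨hXc, σ, rfl, hσ⟩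
    refine ⟨⟨?_, ?_⟩, σ.symm, rfl, ?_⟩
    · rintro _ _ ⟨x, hx, rfl⟩ ⟨y, hy, rfl⟩
      exact ⟨_, hXc.inf hx hy, map_inf_of_equiv σ x y⟩
    · rintro _ ⟨x, hx, rfl⟩
      exact ⟨_, hXc.proj hx, (hσ x hx).symm⟩
    · rintro _ ⟨x, hx, rfl⟩
      change branchProj Γ (σ.symm (σ x)) = σ.symm (branchProj Γ (σ x))
      rw [hσ x hx, σ.symm_apply_apply, σ.symm_apply_apply]
  obtain ⟨π, hπ₀, -, hloc⟩ := exists_perm_of_approximations (ι := Empty) Cond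
    (fun i _ _ => i.elim) (fun i => i.elim) hdom (by
      intro y π X hX hc
      obtain ⟨π', X', hX', hc', hXX', hagree, hy⟩ := hdom y π.symm (π '' X) (hX.image π)
        (hsymm π X hc)
      refine ⟨π'.symm, π' '' X', hX'.image π', hsymm π' X' hc', fun x hx => ?_, fun x hx => ?_,
        (π'.symm_image_image X').symm ▸ hy⟩
      · have := hagree _ ⟨x, hx, rfl⟩
        rw [π.symm_apply_apply] at this
        exact ⟨π x, hXX' ⟨x, hx, rfl⟩, this⟩
      · have := hagree _ ⟨x, hx, rfl⟩
        rw [π.symm_apply_apply] at this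
        rw [Equiv.symm_apply_eq, this]) (σ₀ := σ₀.toEquiv) hX₀ ⟨hX₀c, σ₀, rfl, hσ₀⟩
  have hle : ∀ x y, π x ≤ π y ↔ x ≤ y := fun x y => by
    obtain ⟨_, X, ⟨-, σ, rfl, -⟩, hF, hσ⟩ := hloc {x, y} (Set.toFinite _)
    rw [hσ x (hF (Or.inl rfl)), hσ y (hF (Or.inr rfl))]
    exact le_equiv_iff σ
  refine ⟨⟨π, hle _ _⟩, mem_iff_of_proj_comm hΓ π.injective fun x => ?_, fun n R x _ => ?_, hπ₀⟩
  · obtain ⟨_, X, ⟨hXc, σ, rfl, hσX⟩, hF, hσ⟩ := hloc {x} (Set.finite_singleton _)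
    have hx := hF rfl
    change branchProj Γ (π x) = π (branchProj Γ x)
    rw [hσ x hx, hσ _ (hXc.proj hx)]
    exact hσX x hx
  · obtain ⟨_, X, ⟨-, σ, rfl, -⟩, hF, hσ⟩ := hloc (Set.range x) (Set.finite_range _)
    have : π ∘ x = σ ∘ x := funext fun i => hσ _ (hF ⟨i, rfl⟩)
    change RelMap R (π ∘ x) ↔ _
    rw [this]
    exact relMap_equiv σ R x

theorem isHomogeneousExtension_branch (hT : IsGenericMeetTreeExpansion LR T) (hΓ : IsBranch Γ) :
    IsHomogeneousExtension LR (BranchExt.top hΓ) (BranchExt.of hΓ) where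
  toIsPointExtension := BranchExt.isPointExtension hΓ
  rich := BranchExt.isRichTree (isRichTree hT) (exists_gt hT)
  hom {X f} hX hfγ hf hinf hR := by
    have hXc := branchClosed_preimage hΓ hX
    have hXf := hX.finite.preimage (BranchExt.of_injective (hΓ := hΓ)).injOn
    have hex : ∀ x : T, ∃ y, BranchExt.of hΓ x ∈ X → BranchExt.of hΓ y = f (BranchExt.of hΓ x) := by
      intro x
      by_cases hx : BranchExt.of hΓ x ∈ X
      · rcases BranchExt.cases (f (BranchExt.of hΓ x)) with h | ⟨y, hy⟩
        · rw [← hfγ] at h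
          exact absurd (hf hx hX.base h) (BranchExt.of_ne_top x)
        · exact ⟨y, fun _ => hy⟩
      · exact ⟨x, fun h => absurd h hx⟩
    choose f' hf' using hex
    obtain ⟨σ₀, hσ₀⟩ := exists_automorphism hT hXf hXc.inf (f := f')
      (fun x hx y hy hxy => BranchExt.of_injective (hf hx hy (by
        rw [← hf' x hx, ← hf' y hy, hxy])))
      (fun x hx y hy => BranchExt.of_injective (hΓ := hΓ) (by
        rw [hf' _ (hXc.inf hx hy), ← BranchExt.of_inf_of, ← BranchExt.of_inf_of, hinf _ hx _ hy,
          hf' x hx, hf' y hy]))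
      (fun n R x hx => hR n R x (f' ∘ x) hx fun i => hf' _ (hx i))
    obtain ⟨σ, hσ, hσR, hσX⟩ := exists_branch_automorphism hT hΓ hXf hXc (σ₀ := σ₀) fun x hx =>
      BranchExt.of_injective (hΓ := hΓ) (by
        rw [hσ₀ x hx, hσ₀ _ (hXc.proj hx), hf' _ (hXc.proj hx), ← BranchExt.of_inf_top,
          ← BranchExt.of_inf_top, hinf _ hx _ hX.base, hf' x hx, hfγ])
    refine ⟨_, lift_mem_pointedAut hΓ hσ hσR, fun s hs => ?_⟩
    rcases BranchExt.cases s with rfl | ⟨x, rfl⟩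
    · exact hfγ.symm
    · rw [BranchExt.lift_of, hσX x hs, hσ₀ x hs, hf' x hs]
  position {_ B a m} hB ha haB hm := by
    have hBc := branchClosed_preimage hΓ hB
    have hBf := hB.finite.preimage (BranchExt.of_injective (hΓ := hΓ)).injOn
    rcases BranchExt.cases a with rfl | ⟨a, rfl⟩
    · exact absurd hB.base ha
    obtain ⟨t, ht, htB⟩ := hΓ.exists_not_le (exists_gt hT) ((hBf.insert m).insert a)
    have htb : ∀ b ∈ BranchExt.of hΓ ⁻¹' B, b ⊓ t = branchProj Γ b := fun b hb =>
      (hΓ.proj_eq_inf ht (htB b (Or.inr (Or.inr hb)))).symm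
    have hat : a ⊓ t = branchProj Γ a := (hΓ.proj_eq_inf ht (htB a (Or.inl rfl))).symm
    have haB' : ∀ b, BranchExt.of hΓ (a ⊓ b) ∈ insert (BranchExt.of hΓ a) B →
        a ⊓ b ∈ insert a (insert t (BranchExt.of hΓ ⁻¹' B)) := fun b hb =>
      hb.imp (fun h => BranchExt.of_injective h) Or.inr
    obtain ⟨y, hy, hpos, hrel⟩ := exists_position_type hT (B := insert t (BranchExt.of hΓ ⁻¹' B))
      (hBf.insert t) (by
        rintro x z (rfl | hx) (rfl | hz)
        · exact Or.inl (inf_idem _)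
        · rw [inf_comm, htb z hz]; exact Or.inr (hBc.proj hz)
        · rw [htb x hx]; exact Or.inr (hBc.proj hx)
        · exact Or.inr (hBc.inf hx hz)) (a := a) (m := m)
      (by
        rintro (h | h)
        · exact htB a (Or.inl rfl) h.ge
        · exact ha h)
      (by
        rintro b (rfl | hb)
        · refine haB' b ?_
          rw [hat]
          exact haB _ hB.base
        · exact haB' b (haB _ hb))
      (by
        rintro (h | h)
        · exact htB m (Or.inr (Or.inl rfl)) h.ge
        · exact hm h)
    refine ⟨y, fun h => hy (Or.inr h), fun s hs => ?_, fun n R x hx => hrel n R x fun i =>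
      (hx i).imp id Or.inr⟩
    rcases BranchExt.cases s with rfl | ⟨b, rfl⟩
    · rcases hpos t (Or.inl rfl) with h | h
      · exact Or.inl ⟨hΓ.mem_of_le ht h.1, hΓ.mem_of_le ht h.2⟩
      · have hty : ¬ t ≤ y := fun h' => htB a (Or.inl rfl) (by
          rw [← inf_eq_right, h.2.2, inf_eq_right.2 h'])
        refine Or.inr ⟨fun h' => ?_, fun h' => ?_, ?_⟩
        · exact (hΓ.1.total h' ht).elim h.1 (htB a (Or.inl rfl))
        · exact (hΓ.1.total h' ht).elim h.2.1 hty
        · rw [BranchExt.of_inf_top, BranchExt.of_inf_top, ← hat, h.2.2, hΓ.proj_eq_inf ht hty]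
    · rcases hpos b (Or.inr hs) with h | h
      · exact Or.inl h
      · exact Or.inr ⟨h.1, h.2.1, congrArg _ h.2.2⟩

end Branched

section Branched

open FirstOrder.Language FirstOrder.Language.Structure

variable {LR : FirstOrder.Language.{u, v}} {T : Type w} [SR : LR.Structure T] [SemilatticeInf T]
  {Γ : Set T}

theorem gen_branched_subset {X Y : Set T} (hY : BranchClosed Γ Y) (hXY : X ⊆ Y) :
    gen (branchedStructure Γ) X ⊆ Y := by
  let _ := branchedStructure Γ
  let Z : branchedLang.Substructure T := ⟨Y, by
    intro n F
    exact match n, F with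
      | _, BranchedFunctions.meet => fun x hx => hY.inf (hx 0) (hx 1)
      | _, BranchedFunctions.proj => fun x hx => hY.proj (hx 0)⟩
  exact (Substructure.closure_le (S := Z)).2 hXY

variable [IsMeetTree T]

theorem gen_expBranchedStructure [LR.IsRelational] (hΓ : IsBranch Γ) {X : Set T} (hX : X.Finite) :
    gen (expBranchedStructure LR Γ) X =
      BranchExt.of hΓ ⁻¹' treeClosure (BranchExt.top hΓ) (BranchExt.of hΓ '' X) := by
  let _ := expBranchedStructure LR Γ
  have hcl := branchClosed_preimage hΓ
    (treeClosed_treeClosure (BranchExt.top hΓ) (hX.image (BranchExt.of hΓ)))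
  apply Set.Subset.antisymm
  · let Z : (LR.sum branchedLang).Substructure T :=
      ⟨BranchExt.of hΓ ⁻¹' treeClosure (BranchExt.top hΓ) (BranchExt.of hΓ '' X), by
        rintro n (F | F)
        · exact isEmptyElim F
        · exact match n, F with
            | _, BranchedFunctions.meet => fun x hx => hcl.inf (hx 0) (hx 1)
            | _, BranchedFunctions.proj => fun x hx => hcl.proj (hx 0)⟩
    exact (Substructure.closure_le (S := Z)).2 fun x hx => subset_treeClosure _ _ ⟨x, hx, rfl⟩
  · let Z := Substructure.closure (LR.sum branchedLang) X
    have hX : ∀ x ∈ X, x ∈ Z := fun x hx => Substructure.subset_closure hx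
    have hproj : ∀ x ∈ X, branchProj Γ x ∈ Z := fun x hx =>
      Z.fun_mem (Sum.inr BranchedFunctions.proj) ![x] fun i => by
        fin_cases i
        exact hX x hx
    rintro z ⟨s, rfl | ⟨x, hx, rfl⟩, t, rfl | ⟨y, hy, rfl⟩, hz⟩
    · rw [inf_idem] at hz
      exact absurd hz (BranchExt.of_ne_top z)
    · rw [BranchExt.top_inf_of] at hz
      rw [BranchExt.of_injective hz]
      exact hproj y hy
    · rw [BranchExt.of_inf_top] at hz
      rw [BranchExt.of_injective hz]
      exact hproj x hx
    · rw [BranchExt.of_inf_of] at hz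
      rw [BranchExt.of_injective hz]
      refine Z.fun_mem (Sum.inr BranchedFunctions.meet) ![x, y] fun i => ?_
      fin_cases i
      · exact hX x hx
      · exact hX y hy

theorem branchIndep_of_good (hΓ : IsBranch Γ) {A B C : Set (BranchExt hΓ)}
    (hA : TreeClosed (BranchExt.top hΓ) A) (hB : TreeClosed (BranchExt.top hΓ) B)
    (hCA : C ⊆ A) (hCB : C ⊆ B) (h : ∀ a ∈ A, ∀ b ∈ B, Good (· ≤ ·) C a b) :
    BranchIndep Γ (BranchExt.of hΓ ⁻¹' A) (BranchExt.of hΓ ⁻¹' C) (BranchExt.of hΓ ⁻¹' B) := by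
  have hgA := gen_branched_subset (branchClosed_preimage hΓ hA)
    (Set.union_subset subset_rfl (Set.preimage_mono hCA))
  have hgB := gen_branched_subset (branchClosed_preimage hΓ hB)
    (Set.union_subset subset_rfl (Set.preimage_mono hCB))
  have hgC : BranchExt.of hΓ ⁻¹' C ⊆ gen (branchedStructure Γ) (BranchExt.of hΓ ⁻¹' C) := by
    let _ := branchedStructure Γ
    exact Substructure.subset_closure
  refine ⟨fun a ha b hb hba => ?_, fun a ha b hb hproj hab => ?_⟩
  · obtain ⟨c, hc, h1, h2⟩ := (h _ (hgA ha) _ (hgB hb)).1 hba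
    rcases BranchExt.cases c with rfl | ⟨c, rfl⟩
    · exact absurd h2 BranchExt.not_top_le_of
    · exact ⟨c, hgC hc, h1, h2⟩
  · obtain ⟨c, hc, h1⟩ := (h _ (hgA ha) _ (hgB hb)).2.resolve_left fun h' => hab (hgC h')
    rcases BranchExt.cases c with rfl | ⟨c, rfl⟩
    · rw [BranchExt.of_inf_top, BranchExt.of_inf_top, hproj] at h1
      exact absurd rfl h1
    · exact ⟨c, hgC hc, fun h' => h1 (congrArg (BranchExt.of hΓ) h')⟩

theorem mem_iff_of_lift (hΓ : IsBranch Γ) {σ : BranchExt hΓ ≃o BranchExt hΓ}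
    (hσ : σ ∈ pointedAut LR (BranchExt.isPointExtension hΓ)) {τ : T → T}
    (hτ : ∀ t, BranchExt.of hΓ (τ t) = σ (BranchExt.of hΓ t)) (t : T) : τ t ∈ Γ ↔ t ∈ Γ := by
  rw [← BranchExt.of_le_top (hΓ := hΓ), ← BranchExt.of_le_top (hΓ := hΓ), hτ]
  conv_lhs => rw [← hσ.1]
  exact σ.le_iff_le

theorem isInducedStructure_branched [LR.IsRelational] (hΓ : IsBranch Γ) :
    IsInducedStructure (expBranchedStructure LR Γ) (BranchExt.isPointExtension hΓ) LR
      (BranchIndep Γ) where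
  lift σ hσ := by
    obtain ⟨τ, hτ⟩ := exists_lift (BranchExt.isPointExtension hΓ) hσ
    let _ := expBranchedStructure LR Γ
    have hmem := mem_iff_of_lift hΓ hσ hτ
    refine ⟨{ toEquiv := τ.toEquiv, map_fun' := ?_, map_rel' := ?_ }, hτ⟩
    · rintro n (F | F) x
      · exact isEmptyElim F
      · exact match n, F, x with
          | _, BranchedFunctions.meet, x => map_inf_of_equiv τ (x 0) (x 1)
          | _, BranchedFunctions.proj, x =>
            (proj_comm_of_mem_iff hΓ (σ := orderIsoOfEquiv τ) hmem (x 0)).symm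
    · rintro n (R | R) x
      · exact relMap_equiv τ R x
      · exact match n, R, x with
          | _, BranchedRelations.le, x => le_equiv_iff τ
          | _, BranchedRelations.branch, x => hmem (x 0)
  gen_eq X hX := gen_expBranchedStructure hΓ hX
  indep hA hB _ hCA hCB h := branchIndep_of_good hΓ hA hB hCA hCB h

theorem exists_branched_commutator [LR.IsRelational] [Finite (Σ n, LR.Relations n)] [Countable T]
    [Infinite T] (hU : LR.IsUltrahomogeneous T) (hT : IsGenericMeetTreeExpansion LR T)
    {IndR : Set T → Set T → Set T → Prop} (hR : IsFreeWeakIndependence SR IndR)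
    (hΓ : IsBranch Γ) (α : T ≃[LR.sum treeLang] T) (hα : α '' Γ = Γ)
    (hlt : StrictlyIncreasingOn α Γ) :
    ∃ β : T ≃[LR.sum treeLang] T, β '' Γ = Γ ∧
      MovesRightMaximally (expBranchedStructure LR Γ) (BranchedIndep LR IndR Γ)
        (commutator β α) ∧
      MovesLeftMaximally (expBranchedStructure LR Γ) (BranchedIndep LR IndR Γ)
        (commutator α β) := by
  have hmem : ∀ x, orderIsoOfEquiv α x ∈ Γ ↔ x ∈ Γ := fun x => by
    change α x ∈ Γ ↔ _
    conv_lhs => rw [← hα]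
    exact α.injective.mem_set_image
  have hm := BranchExt.movesAll_lift (hΓ := hΓ) hmem hlt
  let _ := expBranchedStructure LR Γ
  obtain ⟨β, β', hβ', hβ, h⟩ := (isHomogeneousExtension_branch hT hΓ).exists_commutator hU hR
    (isInducedStructure_branched hΓ) α
    (lift_mem_pointedAut hΓ hmem fun _ R x _ => relMap_equiv α R x) (fun _ => rfl) hm (hm.inv rfl)
  have hmemβ := mem_iff_of_lift hΓ hβ' hβ
  refine ⟨β, Set.Subset.antisymm ?_ fun x hx => ?_, h⟩
  · rintro _ ⟨x, hx, rfl⟩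
    exact (hmemβ x).2 hx
  · refine ⟨β.symm x, (hmemβ _).1 ?_, β.apply_symm_apply x⟩
    rwa [β.apply_symm_apply]

end Branched

end MeetTree

theorem lemmal (LR : FirstOrder.Language.{u, v}) [LR.IsRelational] [Finite (Σ n, LR.Relations n)]
    (T : Type w) [Countable T] [Infinite T] [SR : LR.Structure T]
    (hM : MeetTree.IsStrongFraisseLimit LR T)
    [SemilatticeInf T] [MeetTree.IsMeetTree T]
    (hT : MeetTree.IsGenericMeetTreeExpansion LR T)
    (IndR : Set T → Set T → Set T → Prop)
    (hR : MeetTree.IsFreeWeakIndependence SR IndR) :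
    (∀ (γ : T) (α : T ≃[LR.sum MeetTree.treeLang] T),
      MeetTree.IsInfiniteFanAbove α γ → MeetTree.StrictlyIncreasingOn α (Set.Iio γ) →
        ∃ β : T ≃[LR.sum MeetTree.treeLang] T, β γ = γ ∧
          MeetTree.MovesRightMaximally (MeetTree.expPointedStructure LR γ)
            (MeetTree.PointedIndep LR IndR γ) (MeetTree.commutator β α) ∧
          MeetTree.MovesLeftMaximally (MeetTree.expPointedStructure LR γ)
            (MeetTree.PointedIndep LR IndR γ) (MeetTree.commutator α β)) ∧
    (∀ (Γ : Set T), MeetTree.IsBranch Γ → ∀ α : T ≃[LR.sum MeetTree.treeLang] T,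
      α '' Γ = Γ → MeetTree.StrictlyIncreasingOn α Γ →
        ∃ β : T ≃[LR.sum MeetTree.treeLang] T, β '' Γ = Γ ∧
          MeetTree.MovesRightMaximally (MeetTree.expBranchedStructure LR Γ)
            (MeetTree.BranchedIndep LR IndR Γ) (MeetTree.commutator β α) ∧
          MeetTree.MovesLeftMaximally (MeetTree.expBranchedStructure LR Γ)
            (MeetTree.BranchedIndep LR IndR Γ) (MeetTree.commutator α β)) := by
  obtain ⟨_, -, hK⟩ := hM
  exact ⟨fun γ α hα hlt =>
      MeetTree.exists_pointed_commutator hK.ultrahomogeneous hT hR γ α hα hlt,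
    fun Γ hΓ α hα hlt =>
      MeetTree.exists_branched_commutator hK.ultrahomogeneous hT hR hΓ α hα hlt⟩
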